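/- For a positive integer $n$ let $M_n$ be the matching complex of the complete graph on the vertex set $\{1,\dots,n\}$: the simplicial complex whose vertices are the edges of this graph and whose faces are the sets of pairwise disjoint edges. Let $\nu_n=\left\lfloor\frac{n+1}{3}\right\rfloor-1$, and let $\tilde H_*$ denote reduced simplicial homology with integer coefficients. If $n=7$, $n=10$, or $n\ge 12$ with $n\ne 14$, then $\tilde H_{\nu_n}(M_n)$ is a nontrivial (finite) elementary abelian $3$-group; that is, it is a nonzero finite abelian group in which every element $x$ satisfies $3x=0$. -/

import Mathlib

/-- The matching complex `M(G)` of a graph `G`: its vertices are the edges of `G`, and its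
(nonempty) faces are the nonempty finite sets `F` of edges of `G` such that every vertex of `G`
lies in at most one edge of `F`. -/
def matchingComplex {V : Type*} (G : SimpleGraph V) : AbstractSimplicialComplex G.edgeSet where
  faces := {F | F.Nonempty ∧ ∀ v : V, ∀ e ∈ F, ∀ f ∈ F,
    v ∈ (e : Sym2 V) → v ∈ (f : Sym2 V) → e = f}
  isRelLowerSet_faces := fun _ hF =>
    ⟨hF.1, fun _ hts ht => ⟨ht, fun v e he f hf => hF.2 v e (hts he) f (hts hf)⟩⟩
  singleton_mem := fun e => ⟨Finset.singleton_nonempty e, fun v a ha b hb _ _ => by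
    rw [Finset.mem_singleton.mp ha, Finset.mem_singleton.mp hb]⟩

namespace AbstractSimplicialComplex

variable {ι : Type*}

/-- The oriented simplex `v 0 ∧ v 1 ∧ ⋯ ∧ v (k - 1)` on the vertices `v 0, …, v (k - 1)`, as an
element of the exterior algebra of the free abelian group on the vertices. Transposing two entries
changes the sign. For `k = 0` it is the empty simplex `1`. -/
noncomputable def orientedSimplex {k : ℕ} (v : Fin k → ι) : ExteriorAlgebra ℤ (ι →₀ ℤ) :=
  ExteriorAlgebra.ιMulti ℤ k fun i => Finsupp.single (v i) 1

/-- The simplicial boundary operator: the contraction with the linear form that takes the value `1`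
on each vertex. On oriented simplices it is the usual alternating sum of the
facets, see `boundary_orientedSimplex`. -/
noncomputable def boundary (ι : Type*) :
    ExteriorAlgebra ℤ (ι →₀ ℤ) →ₗ[ℤ] ExteriorAlgebra ℤ (ι →₀ ℤ) :=
  CliffordAlgebra.contractLeft (Finsupp.linearCombination ℤ fun _ : ι => (1 : ℤ))

/-- `∂ (v 0 ∧ ⋯ ∧ v k) = ∑ i, (-1) ^ i (v 0 ∧ ⋯ ∧ v i omitted ∧ ⋯ ∧ v k)`. -/
theorem boundary_orientedSimplex {k : ℕ} (v : Fin (k + 1) → ι) :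
    boundary ι (orientedSimplex v) =
      ∑ i : Fin (k + 1), (-1 : ℤ) ^ (i : ℕ) • orientedSimplex (fun j => v (i.succAbove j)) := by
  induction k with
  | zero =>
    simp [boundary, orientedSimplex, ExteriorAlgebra.ιMulti_apply, CliffordAlgebra.contractLeft_ι, ExteriorAlgebra.ι]
  | succ k ih =>
    have h : orientedSimplex v = ExteriorAlgebra.ι ℤ (Finsupp.single (v 0) 1) *
        orientedSimplex (fun j => v j.succ) := by
      simp [orientedSimplex, ExteriorAlgebra.ιMulti_succ_apply, Matrix.vecTail, Function.comp_def]
    have h2 : ∀ i : Fin (k + 1), orientedSimplex (fun j => v (i.succ.succAbove j)) =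
        ExteriorAlgebra.ι ℤ (Finsupp.single (v 0) 1) *
          orientedSimplex (fun j => v (i.succAbove j).succ) := by
      intro i
      simp [orientedSimplex, ExteriorAlgebra.ιMulti_succ_apply, Matrix.vecTail, Function.comp_def]
    have h3 := ih fun j => v j.succ
    rw [h, Fin.sum_univ_succ]
    unfold boundary at h3 ⊢
    unfold ExteriorAlgebra.ι at h2 ⊢
    rw [CliffordAlgebra.contractLeft_ι_mul, h3, Finset.mul_sum, sub_eq_add_neg,
      ← Finset.sum_neg_distrib]
    congr 1
    · simp
    · refine Finset.sum_congr rfl fun i _ => ?_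
      rw [h2 i, Fin.val_succ, pow_succ, mul_neg_one, neg_smul, mul_smul_comm]

theorem boundary_boundary (c : ExteriorAlgebra ℤ (ι →₀ ℤ)) : boundary ι (boundary ι c) = 0 :=
  CliffordAlgebra.contractLeft_contractLeft _ c

/-- The group `C_d(K)` of oriented simplicial `d`-chains with integer coefficients, spanned by the
oriented simplices on the `d`-dimensional faces (those with `d + 1` vertices). The empty set counts
as the unique face of dimension `-1`, so this is the augmented chain complex; the chain groups in
degrees below `-1` are zero. -/
noncomputable def chains (K : AbstractSimplicialComplex ι) (d : ℤ) :
    Submodule ℤ (ExteriorAlgebra ℤ (ι →₀ ℤ)) :=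
  Submodule.span ℤ {c | ∃ (k : ℕ) (v : Fin k ↪ ι), (k : ℤ) = d + 1 ∧
    (k = 0 ∨ Finset.univ.map v ∈ K) ∧ c = orientedSimplex v}

/-- The group `Z_d(K)` of `d`-cycles of the augmented chain complex. -/
noncomputable def cycles (K : AbstractSimplicialComplex ι) (d : ℤ) :
    Submodule ℤ (ExteriorAlgebra ℤ (ι →₀ ℤ)) :=
  K.chains d ⊓ LinearMap.ker (boundary ι)

/-- The group `B_d(K)` of `d`-boundaries of the augmented chain complex. -/
noncomputable def boundaries (K : AbstractSimplicialComplex ι) (d : ℤ) :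
    Submodule ℤ (ExteriorAlgebra ℤ (ι →₀ ℤ)) :=
  (K.chains (d + 1)).map (boundary ι)

/-- Every boundary is a cycle. -/
theorem boundaries_le_cycles (K : AbstractSimplicialComplex ι) (d : ℤ) :
    K.boundaries d ≤ K.cycles d := by
  refine le_inf ?_ ?_
  · rw [boundaries, chains, Submodule.map_span, Submodule.span_le]
    rintro _ ⟨_, ⟨k, v, hk, hv, rfl⟩, rfl⟩
    rcases k with _ | k
    · have : orientedSimplex (v : Fin 0 → ι) = 1 := by simp [orientedSimplex]
      rw [this, boundary, CliffordAlgebra.contractLeft_one]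
      exact Submodule.zero_mem _
    · rw [boundary_orientedSimplex]
      refine Submodule.sum_mem _ fun i _ => Submodule.smul_mem _ _ (Submodule.subset_span ?_)
      refine ⟨k, (Fin.succAboveEmb i).trans v, by push_cast at hk; lia, ?_, rfl⟩
      rcases Nat.eq_zero_or_pos k with h0 | h0
      · exact Or.inl h0
      · refine Or.inr ((K.isRelLowerSet_faces (hv.resolve_left (by lia))).2 ?_ ?_)
        · rw [← Finset.map_map]
          exact Finset.map_subset_map.2 (Finset.subset_univ _)
        · exact ⟨_, Finset.mem_map_of_mem _ (Finset.mem_univ (⟨0, h0⟩ : Fin k))⟩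
  · rw [boundaries, LinearMap.le_ker_iff_map]
    rw [eq_bot_iff]
    rintro _ ⟨_, ⟨c, _, rfl⟩, rfl⟩
    exact boundary_boundary c

/-- The reduced integral simplicial homology group `H̃_d(K) = Z_d(K) / B_d(K)`. -/
abbrev ReducedHomology (K : AbstractSimplicialComplex ι) (d : ℤ) : Type _ :=
  K.cycles d ⧸ (K.boundaries d).submoduleOf (K.cycles d)

end AbstractSimplicialComplex

/-- The number `ν_n = ⌊(n + 1) / 3⌋ - 1`. -/
def matchingNu (n : ℕ) : ℤ := ((n : ℤ) + 1) / 3 - 1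

/-- A finite abelian group, written additively, is an elementary abelian `p`-group if every
element is annihilated by `p`. -/
def IsElementaryAbelianGroup (p : ℕ) (A : Type*) [AddCommGroup A] : Prop :=
  Finite A ∧ ∀ x : A, p • x = 0

open AbstractSimplicialComplex

/-! Homology in degree `ν_n` is that of matchings with `k = ⌊(n + 1) / 3⌋` edges. Looking at the
links at two vertices `u`, `v` shows that a cycle is a sum of boundaries and suspensions `(ua - uv)
* y`, as soon as its double links bound (`cycle_induction`). This gives vanishing on at least `3k +
2` vertices (`cycleOn_le_bdryOn`) and generation by suspensions on `3k` and `3k + 1` vertices.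

On `3k + 1` vertices with `k ≥ 2`, a product of two triads on seven vertices changes by the sign
under all of `S_7`, because the spare vertex can be lent to either triad. Three triads with a common
centre sum to zero, so `3` kills the homology, and transpositions act by `-1`
(`cycleOn_le_signCycles`). Nonvanishing is carried from four vertices upwards: if a suspension
bounds, then the suspended cycle lies in the span of boundaries and sign relations
(`triad_mul_notMem_bdryOn`). On four vertices the quotient by these relations is detected by a
weight in `ZMod 3`.

Nonvanishing on `3k` vertices follows by moving a cycle off a vertex. On `3k + 5` vertices all
cycles come from pentagons times cycles on `3k` vertices (`cycleOn_le_of_pent`), and a suitable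
double link of such a product recovers the second factor. For the exponent everything reduces to
twelve vertices.

There, the kernel of the map to thirteen vertices is generated by cycles missing a vertex and is
killed by `3`; hence `9` kills the homology. Even permutations act trivially on thirteen vertices,
so `3` kills the difference between a cycle and its translates, where `(ℤ/2)^3` translates eight of
the vertices. An explicit identity shows that twice the sum of the eight translates of the relevant
cycle bounds. Together these give `48 x = 0`, and with `9 x = 0` also `3 x = 0`. -/

namespace MatchingChain

/-! ### Matching chains inside the exterior algebra. -/

section

variable {V W : Type*}

/-- The exterior algebra on the edges of the complete graph on `V`. -/
abbrev EdgeAlg (V : Type*) : Type _ :=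
  ExteriorAlgebra ℤ ((⊤ : SimpleGraph V).edgeSet →₀ ℤ)

open Classical in
/-- The basis vector of an edge, and `0` for a degenerate pair. -/
noncomputable def edgeVec (s : Sym2 V) : (⊤ : SimpleGraph V).edgeSet →₀ ℤ :=
  if h : s ∈ (⊤ : SimpleGraph V).edgeSet then Finsupp.single ⟨s, h⟩ 1 else 0

open Classical in
/-- The coordinate form of an edge. -/
noncomputable def edgeForm (s : Sym2 V) : Module.Dual ℤ ((⊤ : SimpleGraph V).edgeSet →₀ ℤ) :=
  if h : s ∈ (⊤ : SimpleGraph V).edgeSet then Finsupp.lapply ⟨s, h⟩ else 0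

/-- The edge `ab` as an element of degree one. -/
noncomputable def edge (a b : V) : EdgeAlg V := ExteriorAlgebra.ι ℤ (edgeVec s(a, b))

/-- The boundary operator. -/
noncomputable abbrev bd : EdgeAlg V →ₗ[ℤ] EdgeAlg V :=
  boundary (⊤ : SimpleGraph V).edgeSet

/-- The coefficient of the edge `ab`, moved to the front. -/
noncomputable def coeff (a b : V) : EdgeAlg V →ₗ[ℤ] EdgeAlg V :=
  CliffordAlgebra.contractLeft (edgeForm s(a, b))

theorem edgeVec_of_ne {a b : V} (h : a ≠ b) :
    edgeVec s(a, b) = Finsupp.single ⟨s(a, b), by simpa using h⟩ 1 :=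
  dif_pos _

theorem edge_comm (a b : V) : edge a b = edge b a := by
  rw [edge, Sym2.eq_swap, edge]

@[simp] theorem edge_self (a : V) : edge a a = 0 := by
  simp [edge, edgeVec]

theorem edge_mul_swap (a b c d : V) : edge a b * edge c d = -(edge c d * edge a b) :=
  eq_neg_of_add_eq_zero_left (ExteriorAlgebra.ι_add_mul_swap _ _)

theorem edge_mul_left_comm (a b c d : V) (x : EdgeAlg V) :
    edge a b * (edge c d * x) = -(edge c d * (edge a b * x)) := by
  rw [← mul_assoc, edge_mul_swap, neg_mul, mul_assoc]

@[simp] theorem bd_one : bd (1 : EdgeAlg V) = 0 :=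
  CliffordAlgebra.contractLeft_one (Q := (0 : QuadraticForm ℤ _)) _

@[simp] theorem coeff_one (a b : V) : coeff a b (1 : EdgeAlg V) = 0 :=
  CliffordAlgebra.contractLeft_one (Q := (0 : QuadraticForm ℤ _)) _

theorem bd_bd (x : EdgeAlg V) : bd (bd x) = 0 := boundary_boundary x

theorem bd_edge_mul {a b : V} (h : a ≠ b) (x : EdgeAlg V) :
    bd (edge a b * x) = x - edge a b * bd x := by
  have := CliffordAlgebra.contractLeft_ι_mul (Q := (0 : QuadraticForm ℤ _))
    (d := Finsupp.linearCombination ℤ fun _ : (⊤ : SimpleGraph V).edgeSet => (1 : ℤ))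
    (edgeVec s(a, b)) x
  refine this.trans ?_
  simp [edgeVec_of_ne h, edge, boundary]

theorem coeff_edge_mul (a b c d : V) (x : EdgeAlg V) :
    coeff a b (edge c d * x) = edgeForm s(a, b) (edgeVec s(c, d)) • x
      - edge c d * coeff a b x :=
  CliffordAlgebra.contractLeft_ι_mul (Q := (0 : QuadraticForm ℤ _)) _ _ _

theorem edgeForm_self {a b : V} (h : a ≠ b) : edgeForm s(a, b) (edgeVec s(a, b)) = 1 := by
  simp [edgeForm, edgeVec_of_ne h, h]

theorem edgeForm_of_ne {s t : Sym2 V} (h : s ≠ t) : edgeForm s (edgeVec t) = 0 := by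
  unfold edgeForm edgeVec
  split_ifs <;> simp [h.symm]

theorem coeff_edge_mul_self {a b : V} (h : a ≠ b) (x : EdgeAlg V) :
    coeff a b (edge a b * x) = x - edge a b * coeff a b x := by
  rw [coeff_edge_mul, edgeForm_self h, one_smul]

theorem coeff_edge_mul_of_ne {a b c d : V} (h : s(a, b) ≠ s(c, d)) (x : EdgeAlg V) :
    coeff a b (edge c d * x) = -(edge c d * coeff a b x) := by
  rw [coeff_edge_mul, edgeForm_of_ne h, zero_smul, zero_sub]

theorem bd_coeff (a b : V) (x : EdgeAlg V) : bd (coeff a b x) = -coeff a b (bd x) :=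
  CliffordAlgebra.contractLeft_comm _ _ _

/-- The algebra map induced by a map of vertices. -/
noncomputable def relabel (f : V → W) : EdgeAlg V →ₐ[ℤ] EdgeAlg W :=
  ExteriorAlgebra.map (Finsupp.linearCombination ℤ fun s : (⊤ : SimpleGraph V).edgeSet =>
    edgeVec (Sym2.map f s))

@[simp] theorem relabel_edge (f : V → W) (a b : V) :
    relabel f (edge a b) = edge (f a) (f b) := by
  by_cases h : a = b
  · simp [h]
  · rw [edge, relabel, ExteriorAlgebra.map_apply_ι, edgeVec_of_ne h]
    simp [edge]

section Chains

variable [DecidableEq V]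

/-- The chains spanned by the `k`-edge matchings on the vertex set `S`. -/
noncomputable def chainOn : ℕ → Finset V → Submodule ℤ (EdgeAlg V)
  | 0, _ => Submodule.span ℤ {1}
  | k + 1, S => Submodule.span ℤ {x | ∃ a ∈ S, ∃ b ∈ S, a ≠ b ∧
      ∃ y ∈ chainOn k (S \ {a, b}), x = edge a b * y}

theorem one_mem_chainOn (S : Finset V) : (1 : EdgeAlg V) ∈ chainOn 0 S :=
  Submodule.mem_span_singleton_self _

theorem edge_mul_mem_chainOn {k : ℕ} {S : Finset V} {a b : V} (ha : a ∈ S) (hb : b ∈ S)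
    (hab : a ≠ b) {y : EdgeAlg V} (hy : y ∈ chainOn k (S \ {a, b})) :
    edge a b * y ∈ chainOn (k + 1) S :=
  Submodule.subset_span ⟨a, ha, b, hb, hab, y, hy, rfl⟩

theorem chainOn_zero_le {S : Finset V} {M : Submodule ℤ (EdgeAlg V)} (h : 1 ∈ M) :
    chainOn 0 S ≤ M := by
  simpa [chainOn, Submodule.span_le] using h

theorem chainOn_succ_le {k : ℕ} {S : Finset V} {M : Submodule ℤ (EdgeAlg V)}
    (h : ∀ a ∈ S, ∀ b ∈ S, a ≠ b → ∀ y ∈ chainOn k (S \ {a, b}), edge a b * y ∈ M) :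
    chainOn (k + 1) S ≤ M := by
  rw [chainOn, Submodule.span_le]
  rintro _ ⟨a, ha, b, hb, hab, y, hy, rfl⟩
  exact h a ha b hb hab y hy

theorem chainOn_mono {k : ℕ} {S T : Finset V} (h : S ⊆ T) : chainOn k S ≤ chainOn k T := by
  induction k generalizing S T with
  | zero => exact chainOn_zero_le (one_mem_chainOn _)
  | succ k ih =>
    exact chainOn_succ_le fun a ha b hb hab y hy =>
      edge_mul_mem_chainOn (h ha) (h hb) hab (ih (Finset.sdiff_subset_sdiff h le_rfl) hy)

theorem edge_mul_mem_chainOn' {k : ℕ} {S T : Finset V} {a b : V} (ha : a ∈ S) (hb : b ∈ S)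
    (hab : a ≠ b) {y : EdgeAlg V} (hy : y ∈ chainOn k T) (hT : T ⊆ S \ {a, b}) :
    edge a b * y ∈ chainOn (k + 1) S :=
  edge_mul_mem_chainOn ha hb hab (chainOn_mono hT hy)

theorem bd_mem_chainOn {k : ℕ} {S : Finset V} {x : EdgeAlg V} (hx : x ∈ chainOn (k + 1) S) :
    bd x ∈ chainOn k S := by
  induction k generalizing S x with
  | zero =>
    refine chainOn_succ_le (M := (chainOn 0 S).comap bd) (fun a ha b hb hab y hy => ?_) hx
    have : bd y = 0 := by
      refine chainOn_zero_le (M := LinearMap.ker bd) ?_ hy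
      simp
    rw [Submodule.mem_comap, bd_edge_mul hab, this, mul_zero, sub_zero]
    exact hy
  | succ k ih =>
    refine chainOn_succ_le (M := (chainOn (k + 1) S).comap bd) (fun a ha b hb hab y hy => ?_) hx
    rw [Submodule.mem_comap, bd_edge_mul hab]
    exact Submodule.sub_mem _ (chainOn_mono Finset.sdiff_subset hy)
      (edge_mul_mem_chainOn ha hb hab (ih hy))

theorem coeff_chainOn_zero {S : Finset V} (a b : V) {x : EdgeAlg V} (hx : x ∈ chainOn 0 S) :
    coeff a b x = 0 :=
  chainOn_zero_le (M := LinearMap.ker (coeff a b)) (by simp) hx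

theorem coeff_eq_zero {k : ℕ} {S : Finset V} {a b : V} (h : a ∉ S ∨ b ∉ S) {x : EdgeAlg V}
    (hx : x ∈ chainOn k S) : coeff a b x = 0 := by
  induction k generalizing S x with
  | zero => exact coeff_chainOn_zero a b hx
  | succ k ih =>
    refine chainOn_succ_le (M := LinearMap.ker (coeff a b)) (fun c hc d hd hcd y hy => ?_) hx
    have hne : s(a, b) ≠ s(c, d) := by
      rw [Ne, Sym2.eq_iff]; grind
    rw [LinearMap.mem_ker, coeff_edge_mul_of_ne hne, ih (by grind) hy, mul_zero, neg_zero]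

theorem coeff_mem_chainOn {k : ℕ} {S : Finset V} {a b : V} (hab : a ≠ b) {x : EdgeAlg V}
    (hx : x ∈ chainOn (k + 1) S) : coeff a b x ∈ chainOn k (S \ {a, b}) := by
  induction k generalizing S x with
  | zero =>
    refine chainOn_succ_le (M := (chainOn 0 (S \ {a, b})).comap (coeff a b))
      (fun c hc d hd hcd y hy => ?_) hx
    rw [Submodule.mem_comap, coeff_edge_mul, coeff_chainOn_zero a b hy, mul_zero, sub_zero]
    exact Submodule.smul_mem _ _ hy
  | succ k ih =>
    refine chainOn_succ_le (M := (chainOn (k + 1) (S \ {a, b})).comap (coeff a b))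
      (fun c hc d hd hcd y hy => ?_) hx
    rw [Submodule.mem_comap]
    by_cases h : s(a, b) = s(c, d)
    · have hS : S \ {c, d} = S \ {a, b} := by
        rw [Sym2.eq_iff] at h; grind
      rw [hS] at hy
      rw [coeff_edge_mul, coeff_eq_zero (by grind) hy, mul_zero, sub_zero]
      exact Submodule.smul_mem _ _ hy
    · rw [coeff_edge_mul_of_ne h]
      refine Submodule.neg_mem _ ?_
      by_cases h' : a ∈ S \ {c, d} ∧ b ∈ S \ {c, d}
      · exact edge_mul_mem_chainOn' (by grind) (by grind) hcd (ih hy) (by grind)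
      · rw [coeff_eq_zero (by grind) hy, mul_zero]
        exact Submodule.zero_mem _

/-- Removing from a chain all terms that cover the vertex `v`. -/
theorem sub_sum_coeff_mem_chainOn {k : ℕ} {S : Finset V} {v : V} (hv : v ∈ S) {x : EdgeAlg V}
    (hx : x ∈ chainOn k S) :
    x - ∑ w ∈ S.erase v, edge v w * coeff v w x ∈ chainOn k (S.erase v) := by
  induction k generalizing S x with
  | zero =>
    rw [Finset.sum_eq_zero fun w _ => by rw [coeff_chainOn_zero v w hx, mul_zero], sub_zero]
    exact hx
  | succ k ih =>
    let L : EdgeAlg V →ₗ[ℤ] EdgeAlg V :=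
      LinearMap.id - ∑ w ∈ S.erase v, LinearMap.mulLeft ℤ (edge v w) ∘ₗ coeff v w
    have hL : ∀ x, L x = x - ∑ w ∈ S.erase v, edge v w * coeff v w x := fun x => by
      simp [L, LinearMap.sum_apply]
    rw [← hL]
    refine chainOn_succ_le (M := (chainOn (k + 1) (S.erase v)).comap L)
      (fun c hc d hd hcd y hy => ?_) hx
    rw [Submodule.mem_comap, hL]
    -- A term through `v` is reproduced by exactly one summand and cancels. In any other term the
    -- leading edge can be pulled out of the sum, which reduces to the induction hypothesis.
    have key : ∀ d ∈ S, v ≠ d → ∀ y ∈ chainOn k (S \ {v, d}),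
        edge v d * y - ∑ w ∈ S.erase v, edge v w * coeff v w (edge v d * y) = 0 := by
      intro d hd hcd y hy
      rw [Finset.sum_eq_single d, coeff_edge_mul_self hcd, coeff_eq_zero (by grind) hy]
      · simp
      · intro w hw hwd
        rw [coeff_edge_mul_of_ne (by simp; grind), coeff_eq_zero (by grind) hy]
        simp
      · grind
    by_cases hvc : v = c
    · subst hvc
      rw [key d hd hcd y hy]
      exact Submodule.zero_mem _
    · by_cases hvd : v = d
      · subst hvd
        rw [edge_comm c v, key c hc hcd.symm y (by rwa [Finset.pair_comm])]
        exact Submodule.zero_mem _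
      · have h1 : ∑ w ∈ S.erase v, edge v w * coeff v w (edge c d * y) =
            edge c d * ∑ w ∈ (S \ {c, d}).erase v, edge v w * coeff v w y := by
          rw [Finset.mul_sum]
          have h2 : ∀ w ∈ S.erase v, edge v w * coeff v w (edge c d * y) =
              edge c d * (edge v w * coeff v w y) := by
            intro w hw
            rw [coeff_edge_mul_of_ne (by simp; grind), mul_neg, edge_mul_left_comm, neg_neg]
          rw [Finset.sum_congr rfl h2]
          refine (Finset.sum_subset (by grind) fun w hw hw' => ?_).symm
          rw [coeff_eq_zero (by grind) hy]
          simp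
        rw [h1, ← mul_sub]
        exact edge_mul_mem_chainOn' (by grind) (by grind) hcd (ih (by grind) hy) (by grind)

end Chains

end

/-! ### Cycles and boundaries; products and relabelling. -/

section

variable {V W : Type*} [DecidableEq V]

/-- The cycles among the chains of `k`-edge matchings on `S`. -/
noncomputable def cycleOn (k : ℕ) (S : Finset V) : Submodule ℤ (EdgeAlg V) :=
  chainOn k S ⊓ LinearMap.ker bd

/-- The boundaries among the chains of `k`-edge matchings on `S`. -/
noncomputable def bdryOn (k : ℕ) (S : Finset V) : Submodule ℤ (EdgeAlg V) :=
  (chainOn (k + 1) S).map bd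

theorem mem_cycleOn {k : ℕ} {S : Finset V} {x : EdgeAlg V} :
    x ∈ cycleOn k S ↔ x ∈ chainOn k S ∧ bd x = 0 := Iff.rfl

theorem bdryOn_le_cycleOn (k : ℕ) (S : Finset V) : bdryOn k S ≤ cycleOn k S := by
  rintro _ ⟨y, hy, rfl⟩
  exact ⟨bd_mem_chainOn hy, bd_bd y⟩

theorem cycleOn_mono {k : ℕ} {S T : Finset V} (h : S ⊆ T) : cycleOn k S ≤ cycleOn k T :=
  inf_le_inf_right _ (chainOn_mono h)

theorem bdryOn_mono {k : ℕ} {S T : Finset V} (h : S ⊆ T) : bdryOn k S ≤ bdryOn k T :=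
  Submodule.map_mono (chainOn_mono h)

theorem coeff_mem_cycleOn {k : ℕ} {S : Finset V} {a b : V} (hab : a ≠ b) {x : EdgeAlg V}
    (hx : x ∈ cycleOn (k + 1) S) : coeff a b x ∈ cycleOn k (S \ {a, b}) := by
  refine mem_cycleOn.2 ⟨coeff_mem_chainOn hab hx.1, ?_⟩
  rw [bd_coeff, (mem_cycleOn.1 hx).2, map_zero, neg_zero]

theorem coeff_mem_bdryOn {k : ℕ} {S : Finset V} {a b : V} (hab : a ≠ b) {x : EdgeAlg V}
    (hx : x ∈ bdryOn (k + 1) S) : coeff a b x ∈ bdryOn k (S \ {a, b}) := by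
  obtain ⟨q, hq, rfl⟩ := hx
  refine ⟨-coeff a b q, Submodule.neg_mem _ (coeff_mem_chainOn hab hq), ?_⟩
  rw [map_neg, bd_coeff, neg_neg]

section Mul

theorem mul_mem_chainOn {k l : ℕ} {S T : Finset V} (h : Disjoint S T) {x y : EdgeAlg V}
    (hx : x ∈ chainOn k S) (hy : y ∈ chainOn l T) : x * y ∈ chainOn (k + l) (S ∪ T) := by
  induction k generalizing S x with
  | zero =>
    refine chainOn_zero_le (M := (chainOn (0 + l) (S ∪ T)).comap (LinearMap.mulRight ℤ y)) ?_ hx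
    simpa using chainOn_mono Finset.subset_union_right hy
  | succ k ih =>
    rw [Nat.succ_add]
    refine chainOn_succ_le (M := (chainOn (k + l + 1) (S ∪ T)).comap (LinearMap.mulRight ℤ y))
      (fun a ha b hb hab z hz => ?_) hx
    rw [Submodule.mem_comap, LinearMap.mulRight_apply, mul_assoc]
    refine edge_mul_mem_chainOn' (by grind) (by grind) hab
      (ih (h.mono_left Finset.sdiff_subset) hz) ?_
    rw [Finset.disjoint_left] at h
    grind

theorem bd_mul {k : ℕ} {S : Finset V} {x : EdgeAlg V} (hx : x ∈ chainOn k S) (y : EdgeAlg V) :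
    bd (x * y) = bd x * y + (-1 : ℤ) ^ k • (x * bd y) := by
  induction k generalizing S x with
  | zero =>
    refine chainOn_zero_le (M := LinearMap.eqLocus (bd ∘ₗ LinearMap.mulRight ℤ y)
      (LinearMap.mulRight ℤ y ∘ₗ bd + (-1 : ℤ) ^ 0 • LinearMap.mulRight ℤ (bd y))) ?_ hx
    simp
  | succ k ih =>
    refine chainOn_succ_le (M := LinearMap.eqLocus (bd ∘ₗ LinearMap.mulRight ℤ y)
      (LinearMap.mulRight ℤ y ∘ₗ bd + (-1 : ℤ) ^ (k + 1) • LinearMap.mulRight ℤ (bd y)))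
      (fun a ha b hb hab z hz => ?_) hx
    simp only [LinearMap.mem_eqLocus, LinearMap.comp_apply, LinearMap.mulRight_apply,
      LinearMap.add_apply, LinearMap.smul_apply]
    rw [mul_assoc, bd_edge_mul hab, bd_edge_mul hab, ih hz, mul_add, sub_mul, mul_smul_comm,
      pow_succ, mul_neg_one, neg_smul]
    simp only [mul_assoc]
    abel

theorem mul_mem_cycleOn {k l : ℕ} {S T : Finset V} (h : Disjoint S T) {x y : EdgeAlg V}
    (hx : x ∈ cycleOn k S) (hy : y ∈ cycleOn l T) : x * y ∈ cycleOn (k + l) (S ∪ T) := by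
  refine mem_cycleOn.2 ⟨mul_mem_chainOn h hx.1 hy.1, ?_⟩
  rw [bd_mul hx.1, (mem_cycleOn.1 hx).2, (mem_cycleOn.1 hy).2]
  simp

theorem bdryOn_mul_cycleOn {k l : ℕ} {S T : Finset V} (h : Disjoint S T) {x y : EdgeAlg V}
    (hx : x ∈ bdryOn k S) (hy : y ∈ cycleOn l T) : x * y ∈ bdryOn (k + l) (S ∪ T) := by
  obtain ⟨q, hq, rfl⟩ := hx
  refine ⟨q * y, ?_, ?_⟩
  · rw [add_right_comm]
    exact mul_mem_chainOn h hq hy.1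
  · rw [bd_mul hq, (mem_cycleOn.1 hy).2]
    simp

theorem cycleOn_mul_bdryOn {k l : ℕ} {S T : Finset V} (h : Disjoint S T) {x y : EdgeAlg V}
    (hx : x ∈ cycleOn k S) (hy : y ∈ bdryOn l T) : x * y ∈ bdryOn (k + l) (S ∪ T) := by
  obtain ⟨q, hq, rfl⟩ := hy
  refine ⟨(-1 : ℤ) ^ k • (x * q), Submodule.smul_mem _ _
    (mul_mem_chainOn (l := l + 1) h hx.1 hq), ?_⟩
  rw [map_smul, bd_mul hx.1, (mem_cycleOn.1 hx).2, zero_mul, zero_add, smul_smul,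
    ← mul_pow]
  simp

end Mul

section Relabel

theorem relabel_mem_chainOn [DecidableEq W] {k : ℕ} {S : Finset V} {T : Finset W} {f : V → W}
    (hf : Set.MapsTo f S T) (hi : Set.InjOn f S) {x : EdgeAlg V} (hx : x ∈ chainOn k S) :
    relabel f x ∈ chainOn k T := by
  induction k generalizing S T x with
  | zero =>
    refine chainOn_zero_le (M := (chainOn 0 T).comap (relabel f).toLinearMap) ?_ hx
    simpa using one_mem_chainOn T
  | succ k ih =>
    refine chainOn_succ_le (M := (chainOn (k + 1) T).comap (relabel f).toLinearMap)
      (fun a ha b hb hab y hy => ?_) hx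
    rw [Submodule.mem_comap, AlgHom.toLinearMap_apply, map_mul, relabel_edge]
    refine edge_mul_mem_chainOn (hf ha) (hf hb) (fun h => hab (hi ha hb h)) (ih ?_ ?_ hy)
    · intro c hc
      have hc' : c ∈ S ∧ c ≠ a ∧ c ≠ b := by simpa using hc
      have h1 := hf hc'.1
      have h2 : f c ≠ f a := fun h => hc'.2.1 (hi hc'.1 ha h)
      have h3 : f c ≠ f b := fun h => hc'.2.2 (hi hc'.1 hb h)
      simp_all
    · exact hi.mono (by simp)

/-- An edge collapsed by `f` goes to `0`, whereas its boundary `1` goes to `1`; hence the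
injectivity on the vertices in use. -/
theorem bd_relabel {k : ℕ} {S : Finset V} {f : V → W} (hi : Set.InjOn f S) {x : EdgeAlg V}
    (hx : x ∈ chainOn k S) : bd (relabel f x) = relabel f (bd x) := by
  induction k generalizing S x with
  | zero =>
    refine chainOn_zero_le (M := LinearMap.eqLocus (bd ∘ₗ (relabel f).toLinearMap)
      ((relabel f).toLinearMap ∘ₗ bd)) ?_ hx
    simp
  | succ k ih =>
    refine chainOn_succ_le (M := LinearMap.eqLocus (bd ∘ₗ (relabel f).toLinearMap)
      ((relabel f).toLinearMap ∘ₗ bd)) (fun a ha b hb hab y hy => ?_) hx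
    simp only [LinearMap.mem_eqLocus, LinearMap.comp_apply, AlgHom.toLinearMap_apply, map_mul,
      relabel_edge]
    rw [bd_edge_mul hab, bd_edge_mul fun h => hab (hi ha hb h), ih (hi.mono (by simp)) hy,
      map_sub, map_mul, relabel_edge]

theorem relabel_mem_cycleOn [DecidableEq W] {k : ℕ} {S : Finset V} {T : Finset W} {f : V → W}
    (hf : Set.MapsTo f S T) (hi : Set.InjOn f S) {x : EdgeAlg V} (hx : x ∈ cycleOn k S) :
    relabel f x ∈ cycleOn k T := by
  refine mem_cycleOn.2 ⟨relabel_mem_chainOn hf hi hx.1, ?_⟩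
  rw [bd_relabel hi hx.1, (mem_cycleOn.1 hx).2, map_zero]

theorem relabel_mem_bdryOn [DecidableEq W] {k : ℕ} {S : Finset V} {T : Finset W} {f : V → W}
    (hf : Set.MapsTo f S T) (hi : Set.InjOn f S) {x : EdgeAlg V} (hx : x ∈ bdryOn k S) :
    relabel f x ∈ bdryOn k T := by
  obtain ⟨q, hq, rfl⟩ := hx
  exact ⟨relabel f q, relabel_mem_chainOn hf hi hq, bd_relabel hi hq⟩

theorem relabel_relabel {U : Type*} {k : ℕ} {S : Finset V} (f : V → W) (g : W → U)
    (h : V → U) (hfg : ∀ a ∈ S, g (f a) = h a) {x : EdgeAlg V} (hx : x ∈ chainOn k S) :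
    relabel g (relabel f x) = relabel h x := by
  induction k generalizing S x with
  | zero =>
    refine chainOn_zero_le (M := LinearMap.eqLocus ((relabel g).toLinearMap ∘ₗ
      (relabel f).toLinearMap) (relabel h).toLinearMap) ?_ hx
    simp
  | succ k ih =>
    refine chainOn_succ_le (M := LinearMap.eqLocus ((relabel g).toLinearMap ∘ₗ
      (relabel f).toLinearMap) (relabel h).toLinearMap) (fun a ha b hb hab y hy => ?_) hx
    simp only [LinearMap.mem_eqLocus, LinearMap.comp_apply, AlgHom.toLinearMap_apply, map_mul,
      relabel_edge]
    rw [ih (fun c hc => hfg c (by grind)) hy, hfg a ha, hfg b hb]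

theorem relabel_eq_self {k : ℕ} {S : Finset V} {f : V → V} (hf : ∀ a ∈ S, f a = a)
    {x : EdgeAlg V} (hx : x ∈ chainOn k S) : relabel f x = x := by
  induction k generalizing S x with
  | zero =>
    refine chainOn_zero_le (M := LinearMap.eqLocus (relabel f).toLinearMap LinearMap.id) ?_ hx
    simp
  | succ k ih =>
    refine chainOn_succ_le (M := LinearMap.eqLocus (relabel f).toLinearMap LinearMap.id)
      (fun a ha b hb hab y hy => ?_) hx
    simp only [LinearMap.mem_eqLocus, AlgHom.toLinearMap_apply, map_mul, relabel_edge,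
      LinearMap.id_apply]
    rw [ih (fun c hc => hf c (by grind)) hy, hf a ha, hf b hb]

theorem relabel_leftInverse {k : ℕ} {S : Finset V} {f : V → W} {g : W → V}
    (hgf : ∀ a ∈ S, g (f a) = a) {x : EdgeAlg V} (hx : x ∈ chainOn k S) :
    relabel g (relabel f x) = x := by
  rw [relabel_relabel f g (fun a => a) hgf hx, relabel_eq_self (fun _ _ => rfl) hx]

end Relabel

end

/-! ### Generating cycles by suspensions; the vanishing range. -/

section

variable {V W : Type*} [DecidableEq V]

/-- The reduced `0`-cycle joining two edges at the vertex `p`. -/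
noncomputable def triad (p q r : V) : EdgeAlg V := edge p q - edge p r

theorem edge_mem_chainOn {S : Finset V} {a b : V} (ha : a ∈ S) (hb : b ∈ S) (hab : a ≠ b) :
    edge a b ∈ chainOn 1 S := by
  simpa using edge_mul_mem_chainOn ha hb hab (one_mem_chainOn _)

theorem bd_edge {V : Type*} {a b : V} (hab : a ≠ b) : bd (edge a b) = 1 := by
  simpa using bd_edge_mul hab 1

theorem triad_mem_cycleOn {S : Finset V} {p q r : V} (hp : p ∈ S) (hq : q ∈ S) (hr : r ∈ S)
    (hpq : p ≠ q) (hpr : p ≠ r) : triad p q r ∈ cycleOn 1 S := by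
  refine mem_cycleOn.2 ⟨Submodule.sub_mem _ (edge_mem_chainOn hp hq hpq)
    (edge_mem_chainOn hp hr hpr), ?_⟩
  rw [triad, map_sub, bd_edge hpq, bd_edge hpr, sub_self]

theorem triad_mul_mem_cycleOn {k : ℕ} {S T : Finset V} {p q r : V} (hp : p ∈ S) (hq : q ∈ S)
    (hr : r ∈ S) (hpq : p ≠ q) (hpr : p ≠ r) (hT : T ⊆ S \ {p, q, r}) {y : EdgeAlg V}
    (hy : y ∈ cycleOn k T) : triad p q r * y ∈ cycleOn (k + 1) S := by
  have h := mul_mem_cycleOn (S := {p, q, r}) (T := T) (by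
    rw [Finset.disjoint_left]; grind)
    (triad_mem_cycleOn (by simp) (by simp) (by simp) hpq hpr) hy
  rw [add_comm]
  exact cycleOn_mono (by grind) h

theorem triad_mul_mem_bdryOn {k : ℕ} {S T : Finset V} {p q r : V} (hp : p ∈ S) (hq : q ∈ S)
    (hr : r ∈ S) (hpq : p ≠ q) (hpr : p ≠ r) (hT : T ⊆ S \ {p, q, r}) {y : EdgeAlg V}
    (hy : y ∈ bdryOn k T) : triad p q r * y ∈ bdryOn (k + 1) S := by
  have h := cycleOn_mul_bdryOn (S := {p, q, r}) (T := T) (by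
    rw [Finset.disjoint_left]; grind)
    (triad_mem_cycleOn (by simp) (by simp) (by simp) hpq hpr) hy
  rw [add_comm]
  exact bdryOn_mono (by grind) h

/-- Both `x` and `m` avoid `u` and `v`. Comparing coefficients of `uv` in the cycle condition gives
`bd m = 0`, hence `bd x = -m`, and the cone `uv * x` has the required boundary. -/
theorem add_edge_mul_mem_bdryOn {k : ℕ} {S : Finset V} {u v : V} (hu : u ∈ S) (hv : v ∈ S)
    (huv : u ≠ v) {x m : EdgeAlg V} (hx : x ∈ chainOn (k + 1) (S \ {u, v}))
    (hm : m ∈ chainOn k (S \ {u, v})) (h : bd (x + edge u v * m) = 0) :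
    x + edge u v * m ∈ bdryOn (k + 1) S := by
  refine ⟨edge u v * x, edge_mul_mem_chainOn hu hv huv hx, ?_⟩
  rw [map_add, bd_edge_mul huv] at h
  have h1 : coeff u v (bd m) = 0 := by
    rw [← neg_eq_zero, ← bd_coeff, coeff_eq_zero (by grind) hm, map_zero]
  have h2 : coeff u v (bd x) = 0 := coeff_eq_zero (by grind) (bd_mem_chainOn hx)
  have h3 := congrArg (coeff u v) h
  rw [map_add, map_sub, coeff_edge_mul_self huv, h1, h2, coeff_eq_zero (by grind) hm] at h3
  have h4 : bd m = 0 := by simpa using h3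
  rw [h4, mul_zero, sub_zero] at h
  rw [bd_edge_mul huv, eq_neg_of_add_eq_zero_left h]
  simp

/-- No term of `x` contains both an edge `ua` and an edge `vb` other than `uv`. Replacing each `ua`
by `ua - uv` and each `vb` by `vb - vu` leaves a remainder made of terms off `u`, `v` and multiples
of `uv`, which bounds by `add_edge_mul_mem_bdryOn`. -/
theorem cycle_induction_of_coeff_coeff_eq_zero {k : ℕ} {S : Finset V} {u v : V} (hu : u ∈ S)
    (hv : v ∈ S) (huv : u ≠ v) {x : EdgeAlg V} (hx : x ∈ cycleOn (k + 1) S)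
    (h : ∀ a ∈ S \ {u, v}, ∀ b ∈ S \ {u, v}, a ≠ b → coeff v b (coeff u a x) = 0)
    {M : Submodule ℤ (EdgeAlg V)} (hB : bdryOn (k + 1) S ≤ M)
    (hu' : ∀ a ∈ S \ {u, v}, ∀ y ∈ cycleOn k (S \ {u, v, a}), triad u a v * y ∈ M)
    (hv' : ∀ b ∈ S \ {u, v}, ∀ y ∈ cycleOn k (S \ {u, v, b}), triad v b u * y ∈ M) :
    x ∈ M := by
  have hA : S.erase u = insert v (S \ {u, v}) := by grind
  have hA' : (S.erase u).erase v = S \ {u, v} := by grind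
  have hxa : ∀ a ∈ S \ {u, v}, coeff u a x ∈ cycleOn k (S \ {u, v, a}) := by
    intro a ha
    have hua : u ≠ a := by grind
    have h1 := coeff_mem_cycleOn hua hx
    refine ⟨?_, h1.2⟩
    have h2 := sub_sum_coeff_mem_chainOn (v := v) (by grind) h1.1
    rw [Finset.sum_eq_zero, sub_zero] at h2
    · exact chainOn_mono (by grind) h2
    · intro b hb
      rw [h a ha b (by grind) (by grind), mul_zero]
  obtain ⟨X, hX⟩ : ∃ X, X = x - ∑ a ∈ S.erase u, edge u a * coeff u a x := ⟨_, rfl⟩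
  have hX1 : X ∈ chainOn (k + 1) (S.erase u) := by
    rw [hX]; exact sub_sum_coeff_mem_chainOn hu hx.1
  have hXb : ∀ b ∈ S \ {u, v}, coeff v b X = coeff v b x := by
    intro b hb
    rw [hX, map_sub, map_sum, Finset.sum_eq_zero, sub_zero]
    intro a ha
    rw [coeff_edge_mul_of_ne (by simp; grind)]
    by_cases hav : a = v
    · subst hav
      rw [coeff_eq_zero (by grind) (coeff_mem_chainOn huv hx.1)]
      simp
    · rw [coeff_eq_zero (a := v) (b := b) (by grind) (hxa a (by grind)).1]
      simp
  have hxb : ∀ b ∈ S \ {u, v}, coeff v b x ∈ cycleOn k (S \ {u, v, b}) := by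
    intro b hb
    have hvb : v ≠ b := by grind
    refine ⟨?_, (coeff_mem_cycleOn hvb hx).2⟩
    rw [← hXb b hb]
    exact chainOn_mono (by grind) (coeff_mem_chainOn hvb hX1)
  obtain ⟨X', hX'⟩ : ∃ X', X' = X - ∑ b ∈ S \ {u, v}, edge v b * coeff v b X := ⟨_, rfl⟩
  have hX'1 : X' ∈ chainOn (k + 1) (S \ {u, v}) := by
    rw [hX', ← hA']; exact sub_sum_coeff_mem_chainOn (by grind) hX1
  rw [Finset.sum_congr rfl fun b hb => by rw [hXb b hb]] at hX'
  rw [hA, Finset.sum_insert (by simp)] at hX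
  have hr : x = X' + edge u v * (coeff u v x + ∑ a ∈ S \ {u, v}, coeff u a x +
      ∑ b ∈ S \ {u, v}, coeff v b x) + ∑ a ∈ S \ {u, v}, triad u a v * coeff u a x +
      ∑ b ∈ S \ {u, v}, triad v b u * coeff v b x := by
    simp only [triad, sub_mul, Finset.sum_sub_distrib, mul_add, Finset.mul_sum, edge_comm v u]
    rw [hX', hX]
    abel
  have h1 : ∑ a ∈ S \ {u, v}, triad u a v * coeff u a x ∈ cycleOn (k + 1) S ⊓ M :=
    Submodule.sum_mem _ fun a ha => ⟨triad_mul_mem_cycleOn hu (by grind) hv (by grind) huv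
      (by grind) (hxa a ha), hu' a ha _ (hxa a ha)⟩
  have h2 : ∑ b ∈ S \ {u, v}, triad v b u * coeff v b x ∈ cycleOn (k + 1) S ⊓ M :=
    Submodule.sum_mem _ fun b hb => ⟨triad_mul_mem_cycleOn hv (by grind) hu (by grind) huv.symm
      (by grind) (hxb b hb), hv' b hb _ (hxb b hb)⟩
  rw [hr]
  refine M.add_mem (M.add_mem (hB (add_edge_mul_mem_bdryOn hu hv huv hX'1 ?_ ?_)) h1.2) h2.2
  · refine Submodule.add_mem _ (Submodule.add_mem _ (coeff_mem_chainOn huv hx.1) ?_) ?_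
    · exact Submodule.sum_mem _ fun a ha => chainOn_mono (by grind) (hxa a ha).1
    · exact Submodule.sum_mem _ fun a ha => chainOn_mono (by grind) (hxb a ha).1
  · have h3 := congrArg bd hr
    rw [map_add, map_add, (mem_cycleOn.1 hx).2, (mem_cycleOn.1 h1.1).2,
      (mem_cycleOn.1 h2.1).2, add_zero, add_zero] at h3
    exact h3.symm

/-- Cycles are generated by boundaries and suspensions, as soon as the double links at two
vertices `u` and `v` contribute nothing. -/
theorem cycle_induction {k : ℕ} {S : Finset V} {u v : V} (hu : u ∈ S)
    (hv : v ∈ S) (huv : u ≠ v) {x : EdgeAlg V} (hx : x ∈ cycleOn (k + 1) S)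
    (h : ∀ a ∈ S \ {u, v}, ∀ b ∈ S \ {u, v}, a ≠ b →
      ∃ q ∈ chainOn k (S \ {u, v, a, b}), bd q = coeff v b (coeff u a x))
    {M : Submodule ℤ (EdgeAlg V)} (hB : bdryOn (k + 1) S ≤ M)
    (hu' : ∀ a ∈ S \ {u, v}, ∀ y ∈ cycleOn k (S \ {u, v, a}), triad u a v * y ∈ M)
    (hv' : ∀ b ∈ S \ {u, v}, ∀ y ∈ cycleOn k (S \ {u, v, b}), triad v b u * y ∈ M) :
    x ∈ M := by
  choose! q hq hqb using h
  -- The double links of `P` are the `q a b`. Each contraction anticommutes with `bd`, so the two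
  -- signs cancel and `bd P` has the same double links as `x`.
  obtain ⟨P, hP⟩ : ∃ P, P = ∑ a ∈ S \ {u, v}, ∑ b ∈ (S \ {u, v}).erase a,
    edge u a * (edge v b * q a b) := ⟨_, rfl⟩
  have hPm : P ∈ chainOn (k + 2) S := by
    rw [hP]
    refine Submodule.sum_mem _ fun a ha => Submodule.sum_mem _ fun b hb => ?_
    refine edge_mul_mem_chainOn hu (by grind) (by grind) (edge_mul_mem_chainOn' (by grind)
      (by grind) (by grind) (hq a ha b (by grind) (by grind)) (by grind))
  have hbP : bd P ∈ bdryOn (k + 1) S := ⟨P, hPm, rfl⟩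
  have key : ∀ a ∈ S \ {u, v}, ∀ b ∈ S \ {u, v}, a ≠ b → coeff v b (coeff u a P) = q a b := by
    intro a ha b hb hab
    have h1 : ∀ a' ∈ S \ {u, v}, ∀ b' ∈ (S \ {u, v}).erase a',
        coeff v b (coeff u a (edge u a' * (edge v b' * q a' b'))) =
        if a' = a then if b' = b then q a b else 0 else 0 := by
      intro a' ha' b' hb'
      have hq' := hq a' ha' b' (by grind) (by grind)
      have e1 : coeff u a (q a' b') = 0 := coeff_eq_zero (by grind) hq'
      have e2 : coeff v b (q a' b') = 0 := coeff_eq_zero (by grind) hq'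
      have huvb : s(u, a) ≠ s(v, b') := by simp; grind
      by_cases haa : a' = a
      · subst haa
        rw [coeff_edge_mul_self (by grind), coeff_edge_mul_of_ne huvb, e1]
        by_cases hbb : b' = b
        · subst hbb
          rw [mul_zero, neg_zero, mul_zero, sub_zero, coeff_edge_mul_self (by grind), e2]
          simp
        · rw [mul_zero, neg_zero, mul_zero, sub_zero,
            coeff_edge_mul_of_ne (by simp; grind), e2]
          simp [hbb]
      · rw [coeff_edge_mul_of_ne (by simp; grind), coeff_edge_mul_of_ne huvb, e1]
        simp [haa]
    rw [hP]
    simp only [map_sum]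
    rw [Finset.sum_congr rfl fun a' ha' => Finset.sum_congr rfl (h1 a' ha'),
      Finset.sum_eq_single a, Finset.sum_eq_single b]
    · simp
    · simp +contextual
    · grind
    · intro a' _ ha'
      simp [ha']
    · simp [ha]
  have hx' : x - bd P ∈ M := by
    refine cycle_induction_of_coeff_coeff_eq_zero hu hv huv
      (Submodule.sub_mem _ hx (bdryOn_le_cycleOn _ _ hbP)) (fun a ha b hb hab => ?_) hB hu' hv'
    rw [map_sub, map_sub, ← hqb a ha b hb hab, ← key a ha b hb hab, bd_coeff, bd_coeff]
    simp
  simpa using M.add_mem hx' (hB hbP)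

/-- The range is stable under `cycle_induction`: double links lose two edges and four vertices,
suspended cycles lose one edge and three vertices. -/
theorem cycleOn_le_bdryOn {k : ℕ} {S : Finset V} (hS : 3 * k + 2 ≤ S.card) :
    cycleOn k S ≤ bdryOn k S := by
  induction k using Nat.strong_induction_on generalizing S with
  | _ k ih =>
  obtain ⟨u, hu, v, hv, huv⟩ := Finset.one_lt_card.1 (show 1 < S.card by omega)
  intro x hx
  cases k with
  | zero =>
    refine chainOn_zero_le (M := bdryOn 0 S) ?_ hx.1
    exact ⟨edge u v, edge_mem_chainOn hu hv huv, bd_edge huv⟩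
  | succ k =>
    refine cycle_induction hu hv huv hx (fun a ha b hb hab => ?_) le_rfl
      (fun a ha y hy => ?_) (fun a ha y hy => ?_)
    · have h1 := coeff_mem_cycleOn (a := u) (b := a) (by grind) hx
      cases k with
      | zero => exact ⟨0, Submodule.zero_mem _, by
          rw [coeff_chainOn_zero _ _ h1.1, map_zero]⟩
      | succ k =>
        have h2 := coeff_mem_cycleOn (a := v) (b := b) (by grind) h1
        have h3 : (S \ {u, a}) \ {v, b} = S \ {u, v, a, b} := by grind
        rw [h3] at h2
        refine ih k (by omega) ?_ h2
        have := Finset.le_card_sdiff {u, v, a, b} S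
        have := Finset.card_le_four (a := u) (b := v) (c := a) (d := b)
        omega
    · have := Finset.le_card_sdiff {u, v, a} S
      have := Finset.card_le_three (a := u) (b := v) (c := a)
      exact triad_mul_mem_bdryOn hu (by grind) hv (by grind) huv (by grind)
        (ih k (by omega) (by omega) hy)
    · have := Finset.le_card_sdiff {u, v, a} S
      have := Finset.card_le_three (a := u) (b := v) (c := a)
      exact triad_mul_mem_bdryOn hv (by grind) hu (by grind) huv.symm (by grind)
        (ih k (by omega) (by omega) hy)

/-- In the bottom degrees, cycles are generated by boundaries and suspensions. -/
theorem cycle_induction_of_card {k : ℕ} {S : Finset V} (hS : 3 * k + 3 ≤ S.card) {u v : V}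
    (hu : u ∈ S) (hv : v ∈ S) (huv : u ≠ v) {x : EdgeAlg V} (hx : x ∈ cycleOn (k + 1) S)
    {M : Submodule ℤ (EdgeAlg V)} (hB : bdryOn (k + 1) S ≤ M)
    (hu' : ∀ a ∈ S \ {u, v}, ∀ y ∈ cycleOn k (S \ {u, v, a}), triad u a v * y ∈ M)
    (hv' : ∀ b ∈ S \ {u, v}, ∀ y ∈ cycleOn k (S \ {u, v, b}), triad v b u * y ∈ M) :
    x ∈ M := by
  refine cycle_induction hu hv huv hx (fun a ha b hb hab => ?_) hB hu' hv'
  have h1 := coeff_mem_cycleOn (a := u) (b := a) (by grind) hx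
  cases k with
  | zero => exact ⟨0, Submodule.zero_mem _, by rw [coeff_chainOn_zero _ _ h1.1, map_zero]⟩
  | succ k =>
    have h2 := coeff_mem_cycleOn (a := v) (b := b) (by grind) h1
    have h3 : (S \ {u, a}) \ {v, b} = S \ {u, v, a, b} := by grind
    rw [h3] at h2
    -- Since `3 * (k + 1) + 3 - 4 = 3 * k + 2`, the double links lie just inside the vanishing
    -- range.
    refine cycleOn_le_bdryOn ?_ h2
    have := Finset.le_card_sdiff {u, v, a, b} S
    have := Finset.card_le_four (a := u) (b := v) (c := a) (d := b)
    omega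

/-- A cycle whose links at `v` are all boundaries can be moved off `v`. -/
theorem exists_cycle_erase {k : ℕ} {S : Finset V} {v : V} (hv : v ∈ S) {x : EdgeAlg V}
    (hx : x ∈ cycleOn (k + 1) S)
    (h : ∀ w ∈ S.erase v, coeff v w x ∈ bdryOn k (S \ {v, w})) :
    ∃ y ∈ cycleOn (k + 1) (S.erase v), x - y ∈ bdryOn (k + 1) S := by
  choose! q hq hqb using h
  obtain ⟨P, hP⟩ : ∃ P, P = ∑ w ∈ S.erase v, edge v w * q w := ⟨_, rfl⟩
  have hPm : P ∈ chainOn (k + 2) S := by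
    rw [hP]
    exact Submodule.sum_mem _ fun w hw =>
      edge_mul_mem_chainOn hv (by grind) (by grind) (hq w hw)
  have hbP : bd P ∈ bdryOn (k + 1) S := ⟨P, hPm, rfl⟩
  have key : x + bd P = x - ∑ w ∈ S.erase v, edge v w * coeff v w x + ∑ w ∈ S.erase v, q w := by
    rw [hP, map_sum, Finset.sum_congr rfl fun w hw => by
      rw [bd_edge_mul (by grind), hqb w hw], Finset.sum_sub_distrib]
    abel
  refine ⟨x + bd P, ⟨?_, ?_⟩, ?_⟩
  · rw [key]
    exact Submodule.add_mem _ (sub_sum_coeff_mem_chainOn hv hx.1)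
      (Submodule.sum_mem _ fun w hw => chainOn_mono (by grind) (hq w hw))
  · exact Submodule.add_mem _ hx.2 (bd_bd P)
  · simpa using Submodule.neg_mem _ hbP

/-- A cycle that bounds after adding the vertex `v` is a sum of cycles that miss a vertex. -/
theorem mem_of_mem_bdryOn_insert {k : ℕ} {S : Finset V} {v : V} (hv : v ∉ S) {x : EdgeAlg V}
    (hx : x ∈ bdryOn k (insert v S)) (hxS : x ∈ chainOn k S) {M : Submodule ℤ (EdgeAlg V)}
    (hB : bdryOn k S ≤ M) (hM : ∀ w ∈ S, cycleOn k (S.erase w) ≤ M) : x ∈ M := by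
  obtain ⟨q, hq, rfl⟩ := hx
  have hS : (insert v S).erase v = S := Finset.erase_insert hv
  have h1 := sub_sum_coeff_mem_chainOn (Finset.mem_insert_self v S) hq
  rw [hS] at h1
  -- The boundary of `q` has no term at `v`, so the links of `q` at `v` are cycles.
  have h2 : ∀ w ∈ S, coeff v w q ∈ cycleOn k (S.erase w) := by
    intro w hw
    refine mem_cycleOn.2 ⟨chainOn_mono (by grind) (coeff_mem_chainOn (by grind) hq), ?_⟩
    rw [bd_coeff, coeff_eq_zero (by grind) hxS, neg_zero]
  have h3 : bd q = bd (q - ∑ w ∈ S, edge v w * coeff v w q) + ∑ w ∈ S, coeff v w q := by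
    rw [map_sub, map_sum, Finset.sum_congr rfl fun w hw => by
      rw [bd_edge_mul (by grind), (mem_cycleOn.1 (h2 w hw)).2, mul_zero, sub_zero]]
    abel
  rw [h3]
  exact M.add_mem (hB ⟨_, h1, rfl⟩) (M.sum_mem fun w hw => hM w hw (h2 w hw))

end

/-! ### Exponent three and the sign action on `3k + 1` vertices. -/

section

variable {V W : Type*} [DecidableEq V]

theorem triad_mul_triad {V : Type*} (a b c p q r : V) (x : EdgeAlg V) :
    triad a b c * (triad p q r * x) = -(triad p q r * (triad a b c * x)) := by
  simp only [triad, sub_mul, mul_sub, edge_mul_left_comm a]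
  abel

@[simp] theorem relabel_triad {V : Type*} (f : V → W) (p q r : V) :
    relabel f (triad p q r) = triad (f p) (f q) (f r) := by
  simp [triad]

/-- Version of `cycle_induction_of_card` in which the triads meet `{p, q}` at most once. -/
theorem cycle_induction_avoiding {k : ℕ} {S : Finset V} (hS : 3 * k + 3 ≤ S.card) (p q : V)
    (hpq : 2 ≤ (S \ {p, q}).card) {x : EdgeAlg V} (hx : x ∈ cycleOn (k + 1) S)
    {M : Submodule ℤ (EdgeAlg V)} (hB : bdryOn (k + 1) S ≤ M)
    (h : ∀ u ∈ S \ {p, q}, ∀ v ∈ S \ {p, q}, u ≠ v → ∀ a ∈ S \ {u, v},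
      ∀ y ∈ cycleOn k (S \ {u, v, a}), triad u a v * y ∈ M) : x ∈ M := by
  obtain ⟨u, hu, v, hv, huv⟩ := Finset.one_lt_card.1 (show 1 < (S \ {p, q}).card by omega)
  refine cycle_induction_of_card hS (by grind) (by grind) huv hx hB
    (fun a ha y hy => h u hu v hv huv a ha y hy) (fun a ha y hy => ?_)
  refine h v hv u hu huv.symm a (by grind) y ?_
  rwa [show S \ {v, u, a} = S \ {u, v, a} by grind]

theorem edge_sub_edge_mem_bdryOn {S : Finset V} {p q r s : V} (hp : p ∈ S) (hq : q ∈ S)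
    (hr : r ∈ S) (hs : s ∈ S) (hpq : p ≠ q) (hpr : p ≠ r) (hps : p ≠ s) (hqr : q ≠ r)
    (hqs : q ≠ s) (hrs : r ≠ s) : edge p q - edge r s ∈ bdryOn 1 S := by
  refine ⟨edge r s * edge p q, edge_mul_mem_chainOn hr hs hrs
    (edge_mem_chainOn (by grind) (by grind) hpq), ?_⟩
  rw [bd_edge_mul hrs, bd_edge hpq, mul_one]

/-- On four vertices an edge is homologous to the complementary edge. A triad is thus a difference
of two of the three perfect matchings, and the triads compared here give the same difference. -/
theorem triad_sub_triad_mem_bdryOn {S : Finset V} {p q r s : V} (hp : p ∈ S) (hq : q ∈ S)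
    (hr : r ∈ S) (hs : s ∈ S) (hpq : p ≠ q) (hpr : p ≠ r) (hps : p ≠ s) (hqr : q ≠ r)
    (hqs : q ≠ s) (hrs : r ≠ s) :
    triad p q r - triad q p s ∈ bdryOn 1 S ∧ triad p q r - triad s r q ∈ bdryOn 1 S := by
  have h1 := edge_sub_edge_mem_bdryOn hp hr hq hs hpr hpq hps hqr.symm hrs hqs
  have h2 := edge_sub_edge_mem_bdryOn hp hq hr hs hpq hpr hps hqr hqs hrs
  constructor
  · convert Submodule.neg_mem _ h1 using 1
    rw [triad, triad, edge_comm q p]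
    abel
  · convert Submodule.sub_mem _ h2 h1 using 1
    rw [triad, triad, edge_comm s r, edge_comm s q]
    abel

/-- Product of two triads on the first six of seven vertices. -/
noncomputable def biTriad {V : Type*} (v : Fin 7 → V) : EdgeAlg V :=
  triad (v 0) (v 1) (v 2) * triad (v 3) (v 4) (v 5)

/-- The spare vertex `v 6` is lent to the second triad; in `biTriad_sub_mem_of_left` it is lent to
the first. -/
theorem biTriad_sub_mem_of_right {S : Finset V} {v : Fin 7 → V} (hv : Function.Injective v)
    (hS : ∀ i, v i ∈ S) {x : EdgeAlg V}
    (hx : triad (v 3) (v 4) (v 5) - x ∈ bdryOn 1 {v 3, v 4, v 5, v 6}) :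
    biTriad v - triad (v 0) (v 1) (v 2) * x ∈ bdryOn 2 S := by
  rw [biTriad, ← mul_sub]
  refine triad_mul_mem_bdryOn (hS _) (hS _) (hS _) (hv.ne (by decide)) (hv.ne (by decide)) ?_ hx
  have := fun i j => @hv i j
  intro z hz
  simp only [Finset.mem_insert, Finset.mem_singleton] at hz
  rcases hz with rfl | rfl | rfl | rfl <;> simp [hS, hv.eq_iff]

theorem biTriad_sub_mem_of_left {S : Finset V} {v : Fin 7 → V} (hv : Function.Injective v)
    (hS : ∀ i, v i ∈ S) {x : EdgeAlg V}
    (hx : triad (v 0) (v 1) (v 2) - x ∈ bdryOn 1 {v 0, v 1, v 2, v 6}) :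
    biTriad v - x * triad (v 3) (v 4) (v 5) ∈ bdryOn 2 S := by
  rw [biTriad, ← sub_mul]
  have hd : Disjoint ({v 0, v 1, v 2, v 6} : Finset V) {v 3, v 4, v 5} := by simp [hv.eq_iff]
  have h := bdryOn_mul_cycleOn hd hx
    (triad_mem_cycleOn (p := v 3) (q := v 4) (r := v 5) (by simp) (by simp) (by simp)
      (hv.ne (by decide)) (hv.ne (by decide)))
  refine bdryOn_mono (fun z hz => ?_) h
  simp only [Finset.mem_insert, Finset.mem_singleton, Finset.mem_union] at hz
  rcases hz with (rfl | rfl | rfl | rfl) | rfl | rfl | rfl <;> simp only [hS]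

/-- The permutations under which the class of `biTriad` transforms by the sign. -/
def biTriadSymm (S : Finset V) : Subgroup (Equiv.Perm (Fin 7)) where
  carrier := {σ | ∀ v : Fin 7 → V, Function.Injective v → (∀ i, v i ∈ S) →
    biTriad (v ∘ σ) - (Equiv.Perm.sign σ : ℤ) • biTriad v ∈ bdryOn 2 S}
  one_mem' := fun v _ _ => by simp
  mul_mem' := fun {σ τ} hσ hτ v hv hS => by
    have h1 := hτ (v ∘ σ) (hv.comp σ.injective) fun i => hS _
    have h2 := Submodule.smul_mem _ (Equiv.Perm.sign τ : ℤ) (hσ v hv hS)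
    convert Submodule.add_mem _ h1 h2 using 1
    rw [smul_sub, smul_smul, Equiv.Perm.sign_mul, Units.val_mul, mul_comm]
    simp [Function.comp_assoc]
  inv_mem' := fun {σ} hσ v hv hS => by
    have h1 := hσ (v ∘ σ.symm) (hv.comp σ.symm.injective) fun i => hS _
    have h2 := Submodule.smul_mem _ (-(Equiv.Perm.sign σ : ℤ)) h1
    convert h2 using 1
    rw [smul_sub, smul_smul, neg_mul, ← Units.val_mul, Int.units_mul_self, Equiv.Perm.sign_inv,
      Function.comp_assoc]
    simp
    abel

/-- A triad with a spare vertex changes by the sign under the symmetries preserving its pair of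
perfect matchings. These symmetries on `{0, 1, 2, 6}` and on `{3, 4, 5, 6}` share the vertex `6`,
and conjugating them by one another yields all adjacent transpositions. -/
theorem biTriadSymm_eq_top (S : Finset V) : biTriadSymm S = ⊤ := by
  have h12 : Equiv.swap 1 2 ∈ biTriadSymm S := fun v hv hS => by
    rw [Equiv.Perm.sign_swap (by decide)]
    convert Submodule.zero_mem (bdryOn 2 S) using 1
    simp [biTriad, triad, Equiv.swap_apply_def, sub_mul]
  have h45 : Equiv.swap 4 5 ∈ biTriadSymm S := fun v hv hS => by
    rw [Equiv.Perm.sign_swap (by decide)]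
    convert Submodule.zero_mem (bdryOn 2 S) using 1
    simp [biTriad, triad, Equiv.swap_apply_def, mul_sub]
  have hR : ∀ v : Fin 7 → V, Function.Injective v →
      triad (v 3) (v 4) (v 5) - triad (v 4) (v 3) (v 6) ∈ bdryOn 1 {v 3, v 4, v 5, v 6} ∧
      triad (v 3) (v 4) (v 5) - triad (v 6) (v 5) (v 4) ∈ bdryOn 1 {v 3, v 4, v 5, v 6} :=
    fun v hv => by
      apply triad_sub_triad_mem_bdryOn <;> simp [hv.eq_iff]
  have hL : ∀ v : Fin 7 → V, Function.Injective v →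
      triad (v 0) (v 1) (v 2) - triad (v 1) (v 0) (v 6) ∈ bdryOn 1 {v 0, v 1, v 2, v 6} ∧
      triad (v 0) (v 1) (v 2) - triad (v 6) (v 2) (v 1) ∈ bdryOn 1 {v 0, v 1, v 2, v 6} :=
    fun v hv => by
      apply triad_sub_triad_mem_bdryOn <;> simp [hv.eq_iff]
  have h36 : Equiv.swap 3 6 ∈ biTriadSymm S := fun v hv hS => by
    rw [Equiv.Perm.sign_swap (by decide)]
    convert biTriad_sub_mem_of_right hv hS (hR v hv).2 using 1
    simp [biTriad, triad, Equiv.swap_apply_def, mul_sub]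
    abel
  have h3456 : Equiv.swap 3 4 * Equiv.swap 5 6 ∈ biTriadSymm S := fun v hv hS => by
    rw [show Equiv.Perm.sign (Equiv.swap (3 : Fin 7) 4 * Equiv.swap 5 6) = 1 by
      rw [Equiv.Perm.sign_mul, Equiv.Perm.sign_swap (by decide),
        Equiv.Perm.sign_swap (by decide)]; rfl]
    convert Submodule.neg_mem _ (biTriad_sub_mem_of_right hv hS (hR v hv).1) using 1
    simp [biTriad, triad, Equiv.swap_apply_def, mul_sub]
  have h06 : Equiv.swap 0 6 ∈ biTriadSymm S := fun v hv hS => by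
    rw [Equiv.Perm.sign_swap (by decide)]
    convert biTriad_sub_mem_of_left hv hS (hL v hv).2 using 1
    simp [biTriad, triad, Equiv.swap_apply_def, mul_sub, sub_mul]
    abel
  have h0126 : Equiv.swap 0 1 * Equiv.swap 2 6 ∈ biTriadSymm S := fun v hv hS => by
    rw [show Equiv.Perm.sign (Equiv.swap (0 : Fin 7) 1 * Equiv.swap 2 6) = 1 by
      rw [Equiv.Perm.sign_mul, Equiv.Perm.sign_swap (by decide),
        Equiv.Perm.sign_swap (by decide)]; rfl]
    convert Submodule.neg_mem _ (biTriad_sub_mem_of_left hv hS (hL v hv).1) using 1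
    simp [biTriad, triad, Equiv.swap_apply_def, mul_sub, sub_mul]
  have conj : ∀ {σ τ : Equiv.Perm (Fin 7)}, σ ∈ biTriadSymm S → τ ∈ biTriadSymm S →
      σ * τ * σ ∈ biTriadSymm S := fun hσ hτ => mul_mem (mul_mem hσ hτ) hσ
  have h05 : Equiv.swap 0 5 ∈ biTriadSymm S := by
    convert conj h3456 h06 using 1; decide
  have h23 : Equiv.swap 2 3 ∈ biTriadSymm S := by
    convert conj h0126 h36 using 1; decide
  have h03 : Equiv.swap 0 3 ∈ biTriadSymm S := by
    convert conj h06 h36 using 1; decide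
  have h04 : Equiv.swap 0 4 ∈ biTriadSymm S := by
    convert conj h05 h45 using 1; decide
  have h34 : Equiv.swap 3 4 ∈ biTriadSymm S := by
    convert conj h03 h04 using 1; decide
  have h56 : Equiv.swap 5 6 ∈ biTriadSymm S := by
    convert conj h05 h06 using 1; decide
  have h02 : Equiv.swap 0 2 ∈ biTriadSymm S := by
    convert conj h03 h23 using 1; decide
  have h01 : Equiv.swap 0 1 ∈ biTriadSymm S := by
    convert conj h02 h12 using 1; decide
  rw [eq_top_iff]
  intro σ _
  have hσ : σ ∈ Submonoid.closure (Set.range fun i : Fin 6 => Equiv.swap i.castSucc i.succ) := by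
    rw [Equiv.Perm.mclosure_swap_castSucc_succ]; trivial
  refine (Submonoid.closure_le (S := (biTriadSymm S).toSubmonoid)).2 ?_ hσ
  rintro _ ⟨i, rfl⟩
  fin_cases i
  · exact h01
  · exact h12
  · exact h23
  · exact h34
  · exact h45
  · exact h56

theorem biTriad_comp_sub_mem {S : Finset V} (σ : Equiv.Perm (Fin 7)) {v : Fin 7 → V}
    (hv : Function.Injective v) (hS : ∀ i, v i ∈ S) :
    biTriad (v ∘ σ) - (Equiv.Perm.sign σ : ℤ) • biTriad v ∈ bdryOn 2 S :=
  (show σ ∈ biTriadSymm S by rw [biTriadSymm_eq_top]; trivial) v hv hS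

/-- Rotating `4, 5, 6` is even and so preserves the class. The three rotated triads at `v 3` sum to
zero, so three equal classes sum to zero. -/
theorem three_smul_biTriad_mem {S : Finset V} {v : Fin 7 → V}
    (hv : Function.Injective v) (hS : ∀ i, v i ∈ S) : (3 : ℤ) • biTriad v ∈ bdryOn 2 S := by
  have h1 := biTriad_comp_sub_mem (Equiv.swap 4 5 * Equiv.swap 5 6) hv hS
  have h2 := biTriad_comp_sub_mem (Equiv.swap 4 6 * Equiv.swap 5 6) hv hS
  rw [Equiv.Perm.sign_mul, Equiv.Perm.sign_swap (by decide),
    Equiv.Perm.sign_swap (by decide)] at h1 h2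
  convert Submodule.neg_mem _ (Submodule.add_mem _ h1 h2) using 1
  simp [biTriad, triad, Equiv.swap_apply_def, mul_sub, sub_mul]
  noncomm_ring

/-- The cycles on which multiplication by `3`, and the sum with the transposition of `p` and `q`,
give boundaries. -/
noncomputable def signCycles (k : ℕ) (S : Finset V) (p q : V) : Submodule ℤ (EdgeAlg V) :=
  (bdryOn k S).comap ((3 : ℤ) • LinearMap.id) ⊓
    (bdryOn k S).comap (LinearMap.id + (relabel (Equiv.swap p q)).toLinearMap)

theorem mem_signCycles {k : ℕ} {S : Finset V} {p q : V} {x : EdgeAlg V} :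
    x ∈ signCycles k S p q ↔ (3 : ℤ) • x ∈ bdryOn k S ∧
      x + relabel (Equiv.swap p q) x ∈ bdryOn k S := Iff.rfl

theorem swap_mapsTo {S : Finset V} {p q : V} (hp : p ∈ S) (hq : q ∈ S) :
    Set.MapsTo (Equiv.swap p q) S S := by
  intro z hz
  rw [Equiv.swap_apply_def]
  split_ifs <;> assumption

theorem bdryOn_le_signCycles {k : ℕ} {S : Finset V} {p q : V} (hp : p ∈ S) (hq : q ∈ S) :
    bdryOn k S ≤ signCycles k S p q := fun _ hx =>
  mem_signCycles.2 ⟨Submodule.smul_mem _ _ hx, Submodule.add_mem _ hx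
    (relabel_mem_bdryOn (swap_mapsTo hp hq) (Equiv.injective _).injOn hx)⟩

theorem biTriad_mem_signCycles {S : Finset V} (hS : S.card = 7) {p q : V} (hp : p ∈ S)
    (hq : q ∈ S) (hpq : p ≠ q) {v : Fin 7 → V} (hv : Function.Injective v)
    (hvS : ∀ i, v i ∈ S) : biTriad v ∈ signCycles 2 S p q := by
  have him : Finset.univ.image v = S :=
    Finset.eq_of_subset_of_card_le (fun z hz => by
      obtain ⟨i, -, rfl⟩ := Finset.mem_image.1 hz; exact hvS i)
      (by rw [Finset.card_image_of_injective _ hv, hS]; simp)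
  rw [← him] at hp hq
  obtain ⟨i, -, rfl⟩ := Finset.mem_image.1 hp
  obtain ⟨j, -, rfl⟩ := Finset.mem_image.1 hq
  refine mem_signCycles.2 ⟨three_smul_biTriad_mem hv hvS, ?_⟩
  have h := biTriad_comp_sub_mem (Equiv.swap i j) hv hvS
  rw [Equiv.Perm.sign_swap fun h => hpq (by rw [h])] at h
  convert h using 1
  simp [biTriad, hv.map_swap]
  abel

theorem card_sub_two_le (S : Finset V) (p q : V) : S.card - 2 ≤ (S \ {p, q}).card := by
  have := Finset.le_card_sdiff {p, q} S
  have := Finset.card_le_two (a := p) (b := q)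
  omega

theorem card_sub_three_le (S : Finset V) (p q r : V) : S.card - 3 ≤ (S \ {p, q, r}).card := by
  have := Finset.le_card_sdiff {p, q, r} S
  have := Finset.card_le_three (a := p) (b := q) (c := r)
  omega

theorem card_sdiff_triple {S : Finset V} {p q r : V} (hp : p ∈ S) (hq : q ∈ S) (hr : r ∈ S)
    (hpq : p ≠ q) (hpr : p ≠ r) (hqr : q ≠ r) : (S \ {p, q, r}).card = S.card - 3 := by
  rw [Finset.card_sdiff_of_subset (by grind), Finset.card_eq_three.2 ⟨p, q, r, hpq, hpr, hqr, rfl⟩]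

set_option maxHeartbeats 1000000 in
/-- In the bottom degree, cycles are generated by boundaries and suspensions on triads that avoid
two given vertices. -/
theorem cycleOn_le_of_triads_avoiding {k : ℕ} {S : Finset V} (hS : 3 * k + 10 ≤ S.card) (p q : V)
    {M : Submodule ℤ (EdgeAlg V)} (hB : bdryOn (k + 3) S ≤ M)
    (avoid : ∀ u ∈ S \ {p, q}, ∀ v ∈ S \ {p, q}, ∀ a ∈ S \ {p, q}, u ≠ v → a ≠ u → a ≠ v →
      ∀ y ∈ cycleOn (k + 2) (S \ {u, v, a}), triad u a v * y ∈ M) : cycleOn (k + 3) S ≤ M := by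
  intro x hx
  refine cycle_induction_avoiding (by omega) p q ?_ hx hB fun u hu v hv huv a ha y hy => ?_
  · exact le_trans (by omega) (card_sub_two_le S p q)
  -- Up to three disjoint triads are split off, each meeting `{p, q}` at most in its middle entry.
  -- At most two of them can meet it, so one avoids it and is brought to the front, up to sign.
  by_cases hapq : a ∈ ({p, q} : Finset V)
  swap
  · exact avoid u hu v hv a (by grind) huv (by grind) (by grind) y hy
  have hmul : ∀ z ∈ bdryOn (k + 2) (S \ {u, v, a}), triad u a v * z ∈ M := fun z hz =>
    hB (triad_mul_mem_bdryOn (by grind) (by grind) (by grind) (by grind) huv (by grind) hz)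
  have hS1 : 3 * k + 7 ≤ (S \ {u, v, a}).card :=
    le_trans (by omega) (card_sub_three_le S u v a)
  refine cycle_induction_avoiding (M := M.comap (LinearMap.mulLeft ℤ (triad u a v)))
    (by omega) p q (le_trans (by omega) (card_sub_two_le _ p q)) hy hmul ?_
  intro u' hu' v' hv' huv' a' ha' z hz
  rw [Submodule.mem_comap, LinearMap.mulLeft_apply]
  by_cases hapq' : a' ∈ ({p, q} : Finset V)
  swap
  · rw [triad_mul_triad]
    refine Submodule.neg_mem _ (avoid u' (by grind) v' (by grind) a' (by grind) huv' (by grind)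
      (by grind) _ (triad_mul_mem_cycleOn (T := (S \ {u, v, a}) \ {u', v', a'}) (by grind)
        (by grind) (by grind) (by grind) (by grind) ?_ hz))
    clear avoid hmul
    grind
  have hS2 : 3 * k + 4 ≤ ((S \ {u, v, a}) \ {u', v', a'}).card :=
    le_trans (by omega) (card_sub_three_le _ u' v' a')
  have hmul' : ∀ z ∈ bdryOn (k + 1) ((S \ {u, v, a}) \ {u', v', a'}),
      triad u a v * (triad u' a' v' * z) ∈ M := fun z hz =>
    hmul _ (triad_mul_mem_bdryOn (by grind) (by grind) (by grind) (by grind) huv' (by grind) hz)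
  refine cycle_induction_avoiding (M := M.comap
    (LinearMap.mulLeft ℤ (triad u a v) ∘ₗ LinearMap.mulLeft ℤ (triad u' a' v')))
    (by omega) p q (le_trans (by omega) (card_sub_two_le _ p q)) hz hmul' ?_
  intro u'' hu'' v'' hv'' huv'' a'' ha'' t ht
  simp only [Submodule.mem_comap, LinearMap.comp_apply, LinearMap.mulLeft_apply]
  rw [triad_mul_triad u', mul_neg, triad_mul_triad u, neg_neg]
  clear hmul hmul' hB hS hS1 hS2
  have e1 : u'' ∈ S \ {p, q} ∧ v'' ∈ S \ {p, q} ∧ a'' ∈ S \ {p, q} := by grind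
  refine avoid u'' e1.1 v'' e1.2.1 a'' e1.2.2 huv'' (by grind) (by grind) _ ?_
  clear avoid
  clear hapq hapq' e1
  have hT : ((S \ {u, v, a}) \ {u', v', a'}) \ {u'', v'', a''} ⊆
      ((S \ {u, v, a}) \ {u'', v'', a''}) \ {u', a', v'} := fun w hw => by
    simp only [Finset.mem_sdiff, Finset.mem_insert, Finset.mem_singleton] at hw ⊢
    tauto
  simp only [Finset.mem_sdiff, Finset.mem_insert, Finset.mem_singleton, not_or] at *
  have ht' : triad u' a' v' * t ∈ cycleOn (k + 1) ((S \ {u, v, a}) \ {u'', v'', a''}) := by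
    refine triad_mul_mem_cycleOn ?_ ?_ ?_ (by tauto) huv' hT ht <;>
      simp only [Finset.mem_sdiff, Finset.mem_insert, Finset.mem_singleton, not_or] <;> grind
  have hT' : (S \ {u, v, a}) \ {u'', v'', a''} ⊆ (S \ {u'', v'', a''}) \ {u, a, v} := fun w hw => by
    simp only [Finset.mem_sdiff, Finset.mem_insert, Finset.mem_singleton] at hw ⊢
    tauto
  refine triad_mul_mem_cycleOn ?_ ?_ ?_ (by tauto) huv hT' ht' <;>
    simp only [Finset.mem_sdiff, Finset.mem_insert, Finset.mem_singleton, not_or] <;> grind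

/-- Splitting off two triads leaves only the empty matching, and a seventh vertex to spare: the
generators are exactly of the form `biTriad`. -/
theorem cycleOn_two_le_signCycles {S : Finset V} (hS : S.card = 7) {p q : V}
    (hp : p ∈ S) (hq : q ∈ S) (hpq : p ≠ q) : cycleOn 2 S ≤ signCycles 2 S p q := by
  have hB := bdryOn_le_signCycles (k := 2) hp hq
  intro x hx
  refine cycle_induction_avoiding (by omega) p q
    (le_trans (by omega) (card_sub_two_le S p q)) hx hB fun u hu v hv huv a ha y hy => ?_
  have hS1 : 4 ≤ (S \ {u, v, a}).card := le_trans (by omega) (card_sub_three_le S u v a)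
  refine cycle_induction_avoiding (M := (signCycles 2 S p q).comap
    (LinearMap.mulLeft ℤ (triad u a v))) (by omega) p q
    (le_trans (by omega) (card_sub_two_le _ p q)) hy ?_ ?_
  · intro z hz
    exact hB (triad_mul_mem_bdryOn (by grind) (by grind) (by grind) (by grind) huv
      (by grind) hz)
  · intro u' hu' v' hv' huv' a' ha' z hz
    refine chainOn_zero_le (M := (signCycles 2 S p q).comap (LinearMap.mulLeft ℤ (triad u a v)
      ∘ₗ LinearMap.mulLeft ℤ (triad u' a' v'))) ?_ hz.1
    obtain ⟨s, hs⟩ : ((S \ {u, v, a}) \ {u', v', a'}).Nonempty := by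
      rw [← Finset.card_pos]
      exact lt_of_lt_of_le (by omega) (card_sub_three_le _ u' v' a')
    have := biTriad_mem_signCycles hS hp hq hpq (v := ![u, a, v, u', a', v', s]) (by
      rw [← List.nodup_ofFn]
      simp
      grind) (by
      intro i
      fin_cases i <;> simp <;> grind)
    simpa [biTriad] using this

/-- In the bottom degree for `3k + 1` vertices (`k ≥ 2`), multiplication by `3` is zero and
transpositions act by `-1`. -/
theorem cycleOn_le_signCycles {k : ℕ} {S : Finset V} (hS : S.card = 3 * (k + 2) + 1) {p q : V}
    (hp : p ∈ S) (hq : q ∈ S) (hpq : p ≠ q) : cycleOn (k + 2) S ≤ signCycles (k + 2) S p q := by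
  induction k generalizing S with
  | zero => exact cycleOn_two_le_signCycles hS hp hq hpq
  | succ k ih =>
    -- For a triad away from `p` and `q` the transposition acts on the other factor alone, where the
    -- induction hypothesis applies.
    refine cycleOn_le_of_triads_avoiding (by omega) p q (bdryOn_le_signCycles hp hq) ?_
    intro u hu v hv a ha huv hau hav y hy
    have hmul : ∀ z ∈ bdryOn (k + 2) (S \ {u, v, a}), triad u a v * z ∈ bdryOn (k + 3) S :=
      fun z hz => triad_mul_mem_bdryOn (by grind) (by grind) (by grind) (by grind) huv
        (by grind) hz
    have h4 := mem_signCycles.1 (ih (by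
      rw [card_sdiff_triple (by grind) (by grind) (by grind) huv hau.symm hav.symm]
      omega) (by grind) (by grind) hy)
    refine mem_signCycles.2 ⟨?_, ?_⟩
    · rw [← mul_smul_comm]
      exact hmul _ h4.1
    · have hu1 : Equiv.swap p q u = u := Equiv.swap_apply_of_ne_of_ne (by grind) (by grind)
      have hv1 : Equiv.swap p q v = v := Equiv.swap_apply_of_ne_of_ne (by grind) (by grind)
      have ha1 : Equiv.swap p q a = a := Equiv.swap_apply_of_ne_of_ne (by grind) (by grind)
      rw [map_mul, relabel_triad, hu1, hv1, ha1, ← mul_add]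
      exact hmul _ h4.2

end

/-! ### The nonvanishing step and its start on four vertices. -/

section

variable {V W : Type*} [DecidableEq V]

/-- Boundaries together with the relations saying that transpositions act by `-1`. -/
noncomputable def signRel (k : ℕ) (S : Finset V) : Submodule ℤ (EdgeAlg V) :=
  bdryOn k S ⊔ Submodule.span ℤ {y | ∃ p ∈ S, ∃ q ∈ S, p ≠ q ∧ ∃ x ∈ cycleOn k S,
    y = x + relabel (Equiv.swap p q) x}

theorem bdryOn_le_signRel (k : ℕ) (S : Finset V) : bdryOn k S ≤ signRel k S := le_sup_left

theorem add_swap_mem_signRel {k : ℕ} {S : Finset V} {p q : V} (hp : p ∈ S) (hq : q ∈ S)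
    (hpq : p ≠ q) {x : EdgeAlg V} (hx : x ∈ cycleOn k S) :
    x + relabel (Equiv.swap p q) x ∈ signRel k S :=
  le_sup_right (a := bdryOn k S) (Submodule.subset_span ⟨p, hp, q, hq, hpq, x, hx, rfl⟩)

/-- From seven vertices on the sign relations cost nothing, so that the conclusion of
`triad_mul_notMem_bdryOn` can serve as its next hypothesis. -/
theorem signRel_eq_bdryOn {k : ℕ} {S : Finset V} (hS : S.card = 3 * (k + 2) + 1) :
    signRel (k + 2) S = bdryOn (k + 2) S := by
  refine le_antisymm (sup_le le_rfl (Submodule.span_le.2 ?_)) le_sup_left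
  rintro _ ⟨p, hp, q, hq, hpq, x, hx, rfl⟩
  exact (mem_signCycles.1 (cycleOn_le_signCycles hS hp hq hpq hx)).2

theorem coeff_coeff {V : Type*} (a b c d : V) (x : EdgeAlg V) :
    coeff a b (coeff c d x) = -coeff c d (coeff a b x) :=
  CliffordAlgebra.contractLeft_comm _ _ _

/-- Delete from the link of `q` at `ua` all terms through `v`; the boundary of the rest is, up to
sign, the given element. -/
theorem coeff_bd_add_sum_mem {k : ℕ} {S : Finset V} {u v a : V} (hv : v ∈ S)
    (huv : u ≠ v) (hua : u ≠ a) (hav : a ≠ v) {q : EdgeAlg V} (hq : q ∈ chainOn (k + 2) S)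
    (h : ∀ b ∈ S \ {u, v, a}, bd (coeff v b (coeff u a q)) = 0) :
    coeff u a (bd q) + ∑ b ∈ S \ {u, v, a}, coeff v b (coeff u a q) ∈
      bdryOn k (S \ {u, v, a}) := by
  have h1 := sub_sum_coeff_mem_chainOn (v := v) (by grind) (coeff_mem_chainOn hua hq)
  rw [show (S \ {u, a}).erase v = S \ {u, v, a} by grind] at h1
  refine ⟨_, Submodule.neg_mem _ h1, ?_⟩
  rw [map_neg, map_sub, bd_coeff, map_sum, Finset.sum_congr rfl fun b hb => by
    rw [bd_edge_mul (by grind), h b hb, mul_zero, sub_zero]]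
  abel

-- Let `bd q` be the suspension and `w b c` the double links of `q`. The links at `u` give that `∑
-- c, w b c`, plus `z` when `b = a`, bounds; those at `v` give that `∑ b, w b c` bounds. After
-- transport to `T`, the row and column versions of each `w b c` cancel modulo sign relations, so
-- adding up all rows and columns leaves `z`.
set_option maxHeartbeats 1000000 in
theorem triad_mul_notMem_bdryOn {k : ℕ} {T : Finset V} {u v a : V} (hu : u ∉ T) (hv : v ∉ T)
    (ha : a ∉ T) (huv : u ≠ v) (hua : u ≠ a) (hva : v ≠ a) {z : EdgeAlg V}
    (hz : z ∈ cycleOn k T) (hzJ : z ∉ signRel k T) :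
    triad u a v * z ∉ bdryOn (k + 1) (insert u (insert v (insert a T))) := by
  rintro ⟨q, hq, hqz⟩
  obtain ⟨A, hA⟩ : ∃ A, A = insert a T := ⟨_, rfl⟩
  rw [← hA] at hq
  have hSA : ∀ b, insert u (insert v A) \ {u, v, b} = A.erase b := by grind
  have hSA' : ∀ b, insert u (insert v A) \ {v, u, b} = A.erase b := by grind
  have hu1 : ∀ b ∈ A, coeff u b (triad u a v * z) = if b = a then z else 0 := by
    intro b hb
    have e : coeff u b z = 0 := coeff_eq_zero (by grind) hz.1
    rw [triad, sub_mul, map_sub, coeff_edge_mul_of_ne (c := u) (d := v) (by simp; grind), e]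
    split_ifs with hba
    · subst hba
      rw [coeff_edge_mul_self hua, e]
      simp
    · rw [coeff_edge_mul_of_ne (by simp; grind), e]
      simp
  have hv1 : ∀ b ∈ A, coeff v b (triad u a v * z) = 0 := by
    intro b hb
    have e : coeff v b z = 0 := coeff_eq_zero (by grind) hz.1
    rw [triad, sub_mul, map_sub, coeff_edge_mul_of_ne (c := u) (d := v) (by simp; grind), e,
      coeff_edge_mul_of_ne (by simp; grind), e]
    simp
  obtain ⟨w, hw⟩ : ∃ w : V → V → EdgeAlg V, ∀ b c, w b c = coeff v c (coeff u b q) :=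
    ⟨_, fun _ _ => rfl⟩
  have hw' : ∀ b c, coeff u b (coeff v c q) = -w b c := fun b c => by rw [hw, coeff_coeff]
  have hwc : ∀ b ∈ A, ∀ c ∈ A.erase b, w b c ∈ cycleOn k (A \ {b, c}) := by
    intro b hb c hc
    refine mem_cycleOn.2 ⟨?_, ?_⟩
    · rw [hw]
      exact chainOn_mono (by grind) (coeff_mem_chainOn (by grind)
        (coeff_mem_chainOn (by grind) hq))
    · rw [hw, bd_coeff, bd_coeff, hqz, hu1 b hb]
      split_ifs
      · rw [map_neg, coeff_eq_zero (by grind) hz.1]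
        simp
      · simp
  have hrow : ∀ b ∈ A, (if b = a then z else 0) + ∑ c ∈ A.erase b, w b c ∈
      bdryOn k (A.erase b) := by
    intro b hb
    have := coeff_bd_add_sum_mem (u := u) (v := v) (a := b) (by grind) huv (by grind) (by grind)
      hq (fun c hc => by
        rw [hSA] at hc
        rw [← hw]; exact (mem_cycleOn.1 (hwc b hb c hc)).2)
    rw [hSA, hqz, hu1 b hb] at this
    simpa only [hw] using this
  have hcol : ∀ c ∈ A, ∑ b ∈ A.erase c, w b c ∈ bdryOn k (A.erase c) := by
    intro c hc
    have := coeff_bd_add_sum_mem (u := v) (v := u) (a := c) (by grind) huv.symm (by grind)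
      (by grind) hq (fun b hb => by
        rw [hSA'] at hb
        rw [hw', map_neg, (mem_cycleOn.1 (hwc b (by grind) c (by grind))).2, neg_zero])
    rw [hSA', hqz, hv1 c hc, zero_add] at this
    simp only [hw', Finset.sum_neg_distrib] at this
    simpa using Submodule.neg_mem _ this
  -- `φ b` carries `A.erase b` to `T` by the transposition of `a` and `b`, corrected by the sign of
  -- that permutation.
  obtain ⟨φ, hφ⟩ : ∃ φ : V → EdgeAlg V →ₗ[ℤ] EdgeAlg V, ∀ b x, φ b x =
    (if b = a then (1 : ℤ) else -1) • relabel (Equiv.swap a b) x :=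
    ⟨fun b => (if b = a then (1 : ℤ) else -1) • (relabel (Equiv.swap a b)).toLinearMap,
      fun b x => rfl⟩
  have hmaps : ∀ b ∈ A, Set.MapsTo (Equiv.swap a b) (A.erase b) T := by
    intro b hb c hc
    rw [Equiv.swap_apply_def]
    simp only [Finset.coe_erase, Set.mem_sdiff, Finset.mem_coe, Set.mem_singleton_iff] at hc ⊢
    split_ifs <;> grind
  have hφB : ∀ b ∈ A, ∀ x ∈ bdryOn k (A.erase b), φ b x ∈ signRel k T := by
    intro b hb x hx
    rw [hφ]
    exact Submodule.smul_mem _ _ (bdryOn_le_signRel k T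
      (relabel_mem_bdryOn (hmaps b hb) (Equiv.injective _).injOn hx))
  -- Since `w b c` avoids both `b` and `c`, its two transports differ by the transposition of `b`
  -- and `c` in `T`; if one of `b`, `c` is `a`, both relabellings are trivial and only the signs
  -- differ.
  have hanti : ∀ b ∈ A, ∀ c ∈ A.erase b, φ b (w b c) + φ c (w b c) ∈ signRel k T := by
    intro b hb c hc
    have hwbc := hwc b hb c hc
    rw [hφ, hφ]
    by_cases hba : b = a
    · subst hba
      rw [if_pos rfl, if_neg (by grind), relabel_eq_self (f := Equiv.swap b b) (by simp) hwbc.1,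
        relabel_eq_self (f := Equiv.swap b c) (S := A \ {b, c}) _ hwbc.1]
      · simp
      · intro d hd
        exact Equiv.swap_apply_of_ne_of_ne (by grind) (by grind)
    by_cases hca : c = a
    · subst hca
      rw [if_pos rfl, if_neg hba, relabel_eq_self (f := Equiv.swap c c) (by simp) hwbc.1,
        relabel_eq_self (f := Equiv.swap c b) (S := A \ {b, c}) _ hwbc.1]
      · simp
      · intro d hd
        exact Equiv.swap_apply_of_ne_of_ne (by grind) (by grind)
    · rw [if_neg hba, if_neg hca]
      have h1 : relabel (Equiv.swap a b) (w b c) ∈ cycleOn k T :=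
        relabel_mem_cycleOn (hmaps b hb) (Equiv.injective _).injOn
          (cycleOn_mono (by grind) hwbc)
      have h2 := add_swap_mem_signRel (p := b) (q := c)
        (Finset.mem_of_mem_insert_of_ne (hA ▸ hb) hba)
        (Finset.mem_of_mem_insert_of_ne (hA ▸ Finset.mem_of_mem_erase hc) hca)
        (Finset.ne_of_mem_erase hc).symm h1
      rw [relabel_relabel _ _ (Equiv.swap a c) (S := A \ {b, c}) _ hwbc.1] at h2
      · convert Submodule.neg_mem _ h2 using 1
        simp
        abel
      · intro d hd
        simp only [Equiv.swap_apply_def]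
        grind
  have hsum1 : ∑ b ∈ A, φ b ((if b = a then z else 0) + ∑ c ∈ A.erase b, w b c) =
      z + ∑ b ∈ A, ∑ c ∈ A.erase b, φ b (w b c) := by
    simp only [map_add, map_sum, Finset.sum_add_distrib]
    congr 1
    rw [Finset.sum_eq_single a]
    · simp only [if_true, hφ]
      rw [relabel_eq_self (by simp) hz.1, one_smul]
    · intro b _ hb
      simp [hb]
    · grind
  have hsum2 : ∑ c ∈ A, φ c (∑ b ∈ A.erase c, w b c) =
      ∑ b ∈ A, ∑ c ∈ A.erase b, φ c (w b c) := by
    simp only [map_sum]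
    refine Finset.sum_comm' fun b c => ?_
    grind
  have h1 : ∑ b ∈ A, φ b ((if b = a then z else 0) + ∑ c ∈ A.erase b, w b c) ∈ signRel k T :=
    Submodule.sum_mem _ fun b hb => hφB b hb _ (hrow b hb)
  have h2 : ∑ c ∈ A, φ c (∑ b ∈ A.erase c, w b c) ∈ signRel k T :=
    Submodule.sum_mem _ fun c hc => hφB c hc _ (hcol c hc)
  have h3 : ∑ b ∈ A, ∑ c ∈ A.erase b, (φ b (w b c) + φ c (w b c)) ∈ signRel k T :=
    Submodule.sum_mem _ fun b hb => Submodule.sum_mem _ fun c hc => hanti b hb c hc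
  apply hzJ
  convert Submodule.sub_mem _ (Submodule.add_mem _ h1 h2) h3 using 1
  rw [hsum1, hsum2]
  simp only [Finset.sum_add_distrib]
  abel

section Base

/-- Weights of the edges on four vertices, constant on perfect matchings. -/
def weightFour : Sym2 (Fin 4) → ZMod 3 :=
  Sym2.lift ⟨fun i j => if i.val ^^^ j.val = 1 then 1 else if i.val ^^^ j.val = 2 then -1 else 0,
    by decide⟩

theorem weightFour_eq : ∀ a b c d : Fin 4, a ≠ b → a ≠ c → a ≠ d → b ≠ c → b ≠ d → c ≠ d →
    weightFour s(a, b) = weightFour s(c, d) := by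
  have h : ∀ a b c d : Fin 4, [a, b, c, d].Nodup → weightFour s(a, b) = weightFour s(c, d) := by
    decide
  intro a b c d h1 h2 h3 h4 h5 h6
  exact h a b c d (by simp [*])

/-- The linear form on chains that sums a weight over the edges. -/
noncomputable def weightForm {V R : Type*} [AddCommGroup R] (c : Sym2 V → R) :
    EdgeAlg V →ₗ[ℤ] R :=
  Finsupp.linearCombination ℤ (fun s : (⊤ : SimpleGraph V).edgeSet => c s) ∘ₗ
    ExteriorAlgebra.ιInv

theorem weightForm_edge {V R : Type*} [AddCommGroup R] (c : Sym2 V → R) {a b : V} (h : a ≠ b) :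
    weightForm c (edge a b) = c s(a, b) := by
  rw [weightForm, LinearMap.comp_apply, edge, ExteriorAlgebra.ι_leftInverse, edgeVec_of_ne h]
  simp

theorem chainOn_one_le {S : Finset V} {M : Submodule ℤ (EdgeAlg V)}
    (h : ∀ a ∈ S, ∀ b ∈ S, a ≠ b → edge a b ∈ M) : chainOn 1 S ≤ M :=
  chainOn_succ_le fun a ha b hb hab y hy =>
    chainOn_zero_le (M := M.comap (LinearMap.mulLeft ℤ (edge a b)))
      (by simpa using h a ha b hb hab) hy

theorem chainOn_two_le {S : Finset V} {M : Submodule ℤ (EdgeAlg V)}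
    (h : ∀ a ∈ S, ∀ b ∈ S, ∀ c ∈ S, ∀ d ∈ S, a ≠ b → a ≠ c → a ≠ d → b ≠ c → b ≠ d → c ≠ d →
      edge a b * edge c d ∈ M) : chainOn 2 S ≤ M :=
  chainOn_succ_le fun a ha b hb hab y hy =>
    chainOn_one_le (M := M.comap (LinearMap.mulLeft ℤ (edge a b)))
      (fun c hc d hd hcd => h a ha b hb c (by grind) d (by grind) hab (by grind) (by grind)
        (by grind) (by grind) hcd) hy

/-- The weight takes the three values of `ZMod 3` on the three perfect matchings. A transposition
fixes one matching and exchanges the others; as the values sum to zero, the weight plus its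
transpose is a constant `l`. The coefficients of a cycle sum to zero, so the weight kills sign
relations, but it does not kill the triad. -/
theorem exists_notMem_signRel_one :
    ∃ z ∈ cycleOn 1 (Finset.univ : Finset (Fin 4)), z ∉ signRel 1 Finset.univ := by
  refine ⟨triad 0 1 2, triad_mem_cycleOn (by simp) (by simp) (by simp) (by decide) (by decide),
    fun h => ?_⟩
  have hJ : signRel 1 (Finset.univ : Finset (Fin 4)) ≤ LinearMap.ker (weightForm weightFour) := by
    refine sup_le ?_ (Submodule.span_le.2 ?_)
    · rw [bdryOn, Submodule.map_le_iff_le_comap]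
      refine chainOn_two_le fun a _ b _ c _ d _ hab hac had hbc hbd hcd => ?_
      rw [Submodule.mem_comap, LinearMap.mem_ker, bd_edge_mul hab, bd_edge hcd, mul_one, map_sub,
        weightForm_edge _ hab, weightForm_edge _ hcd, weightFour_eq a b c d hab hac had hbc hbd hcd,
        sub_self]
    · rintro _ ⟨p, -, q, -, hpq, x, hx, rfl⟩
      obtain ⟨l, hl⟩ : ∃ l : ZMod 3, ∀ i j : Fin 4, i ≠ j → weightFour s(i, j) +
          weightFour s(Equiv.swap p q i, Equiv.swap p q j) = l := by
        revert p q
        decide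
      have h1 : weightForm weightFour x + weightForm weightFour (relabel (Equiv.swap p q) x) =
          (ExteriorAlgebra.algebraMapInv (bd x) : ℤ) • l := by
        refine chainOn_one_le (M := LinearMap.eqLocus (weightForm weightFour +
          weightForm weightFour ∘ₗ (relabel (Equiv.swap p q)).toLinearMap)
          (((LinearMap.toSpanSingleton ℤ (ZMod 3) l) ∘ₗ
            ExteriorAlgebra.algebraMapInv.toLinearMap) ∘ₗ bd)) (fun i _ j _ hij => ?_) hx.1
        simp only [LinearMap.mem_eqLocus, LinearMap.add_apply, LinearMap.comp_apply,
          AlgHom.toLinearMap_apply, relabel_edge, bd_edge hij]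
        rw [weightForm_edge _ hij, weightForm_edge _ ((Equiv.injective _).ne hij), hl i j hij]
        simp
      rw [SetLike.mem_coe, LinearMap.mem_ker, map_add, h1, (mem_cycleOn.1 hx).2]
      simp
  have h1 := hJ h
  rw [LinearMap.mem_ker, triad, map_sub, weightForm_edge _ (by decide),
    weightForm_edge _ (by decide)] at h1
  revert h1
  decide

end Base

end

/-! ### Pentagons and cycles on `3k + 5` vertices. -/

section

variable {V W : Type*} [DecidableEq V]

/-- The `5`-cycle of pairwise disjoint consecutive edges `wa, bc, dw, ab, cd`. -/
noncomputable def pent {V : Type*} (w a b c d : V) : EdgeAlg V :=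
  edge w a * edge b c + edge b c * edge d w + edge d w * edge a b + edge a b * edge c d +
    edge c d * edge w a

@[simp] theorem relabel_pent {V : Type*} (f : V → W) (w a b c d : V) :
    relabel f (pent w a b c d) = pent (f w) (f a) (f b) (f c) (f d) := by
  simp [pent]

theorem edge_mul_edge_mem_chainOn {S : Finset V} {a b c d : V} (ha : a ∈ S) (hb : b ∈ S)
    (hc : c ∈ S) (hd : d ∈ S) (h : [a, b, c, d].Nodup) : edge a b * edge c d ∈ chainOn 2 S := by
  simp only [List.nodup_cons, List.mem_cons, not_or] at h
  exact edge_mul_mem_chainOn ha hb h.1.1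
    (edge_mem_chainOn (by simp; grind) (by simp; grind) h.2.2.1.1)

theorem pent_mem_cycleOn {S : Finset V} {w a b c d : V} (hw : w ∈ S) (ha : a ∈ S) (hb : b ∈ S)
    (hc : c ∈ S) (hd : d ∈ S) (h : [w, a, b, c, d].Nodup) : pent w a b c d ∈ cycleOn 2 S := by
  simp only [List.nodup_cons, List.mem_cons, not_or, List.not_mem_nil, not_false_eq_true,
    List.nodup_nil, and_true] at h
  obtain ⟨⟨hwa, hwb, hwc, hwd⟩, ⟨hab, hac, had⟩, ⟨hbc, hbd⟩, hcd⟩ := h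
  refine mem_cycleOn.2 ⟨?_, ?_⟩
  · unfold pent
    refine Submodule.add_mem _ (Submodule.add_mem _ (Submodule.add_mem _
      (Submodule.add_mem _ ?_ ?_) ?_) ?_) ?_ <;>
    refine edge_mul_edge_mem_chainOn (by assumption) (by assumption) (by assumption)
      (by assumption) ?_ <;> simp [*, Ne.symm, eq_comm]
  · unfold pent
    simp only [map_add]
    rw [bd_edge_mul hwa, bd_edge_mul hbc, bd_edge_mul (Ne.symm hwd), bd_edge_mul hab,
      bd_edge_mul hcd, bd_edge hwa, bd_edge hbc, bd_edge (Ne.symm hwd), bd_edge hab, bd_edge hcd]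
    simp only [mul_one]
    abel

theorem pent_mul_mem_cycleOn {k : ℕ} {S T : Finset V} {w a b c d : V} (hw : w ∈ S) (ha : a ∈ S)
    (hb : b ∈ S) (hc : c ∈ S) (hd : d ∈ S) (h : [w, a, b, c, d].Nodup)
    (hT : T ⊆ S \ {w, a, b, c, d}) {y : EdgeAlg V} (hy : y ∈ cycleOn k T) :
    pent w a b c d * y ∈ cycleOn (k + 2) S := by
  have h := mul_mem_cycleOn (S := {w, a, b, c, d}) (T := T) (by
    rw [Finset.disjoint_left]; grind)
    (pent_mem_cycleOn (by simp) (by simp) (by simp) (by simp) (by simp) h) hy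
  rw [add_comm]
  exact cycleOn_mono (by grind) h

theorem pent_mul_mem_bdryOn {k : ℕ} {S T : Finset V} {w a b c d : V} (hw : w ∈ S) (ha : a ∈ S)
    (hb : b ∈ S) (hc : c ∈ S) (hd : d ∈ S) (h : [w, a, b, c, d].Nodup)
    (hT : T ⊆ S \ {w, a, b, c, d}) {y : EdgeAlg V} (hy : y ∈ bdryOn k T) :
    pent w a b c d * y ∈ bdryOn (k + 2) S := by
  have h := cycleOn_mul_bdryOn (S := {w, a, b, c, d}) (T := T) (by
    rw [Finset.disjoint_left]; grind)
    (pent_mem_cycleOn (by simp) (by simp) (by simp) (by simp) (by simp) h) hy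
  rw [add_comm]
  exact bdryOn_mono (by grind) h

theorem triad_mul_pent_mul {V : Type*} (p q r w a b c d : V) (x : EdgeAlg V) :
    triad p q r * (pent w a b c d * x) = pent w a b c d * (triad p q r * x) := by
  have h : ∀ s t : V, edge s t * (pent w a b c d * x) = pent w a b c d * (edge s t * x) := by
    intro s t
    simp only [pent, add_mul, mul_add, mul_assoc, edge_mul_left_comm s t, mul_neg, neg_neg]
  simp only [triad, sub_mul, mul_sub, h]

/-- Of the five products only `au * vb` contains edges at both `u` and `v` other than `uv`.
Pentagons therefore realise one prescribed double link and no other. -/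
theorem coeff_coeff_pent {k : ℕ} {T : Finset V} {u v a b c : V} (h : [a, u, v, b, c].Nodup)
    (hu : u ∉ T) (hv : v ∉ T) {y : EdgeAlg V} (hy : y ∈ chainOn k T) {a' b' : V}
    (hua : a' ≠ u) (hva : a' ≠ v) (hvb : b' ≠ v) :
    coeff v b' (coeff u a' (pent a u v b c * y)) = if a' = a ∧ b' = b then y else 0 := by
  simp only [List.nodup_cons, List.mem_cons, not_or, List.not_mem_nil, not_false_eq_true,
    List.nodup_nil, and_true] at h
  obtain ⟨⟨hau, hav, hab, hac⟩, ⟨huv, hub', huc⟩, ⟨hvb', hvc⟩, hbc⟩ := h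
  have e1 : coeff u a' y = 0 := coeff_eq_zero (by grind) hy
  have e2 : coeff v b' y = 0 := coeff_eq_zero (by grind) hy
  have s1 : edgeForm s(u, a') (edgeVec s(v, b)) = 0 := edgeForm_of_ne (by simp; grind)
  have s2 : edgeForm s(u, a') (edgeVec s(c, a)) = 0 := edgeForm_of_ne (by simp; grind)
  have s3 : edgeForm s(u, a') (edgeVec s(u, v)) = 0 := edgeForm_of_ne (by simp; grind)
  have s4 : edgeForm s(u, a') (edgeVec s(b, c)) = 0 := edgeForm_of_ne (by simp; grind)
  have s5 : edgeForm s(v, b') (edgeVec s(b, c)) = 0 := edgeForm_of_ne (by simp; grind)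
  have s6 : edgeForm s(u, a') (edgeVec s(a, u)) = if a' = a then 1 else 0 := by
    split_ifs with h
    · subst h
      rw [Sym2.eq_swap]
      exact edgeForm_self hua
    · exact edgeForm_of_ne (by simp; grind)
  have s7 : edgeForm s(v, b') (edgeVec s(v, b)) = if b' = b then 1 else 0 := by
    split_ifs with h
    · subst h
      exact edgeForm_self (Ne.symm hvb)
    · exact edgeForm_of_ne (by simp; grind)
  simp only [pent, add_mul, map_add, mul_assoc, coeff_edge_mul, map_sub, map_smul, e1, e2, s1, s2,
    s3, s4, s5, s6, s7]
  by_cases ha : a' = a <;> by_cases hb : b' = b <;> simp [ha, hb]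

theorem cycleOn_one_le_of_card_two {S : Finset V} (hS : S.card = 2) :
    cycleOn 1 S ≤ bdryOn 1 S := by
  obtain ⟨u, v, huv, rfl⟩ := Finset.card_eq_two.1 hS
  intro x hx
  refine cycle_induction (k := 0) (u := u) (v := v) (by simp) (by simp) huv hx ?_ le_rfl ?_ ?_ <;>
    simp

/-- The links at `c` lose one edge and two vertices, which puts them in the vanishing range. -/
theorem exists_erase_of_card {k : ℕ} {S : Finset V} (hS : 3 * k + 1 ≤ S.card) {x : EdgeAlg V}
    (hx : x ∈ cycleOn k S) {c : V} (hc : c ∈ S) :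
    ∃ y ∈ cycleOn k (S.erase c), x - y ∈ bdryOn k S := by
  cases k with
  | zero =>
    refine ⟨x, ⟨hx.1, hx.2⟩, by simp⟩
  | succ k =>
    refine exists_cycle_erase hc hx fun w hw => ?_
    have hcw : c ≠ w := by grind
    refine cycleOn_le_bdryOn ?_ (coeff_mem_cycleOn hcw hx)
    have := card_sub_two_le S c w
    omega

theorem card_sub_four_le (S : Finset V) (p q r t : V) :
    S.card - 4 ≤ (S \ {p, q, r, t}).card := by
  have := Finset.le_card_sdiff {p, q, r, t} S
  have := Finset.card_le_four (a := p) (b := q) (c := r) (d := t)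
  omega

/-- Here the double links need not bound, but each can be moved off a further vertex `c`. The
pentagon `a u v b c` times the moved cycle has that double link; subtracting all of these makes
`cycle_induction` applicable. -/
theorem cycle_induction_pent {k : ℕ} {S : Finset V} (hS : 3 * k + 5 ≤ S.card) {u v : V}
    (hu : u ∈ S) (hv : v ∈ S) (huv : u ≠ v) {x : EdgeAlg V} (hx : x ∈ cycleOn (k + 2) S)
    {M : Submodule ℤ (EdgeAlg V)} (hB : bdryOn (k + 2) S ≤ M)
    (hM : ∀ a ∈ S, ∀ b ∈ S, ∀ c ∈ S, [a, u, v, b, c].Nodup →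
      ∀ y ∈ cycleOn k (S \ {a, u, v, b, c}), pent a u v b c * y ∈ M)
    (hu' : ∀ a ∈ S \ {u, v}, ∀ y ∈ cycleOn (k + 1) (S \ {u, v, a}), triad u a v * y ∈ M)
    (hv' : ∀ b ∈ S \ {u, v}, ∀ y ∈ cycleOn (k + 1) (S \ {u, v, b}), triad v b u * y ∈ M) :
    x ∈ M := by
  obtain ⟨w, hw⟩ : ∃ w : V → V → EdgeAlg V, ∀ a b, w a b = coeff v b (coeff u a x) :=
    ⟨_, fun _ _ => rfl⟩
  have hwc : ∀ a ∈ S \ {u, v}, ∀ b ∈ (S \ {u, v}).erase a, ∃ c ∈ S \ {u, v, a, b},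
      ∃ y ∈ cycleOn k ((S \ {u, v, a, b}).erase c),
        w a b - y ∈ bdryOn k (S \ {u, v, a, b}) := by
    intro a ha b hb
    have hcard : 3 * k + 1 ≤ (S \ {u, v, a, b}).card :=
      le_trans (by omega) (card_sub_four_le S u v a b)
    obtain ⟨c, hc⟩ := Finset.card_pos.1 (lt_of_lt_of_le (by omega) hcard)
    refine ⟨c, hc, exists_erase_of_card hcard ?_ hc⟩
    rw [hw]
    exact cycleOn_mono (by grind) (coeff_mem_cycleOn (by grind)
      (coeff_mem_cycleOn (by grind) hx))
  choose! c hc y hy hyw using hwc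
  have hnd : ∀ a ∈ S \ {u, v}, ∀ b ∈ (S \ {u, v}).erase a, [a, u, v, b, c a b].Nodup := by
    intro a ha b hb
    have := hc a ha b hb
    simp only [List.nodup_cons, List.mem_cons, not_or, List.not_mem_nil, not_false_eq_true,
      List.nodup_nil, and_true]
    grind
  have hne : ∀ a ∈ S \ {u, v}, a ≠ u ∧ a ≠ v := by simp
  obtain ⟨P, hP⟩ : ∃ P, P = ∑ a ∈ S \ {u, v}, ∑ b ∈ (S \ {u, v}).erase a,
    pent a u v b (c a b) * y a b := ⟨_, rfl⟩
  have hT : ∀ a ∈ S \ {u, v}, ∀ b ∈ (S \ {u, v}).erase a,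
      (S \ {u, v, a, b}).erase (c a b) ⊆ S \ {a, u, v, b, c a b} := by
    intro a _ b _ z hz
    simp only [Finset.mem_erase, Finset.mem_sdiff, Finset.mem_insert, Finset.mem_singleton,
      not_or] at hz ⊢
    tauto
  have hPm : P ∈ cycleOn (k + 2) S ⊓ M := by
    rw [hP]
    refine Submodule.sum_mem _ fun a ha => Submodule.sum_mem _ fun b hb => ⟨?_, ?_⟩
    · exact pent_mul_mem_cycleOn (by grind) hu hv (by grind) (by grind) (hnd a ha b hb)
        (hT a ha b hb) (hy a ha b hb)
    · exact hM a (by grind) b (by grind) _ (by grind) (hnd a ha b hb) _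
        (cycleOn_mono (hT a ha b hb) (hy a ha b hb))
  have hx' : x - P ∈ M := by
    refine cycle_induction hu hv huv (Submodule.sub_mem _ hx hPm.1) (fun a ha b hb hab => ?_)
      hB hu' hv'
    have hDP : coeff v b (coeff u a P) = y a b := by
      rw [hP]
      simp only [map_sum]
      rw [Finset.sum_congr rfl fun a' ha' => Finset.sum_congr rfl fun b' hb' =>
        coeff_coeff_pent (hnd a' ha' b' hb') (by simp) (by simp) (hy a' ha' b' hb').1
          (hne a ha).1 (hne a ha).2 (hne b hb).2, Finset.sum_eq_single a,
        Finset.sum_eq_single b]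
      · simp
      · intro b' _ hb'
        simp [hb'.symm]
      · grind
      · intro a' _ ha'
        simp [ha'.symm]
      · simp [ha]
    rw [map_sub, map_sub, hDP, ← hw]
    exact hyw a ha b (by grind)
  simpa using M.add_mem hx' hPm.2

/-- In the bottom degree for `3k + 5` vertices, cycles are generated by boundaries and products
with pentagons. -/
theorem cycleOn_le_of_pent {k : ℕ} {S : Finset V} (hS : S.card = 3 * k + 5)
    {M : Submodule ℤ (EdgeAlg V)} (hB : bdryOn (k + 2) S ≤ M)
    (hM : ∀ w ∈ S, ∀ a ∈ S, ∀ b ∈ S, ∀ c ∈ S, ∀ d ∈ S, [w, a, b, c, d].Nodup →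
      ∀ y ∈ cycleOn k (S \ {w, a, b, c, d}), pent w a b c d * y ∈ M) : cycleOn (k + 2) S ≤ M := by
  induction k using Nat.strong_induction_on generalizing S M with
  | _ k ih =>
  have cone : ∀ u ∈ S, ∀ v ∈ S, u ≠ v → ∀ a ∈ S \ {u, v},
      ∀ y ∈ cycleOn (k + 1) (S \ {u, v, a}), triad u a v * y ∈ M := by
    intro u hu v hv huv a ha y hy
    have hua : u ≠ a := by grind
    have hva : v ≠ a := by grind
    have haS : a ∈ S := by grind
    have hcard := card_sdiff_triple hu hv haS huv hua hva
    have hmul : bdryOn (k + 1) (S \ {u, v, a}) ≤ M.comap (LinearMap.mulLeft ℤ (triad u a v)) :=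
      fun z hz => hB (triad_mul_mem_bdryOn hu haS hv hua huv
        (by rw [Finset.pair_comm]) hz)
    -- For positive `k` the suspended cycle has `k + 1` edges on `3k + 2 = 3(k - 1) + 5` vertices,
    -- so it is again generated by pentagons, and these commute with the triad. For `k = 0` only two
    -- vertices are left.
    cases k with
    | zero => exact hmul (cycleOn_one_le_of_card_two (by omega) hy)
    | succ k =>
      refine ih k (by omega) (S := S \ {u, v, a}) (by omega) hmul ?_ hy
      intro w hw a' ha' b hb c hc d hd hnd z hz
      rw [Submodule.mem_comap, LinearMap.mulLeft_apply, triad_mul_pent_mul]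
      simp only [Finset.mem_sdiff, Finset.mem_insert, Finset.mem_singleton, not_or]
        at hw ha' hb hc hd
      have hT : (S \ {u, v, a}) \ {w, a', b, c, d} ⊆ (S \ {w, a', b, c, d}) \ {u, a, v} := by
        intro t ht
        simp only [Finset.mem_sdiff, Finset.mem_insert, Finset.mem_singleton, not_or] at ht ⊢
        tauto
      refine hM w hw.1 a' ha'.1 b hb.1 c hc.1 d hd.1 hnd _
        (triad_mul_mem_cycleOn ?_ ?_ ?_ hua huv hT hz) <;>
      · simp only [Finset.mem_sdiff, Finset.mem_insert, Finset.mem_singleton, not_or]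
        tauto
  intro x hx
  obtain ⟨u, hu, v, hv, huv⟩ := Finset.one_lt_card.1 (show 1 < S.card by omega)
  refine cycle_induction_pent hS.ge hu hv huv hx hB
    (fun a ha b hb c hc => hM a ha u hu v hv b hb c hc) (cone u hu v hv huv)
    (fun b hb y hy => cone v hv u hu huv.symm b (by grind) y ?_)
  rwa [show S \ {v, u, b} = S \ {u, v, b} by grind]

end

/-! ### Nonvanishing in each residue class modulo three. -/

section Nonvanishing

variable {V : Type*} [DecidableEq V]

theorem exists_notMem_signRel_of_card_four {S : Finset V} (hS : S.card = 4) :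
    ∃ z ∈ cycleOn 1 S, z ∉ signRel 1 S := by
  obtain ⟨z, hz, hzJ⟩ := exists_notMem_signRel_one
  let e : Fin 4 ≃ S := (Fintype.equivFinOfCardEq (by simpa using hS)).symm
  let f : Fin 4 → V := fun i => e i
  let g : V → Fin 4 := fun a => if h : a ∈ S then e.symm ⟨a, h⟩ else 0
  have hgf : ∀ i, g (f i) = i := fun i => by simp [f, g]
  have hfg : ∀ a ∈ S, f (g a) = a := fun a ha => by simp [f, g, ha]
  have hgi : Set.InjOn g S := fun a ha b hb h => by rw [← hfg a ha, h, hfg b hb]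
  refine ⟨relabel f z, relabel_mem_cycleOn (fun i _ => (e i).2)
    (Function.LeftInverse.injective hgf).injOn hz, fun h => hzJ ?_⟩
  have hle : signRel 1 S ≤ (signRel 1 Finset.univ).comap (relabel g).toLinearMap := by
    refine sup_le (fun x hx => bdryOn_le_signRel _ _
      (relabel_mem_bdryOn (fun _ _ => by simp) hgi hx)) (Submodule.span_le.2 ?_)
    rintro _ ⟨p, hp, q, hq, hpq, x, hx, rfl⟩
    have hpq' : g p ≠ g q := fun h => hpq (hgi hp hq h)
    have hsw : ∀ a ∈ S, g (Equiv.swap p q a) = Equiv.swap (g p) (g q) (g a) := by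
      intro a ha
      by_cases hap : a = p
      · simp [hap]
      by_cases haq : a = q
      · simp [haq]
      · rw [Equiv.swap_apply_of_ne_of_ne hap haq, Equiv.swap_apply_of_ne_of_ne]
        · exact fun h => hap (hgi ha hp h)
        · exact fun h => haq (hgi ha hq h)
    rw [SetLike.mem_coe, Submodule.mem_comap, AlgHom.toLinearMap_apply, map_add,
      relabel_relabel (Equiv.swap p q) g (fun a => Equiv.swap (g p) (g q) (g a)) hsw hx.1,
      ← relabel_relabel g (Equiv.swap (g p) (g q)) _ (fun a _ => rfl) hx.1]
    exact add_swap_mem_signRel (by simp) (by simp) hpq'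
      (relabel_mem_cycleOn (fun _ _ => by simp) hgi hx)
  have := hle h
  rwa [Submodule.mem_comap, AlgHom.toLinearMap_apply,
    relabel_leftInverse (fun i _ => hgf i) hz.1] at this

theorem exists_notMem_signRel {k : ℕ} {S : Finset V} (hS : S.card = 3 * (k + 1) + 1) :
    ∃ z ∈ cycleOn (k + 1) S, z ∉ signRel (k + 1) S := by
  induction k generalizing S with
  | zero => exact exists_notMem_signRel_of_card_four hS
  | succ k ih =>
    obtain ⟨U, hU, hcard⟩ := Finset.exists_subset_card_eq (show 3 ≤ S.card by omega)
    obtain ⟨u, v, a, huv, hua, hva, rfl⟩ := Finset.card_eq_three.1 hcard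
    have hu : u ∈ S := hU (by simp)
    have hv : v ∈ S := hU (by simp)
    have ha : a ∈ S := hU (by simp)
    obtain ⟨z, hz, hzJ⟩ := ih (S := S \ {u, v, a})
      (by rw [card_sdiff_triple hu hv ha huv hua hva]; omega)
    refine ⟨triad u a v * z, triad_mul_mem_cycleOn hu ha hv hua huv (by grind) hz, ?_⟩
    rw [signRel_eq_bdryOn hS]
    have := triad_mul_notMem_bdryOn (by simp) (by simp) (by simp) huv hua hva hz hzJ
    rwa [show insert u (insert v (insert a (S \ {u, v, a}))) = S by grind] at this

theorem exists_notMem_bdryOn_of_card_one_mod {k : ℕ} (hk : 2 ≤ k) {S : Finset V}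
    (hS : S.card = 3 * k + 1) : ∃ z ∈ cycleOn k S, z ∉ bdryOn k S := by
  obtain ⟨k, rfl⟩ := Nat.exists_eq_add_of_le' hk
  obtain ⟨z, hz, hzJ⟩ := exists_notMem_signRel (k := k + 1) hS
  exact ⟨z, hz, fun h => hzJ (bdryOn_le_signRel _ _ h)⟩

/-- A nonbounding cycle on one more vertex can be moved off that vertex. `Infinite V` only supplies
the vertex to add. -/
theorem exists_notMem_bdryOn_of_card_zero_mod [Infinite V] {k : ℕ} (hk : 2 ≤ k) {S : Finset V}
    (hS : S.card = 3 * k) : ∃ z ∈ cycleOn k S, z ∉ bdryOn k S := by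
  obtain ⟨v, hv⟩ := Infinite.exists_notMem_finset S
  have hcard : (insert v S).card = 3 * k + 1 := by rw [Finset.card_insert_of_notMem hv, hS]
  obtain ⟨z, hz, hzB⟩ := exists_notMem_bdryOn_of_card_one_mod hk hcard
  obtain ⟨y, hy, hzy⟩ := exists_erase_of_card hcard.ge hz (Finset.mem_insert_self v S)
  rw [Finset.erase_insert hv] at hy
  refine ⟨y, hy, fun h => hzB ?_⟩
  simpa using Submodule.add_mem _ hzy (bdryOn_mono (Finset.subset_insert v S) h)

/-- Take `y` on `3k` vertices that does not bound even when `c` is added. The links of `pent a u v b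
c * y` at `ua` and `vb` recover `y` on the complement of `u, v, a, b`, which contains `c`. -/
theorem exists_notMem_bdryOn_of_card_two_mod {k : ℕ} (hk : 2 ≤ k) {S : Finset V}
    (hS : S.card = 3 * k + 5) : ∃ z ∈ cycleOn (k + 2) S, z ∉ bdryOn (k + 2) S := by
  obtain ⟨U, hU, hcard⟩ := Finset.exists_subset_card_eq (show 5 ≤ S.card by omega)
  obtain ⟨l, hl, hlU⟩ : ∃ l : List V, l.Nodup ∧ l.toFinset = U :=
    ⟨U.toList, U.nodup_toList, U.toList_toFinset⟩
  have hlen : l.length = 5 := by rw [← List.toFinset_card_of_nodup hl, hlU, hcard]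
  obtain ⟨a, u, v, b, c, rfl⟩ : ∃ a u v b c, l = [a, u, v, b, c] := by
    match l, hlen with
    | [a, u, v, b, c], _ => exact ⟨a, u, v, b, c, rfl⟩
  rw [← hlU] at hU
  have hmem : ∀ x ∈ [a, u, v, b, c], x ∈ S := fun x hx => hU (by simpa using hx)
  obtain ⟨hau, hav, hab, hac, huv, hub, huc, hvb, hvc, hbc⟩ : a ≠ u ∧ a ≠ v ∧ a ≠ b ∧ a ≠ c ∧
      u ≠ v ∧ u ≠ b ∧ u ≠ c ∧ v ≠ b ∧ v ≠ c ∧ b ≠ c := by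
    simp only [List.nodup_cons, List.mem_cons, not_or, List.not_mem_nil, not_false_eq_true,
      List.nodup_nil, and_true] at hl
    tauto
  have hT : (S \ {u, v, a, b}).card = 3 * k + 1 := by
    rw [Finset.card_sdiff_of_subset, hS, Finset.card_eq_succ.2 ⟨u, {v, a, b}, by
      simp [huv, hau.symm, hub], rfl, Finset.card_eq_three.2 ⟨v, a, b, hav.symm, hvb, hab, rfl⟩⟩]
    · omega
    · intro x hx
      simp only [Finset.mem_insert, Finset.mem_singleton] at hx
      exact hmem x (by simp only [List.mem_cons]; tauto)
  have hc : c ∈ S \ {u, v, a, b} := by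
    simp [hmem c (by simp), hac.symm, huc.symm, hvc.symm, hbc.symm]
  obtain ⟨z, hz, hzB⟩ := exists_notMem_bdryOn_of_card_one_mod hk hT
  obtain ⟨y, hy, hzy⟩ := exists_erase_of_card hT.ge hz hc
  have hyB : y ∉ bdryOn k (S \ {u, v, a, b}) := fun h => hzB (by
    simpa using Submodule.add_mem _ hzy h)
  have hsub : (S \ {u, v, a, b}).erase c ⊆ S \ {a, u, v, b, c} := by
    intro x hx
    simp only [Finset.mem_erase, Finset.mem_sdiff, Finset.mem_insert, Finset.mem_singleton] at hx ⊢
    tauto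
  refine ⟨pent a u v b c * y, pent_mul_mem_cycleOn (hmem _ (by simp)) (hmem _ (by simp))
    (hmem _ (by simp)) (hmem _ (by simp)) (hmem _ (by simp)) hl hsub hy, fun h => hyB ?_⟩
  have h1 := coeff_mem_bdryOn hvb (coeff_mem_bdryOn hau.symm h)
  rw [coeff_coeff_pent hl (by simp) (by simp) hy.1 hau hav hvb.symm,
    if_pos ⟨rfl, rfl⟩] at h1
  refine bdryOn_mono (fun x hx => ?_) h1
  simp only [Finset.mem_sdiff, Finset.mem_insert, Finset.mem_singleton] at hx ⊢
  tauto

end Nonvanishing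

/-! ### Reduction of the exponent to twelve vertices. -/

section Exponent

variable {V : Type*} [DecidableEq V]

theorem three_smul_mem_of_card_one_mod {k : ℕ} (hk : 2 ≤ k) {S : Finset V}
    (hS : S.card = 3 * k + 1) {x : EdgeAlg V} (hx : x ∈ cycleOn k S) :
    (3 : ℤ) • x ∈ bdryOn k S := by
  obtain ⟨k, rfl⟩ := Nat.exists_eq_add_of_le' hk
  obtain ⟨p, hp, q, hq, hpq⟩ := Finset.one_lt_card.1 (show 1 < S.card by omega)
  exact (mem_signCycles.1 (cycleOn_le_signCycles hS hp hq hpq hx)).1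

theorem add_swap_mem_of_card_one_mod {k : ℕ} (hk : 2 ≤ k) {S : Finset V}
    (hS : S.card = 3 * k + 1) {p q : V} (hp : p ∈ S) (hq : q ∈ S) (hpq : p ≠ q) {x : EdgeAlg V}
    (hx : x ∈ cycleOn k S) : x + relabel (Equiv.swap p q) x ∈ bdryOn k S := by
  obtain ⟨k, rfl⟩ := Nat.exists_eq_add_of_le' hk
  exact (mem_signCycles.1 (cycleOn_le_signCycles hS hp hq hpq hx)).2

/-- The cycles of which three times is a boundary. -/
noncomputable def threeTorsion (k : ℕ) (S : Finset V) : Submodule ℤ (EdgeAlg V) :=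
  (bdryOn k S).comap ((3 : ℤ) • LinearMap.id)

theorem mem_threeTorsion {k : ℕ} {S : Finset V} {x : EdgeAlg V} :
    x ∈ threeTorsion k S ↔ (3 : ℤ) • x ∈ bdryOn k S := Iff.rfl

theorem bdryOn_le_threeTorsion (k : ℕ) (S : Finset V) : bdryOn k S ≤ threeTorsion k S :=
  fun _ hx => Submodule.smul_mem _ _ hx

/-- If three kills the homology of a smaller complex, it kills products with a pentagon. -/
theorem cycleOn_le_threeTorsion_of_pent {k : ℕ} {S : Finset V} (hS : S.card = 3 * k + 5)
    (h : ∀ w a b c d, [w, a, b, c, d].Nodup → {w, a, b, c, d} ⊆ S →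
      ∀ y ∈ cycleOn k (S \ {w, a, b, c, d}), pent w a b c d * y ∈ threeTorsion (k + 2) S) :
    cycleOn (k + 2) S ≤ threeTorsion (k + 2) S :=
  cycleOn_le_of_pent hS (bdryOn_le_threeTorsion _ _)
    fun w hw a ha b hb c hc d hd hnd y hy => h w a b c d hnd (by
      intro z hz
      simp only [Finset.mem_insert, Finset.mem_singleton] at hz
      rcases hz with rfl | rfl | rfl | rfl | rfl <;> assumption) y hy

theorem card_sdiff_five {S : Finset V} {w a b c d : V} (hnd : [w, a, b, c, d].Nodup)
    (h : {w, a, b, c, d} ⊆ S) : (S \ {w, a, b, c, d}).card = S.card - 5 := by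
  rw [Finset.card_sdiff_of_subset h]
  congr 1
  have := List.toFinset_card_of_nodup hnd
  simpa using this

theorem pent_mul_mem_threeTorsion {k : ℕ} {S : Finset V} {w a b c d : V}
    (hnd : [w, a, b, c, d].Nodup) (h : {w, a, b, c, d} ⊆ S) {y : EdgeAlg V}
    (hy : y ∈ threeTorsion k (S \ {w, a, b, c, d})) :
    pent w a b c d * y ∈ threeTorsion (k + 2) S := by
  rw [mem_threeTorsion, ← mul_smul_comm]
  exact pent_mul_mem_bdryOn (h (by simp)) (h (by simp)) (h (by simp)) (h (by simp)) (h (by simp))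
    hnd subset_rfl hy

theorem triad_mul_mem_threeTorsion {k : ℕ} {S : Finset V} {u v a : V} (hu : u ∈ S) (hv : v ∈ S)
    (ha : a ∈ S) (huv : u ≠ v) (hua : u ≠ a) {y : EdgeAlg V}
    (hy : y ∈ threeTorsion k (S \ {u, v, a})) : triad u a v * y ∈ threeTorsion (k + 1) S := by
  rw [mem_threeTorsion, ← mul_smul_comm]
  exact triad_mul_mem_bdryOn hu ha hv hua huv (by rw [Finset.pair_comm]) hy

/-- The exponent for `3k` vertices follows from that for twelve. -/
theorem three_smul_mem_of_card_zero_mod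
    (h : ∀ S : Finset V, S.card = 12 → cycleOn 4 S ≤ threeTorsion 4 S) {k : ℕ} {S : Finset V}
    (hS : S.card = 3 * (k + 4)) : cycleOn (k + 4) S ≤ threeTorsion (k + 4) S := by
  induction k generalizing S with
  | zero => exact h S hS
  | succ k ih =>
    obtain ⟨u, hu, v, hv, huv⟩ := Finset.one_lt_card.1 (show 1 < S.card by omega)
    intro x hx
    refine cycle_induction_of_card (by omega) hu hv huv hx (bdryOn_le_threeTorsion _ _)
      (fun a ha y hy => ?_) (fun a ha y hy => ?_)
    · refine triad_mul_mem_threeTorsion hu hv (by grind) huv (by grind) (ih ?_ hy)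
      rw [card_sdiff_triple hu hv (by grind) huv (by grind) (by grind)]
      omega
    · refine triad_mul_mem_threeTorsion hv hu (by grind) huv.symm (by grind) (ih ?_ ?_)
      · rw [card_sdiff_triple hv hu (by grind) huv.symm (by grind) (by grind)]
        omega
      · rwa [show S \ {v, u, a} = S \ {u, v, a} by grind]

/-- Splitting off a pentagon leaves `3 * (k + 4)` vertices, hence at least twelve. Fourteen vertices
would leave nine, which is outside the reach of this reduction. -/
theorem three_smul_mem_of_card_two_mod
    (h : ∀ S : Finset V, S.card = 12 → cycleOn 4 S ≤ threeTorsion 4 S) {k : ℕ} {S : Finset V}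
    (hS : S.card = 3 * (k + 4) + 5) : cycleOn (k + 6) S ≤ threeTorsion (k + 6) S := by
  refine cycleOn_le_threeTorsion_of_pent hS fun w a b c d hnd hsub y hy =>
    pent_mul_mem_threeTorsion hnd hsub (three_smul_mem_of_card_zero_mod h ?_ hy)
  rw [card_sdiff_five hnd hsub]
  omega

end Exponent

/-! ### Sums of translates on the eight points of a cube. -/

section Translations

variable {G : Type*} [AddCommGroup G] [Fintype G]

/-- The sum over all translates. -/
noncomputable def translateSum : EdgeAlg G →ₗ[ℤ] EdgeAlg G :=
  ∑ d : G, (relabel (d + ·)).toLinearMap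

theorem translateSum_apply (x : EdgeAlg G) : translateSum x = ∑ d : G, relabel (d + ·) x := by
  simp [translateSum]

theorem translateSum_edge_mul₃ (x a b c d e f : G) :
    translateSum (edge (x + a) (x + b) * edge (x + c) (x + d) * edge (x + e) (x + f)) =
      translateSum (edge a b * edge c d * edge e f) := by
  simp only [translateSum_apply, map_mul, relabel_edge, ← add_assoc]
  exact Fintype.sum_equiv (Equiv.addRight x) _ _ fun d => rfl

end Translations

/-- The group with eight elements and exponent two. -/
abbrev Cube : Type := ZMod 2 × ZMod 2 × ZMod 2

/-- The elements of the cube, numbered by their binary digits. -/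
def cubePoint : Fin 8 → Cube :=
  ![(0, 0, 0), (1, 0, 0), (0, 1, 0), (1, 1, 0), (0, 0, 1), (1, 0, 1), (0, 1, 1), (1, 1, 1)]

/-- The sum of the translates of a product of three edges. -/
noncomputable def cubeSum (a b c d e f : Fin 8) : EdgeAlg Cube :=
  translateSum (edge (cubePoint a) (cubePoint b) * edge (cubePoint c) (cubePoint d) *
    edge (cubePoint e) (cubePoint f))

section CubeSum

theorem edge_congr {V : Type*} {a b c d : V} (h : s(a, b) = s(c, d)) : edge a b = edge c d := by
  rw [edge, h, edge]

theorem edge_mul_rotate {V : Type*} (a b c d e f : V) :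
    edge a b * edge c d * edge e f = edge c d * edge e f * edge a b := by
  rw [mul_assoc, mul_assoc, edge_mul_left_comm, edge_mul_swap a b, mul_neg, neg_neg]

theorem edge_mul_swap_left {V : Type*} (a b c d e f : V) :
    edge a b * edge c d * edge e f = -(edge c d * edge a b * edge e f) := by
  rw [edge_mul_swap, neg_mul]

variable {a b c d e f a' b' c' d' e' f' : Fin 8} (x : Fin 8)

/-- This and the next five lemmas bring orbit sums to a normal form: a translation by `x` matches
the two triples of edges, up to the order of the factors and the corresponding sign. -/
theorem cubeSum_translate
    (h : s(cubePoint x + cubePoint a, cubePoint x + cubePoint b) = s(cubePoint a', cubePoint b'))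
    (h' : s(cubePoint x + cubePoint c, cubePoint x + cubePoint d) = s(cubePoint c', cubePoint d'))
    (h'' : s(cubePoint x + cubePoint e, cubePoint x + cubePoint f) =
      s(cubePoint e', cubePoint f')) : cubeSum a b c d e f = cubeSum a' b' c' d' e' f' := by
  rw [cubeSum, ← translateSum_edge_mul₃ (cubePoint x), edge_congr h, edge_congr h', edge_congr h'',
    cubeSum]

theorem cubeSum_swap_left
    (h : s(cubePoint x + cubePoint a, cubePoint x + cubePoint b) = s(cubePoint c', cubePoint d'))
    (h' : s(cubePoint x + cubePoint c, cubePoint x + cubePoint d) = s(cubePoint a', cubePoint b'))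
    (h'' : s(cubePoint x + cubePoint e, cubePoint x + cubePoint f) =
      s(cubePoint e', cubePoint f')) : cubeSum a b c d e f = -cubeSum a' b' c' d' e' f' := by
  rw [cubeSum_translate x h h' h'', cubeSum, edge_mul_swap_left, map_neg, cubeSum]

theorem cubeSum_rotate
    (h : s(cubePoint x + cubePoint a, cubePoint x + cubePoint b) = s(cubePoint e', cubePoint f'))
    (h' : s(cubePoint x + cubePoint c, cubePoint x + cubePoint d) = s(cubePoint a', cubePoint b'))
    (h'' : s(cubePoint x + cubePoint e, cubePoint x + cubePoint f) =
      s(cubePoint c', cubePoint d')) : cubeSum a b c d e f = cubeSum a' b' c' d' e' f' := by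
  rw [cubeSum_translate x h h' h'', cubeSum, edge_mul_rotate, cubeSum]

theorem cubeSum_rotate_symm
    (h : s(cubePoint x + cubePoint a, cubePoint x + cubePoint b) = s(cubePoint c', cubePoint d'))
    (h' : s(cubePoint x + cubePoint c, cubePoint x + cubePoint d) = s(cubePoint e', cubePoint f'))
    (h'' : s(cubePoint x + cubePoint e, cubePoint x + cubePoint f) =
      s(cubePoint a', cubePoint b')) : cubeSum a b c d e f = cubeSum a' b' c' d' e' f' := by
  rw [cubeSum_translate x h h' h'', cubeSum, ← edge_mul_rotate, cubeSum]

theorem cubeSum_swap_right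
    (h : s(cubePoint x + cubePoint a, cubePoint x + cubePoint b) = s(cubePoint a', cubePoint b'))
    (h' : s(cubePoint x + cubePoint c, cubePoint x + cubePoint d) = s(cubePoint e', cubePoint f'))
    (h'' : s(cubePoint x + cubePoint e, cubePoint x + cubePoint f) =
      s(cubePoint c', cubePoint d')) : cubeSum a b c d e f = -cubeSum a' b' c' d' e' f' := by
  rw [cubeSum_translate x h h' h'', cubeSum, edge_mul_rotate, edge_mul_swap_left,
    edge_mul_rotate, edge_mul_rotate, map_neg, cubeSum]

theorem cubeSum_swap_outer
    (h : s(cubePoint x + cubePoint a, cubePoint x + cubePoint b) = s(cubePoint e', cubePoint f'))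
    (h' : s(cubePoint x + cubePoint c, cubePoint x + cubePoint d) = s(cubePoint c', cubePoint d'))
    (h'' : s(cubePoint x + cubePoint e, cubePoint x + cubePoint f) =
      s(cubePoint a', cubePoint b')) : cubeSum a b c d e f = -cubeSum a' b' c' d' e' f' := by
  rw [cubeSum_translate x h h' h'', cubeSum, edge_mul_rotate, edge_mul_swap_left, map_neg, cubeSum]

end CubeSum

/-- A pentagon on the cube. -/
noncomputable abbrev cubePent (w a b c d : Fin 8) : EdgeAlg Cube :=
  pent (cubePoint w) (cubePoint a) (cubePoint b) (cubePoint c) (cubePoint d)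

/-- A triad on the cube. -/
noncomputable abbrev cubeTriad (p q r : Fin 8) : EdgeAlg Cube :=
  triad (cubePoint p) (cubePoint q) (cubePoint r)

theorem translateSum_cubePent_mul_cubeTriad (w a b c d p q r : Fin 8) :
    translateSum (cubePent w a b c d * cubeTriad p q r) =
      cubeSum w a b c p q - cubeSum w a b c p r + (cubeSum b c d w p q - cubeSum b c d w p r) +
      (cubeSum d w a b p q - cubeSum d w a b p r) + (cubeSum a b c d p q - cubeSum a b c d p r) +
      (cubeSum c d w a p q - cubeSum c d w a p r) := by
  simp only [cubeSum, pent, triad, add_mul, mul_sub, map_add, map_sub]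
  abel

/-- A finite check: all products are rewritten in terms of a few orbit sums, which cancel apart from
the one on the right and multiples of sums equal to their own negatives. -/
theorem translateSum_cubePent_add :
    translateSum (cubePent 0 2 6 7 3 * cubeTriad 1 4 5) +
      translateSum (cubePent 0 1 5 6 4 * (cubeTriad 2 3 7 - cubeTriad 3 7 2)) =
    (2 : ℤ) • cubeSum 0 4 1 5 2 6 := by
  have h1 : cubeSum 0 2 6 7 1 4 = cubeSum 0 1 2 7 4 6 :=
    cubeSum_rotate 6 (by decide) (by decide) (by decide)
  have h2 : cubeSum 0 2 6 7 1 5 = cubeSum 0 1 2 6 5 7 :=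
    cubeSum_rotate 7 (by decide) (by decide) (by decide)
  have h3 : cubeSum 6 7 3 0 1 4 = -cubeSum 0 1 2 7 5 6 :=
    cubeSum_swap_right 6 (by decide) (by decide) (by decide)
  have h4 : cubeSum 6 7 3 0 1 5 = -cubeSum 0 1 2 6 4 7 :=
    cubeSum_swap_right 7 (by decide) (by decide) (by decide)
  have h5 : cubeSum 3 0 2 6 1 4 = -cubeSum 0 3 1 4 2 6 :=
    cubeSum_swap_right 0 (by decide) (by decide) (by decide)
  have h6 : cubeSum 3 0 2 6 1 5 = -cubeSum 0 3 1 5 2 6 :=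
    cubeSum_swap_right 0 (by decide) (by decide) (by decide)
  have h7 : cubeSum 2 6 7 3 1 4 = -cubeSum 0 4 1 5 2 7 :=
    cubeSum_swap_left 3 (by decide) (by decide) (by decide)
  have h8 : cubeSum 2 6 7 3 1 5 = -cubeSum 0 4 1 5 2 6 :=
    cubeSum_swap_left 3 (by decide) (by decide) (by decide)
  have h9 : cubeSum 7 3 0 2 1 4 = cubeSum 0 2 1 4 3 7 :=
    cubeSum_rotate 0 (by decide) (by decide) (by decide)
  have h10 : cubeSum 7 3 0 2 1 5 = cubeSum 0 2 1 5 3 7 :=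
    cubeSum_rotate 0 (by decide) (by decide) (by decide)
  have h11 : cubeSum 0 1 5 6 2 3 = -cubeSum 0 1 2 3 4 7 :=
    cubeSum_swap_right 1 (by decide) (by decide) (by decide)
  have h12 : cubeSum 0 1 5 6 2 7 = -cubeSum 0 1 2 7 5 6 :=
    cubeSum_swap_right 0 (by decide) (by decide) (by decide)
  have h13 : cubeSum 5 6 4 0 2 3 = -cubeSum 0 1 2 6 4 7 :=
    cubeSum_swap_outer 2 (by decide) (by decide) (by decide)
  have h14 : cubeSum 5 6 4 0 2 7 = -cubeSum 0 3 1 4 2 6 :=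
    cubeSum_swap_right 6 (by decide) (by decide) (by decide)
  have h15 : cubeSum 4 0 1 5 2 3 = cubeSum 0 1 2 6 3 7 :=
    cubeSum_rotate_symm 2 (by decide) (by decide) (by decide)
  have h16 : cubeSum 4 0 1 5 2 7 = cubeSum 0 4 1 5 2 7 :=
    cubeSum_translate 0 (by decide) (by decide) (by decide)
  have h17 : cubeSum 1 5 6 4 2 3 = cubeSum 0 1 2 6 5 7 :=
    cubeSum_rotate_symm 3 (by decide) (by decide) (by decide)
  have h18 : cubeSum 1 5 6 4 2 7 = cubeSum 0 2 1 4 3 7 :=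
    cubeSum_rotate 6 (by decide) (by decide) (by decide)
  have h19 : cubeSum 6 4 0 1 2 3 = cubeSum 0 1 2 3 4 6 :=
    cubeSum_rotate 0 (by decide) (by decide) (by decide)
  have h20 : cubeSum 6 4 0 1 2 7 = cubeSum 0 1 2 7 4 6 :=
    cubeSum_rotate 0 (by decide) (by decide) (by decide)
  have h21 : cubeSum 0 1 5 6 3 7 = -cubeSum 0 1 2 6 4 7 :=
    cubeSum_swap_right 1 (by decide) (by decide) (by decide)
  have h22 : cubeSum 0 1 5 6 3 2 = -cubeSum 0 1 2 3 4 7 :=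
    cubeSum_swap_right 1 (by decide) (by decide) (by decide)
  have h23 : cubeSum 5 6 4 0 3 7 = cubeSum 0 3 1 5 2 6 :=
    cubeSum_translate 5 (by decide) (by decide) (by decide)
  have h24 : cubeSum 5 6 4 0 3 2 = -cubeSum 0 1 2 6 4 7 :=
    cubeSum_swap_outer 2 (by decide) (by decide) (by decide)
  have h25 : cubeSum 4 0 1 5 3 7 = -cubeSum 0 4 1 5 2 6 :=
    cubeSum_swap_left 1 (by decide) (by decide) (by decide)
  have h26 : cubeSum 4 0 1 5 3 2 = cubeSum 0 1 2 6 3 7 :=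
    cubeSum_rotate_symm 2 (by decide) (by decide) (by decide)
  have h27 : cubeSum 1 5 6 4 3 7 = -cubeSum 0 2 1 5 3 7 :=
    cubeSum_swap_left 4 (by decide) (by decide) (by decide)
  have h28 : cubeSum 1 5 6 4 3 2 = cubeSum 0 1 2 6 5 7 :=
    cubeSum_rotate_symm 3 (by decide) (by decide) (by decide)
  have h29 : cubeSum 6 4 0 1 3 7 = cubeSum 0 1 2 6 5 7 :=
    cubeSum_rotate 1 (by decide) (by decide) (by decide)
  have h30 : cubeSum 6 4 0 1 3 2 = cubeSum 0 1 2 3 4 6 :=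
    cubeSum_rotate 0 (by decide) (by decide) (by decide)
  have h31 : cubeSum 0 4 1 5 2 7 = -cubeSum 0 4 1 5 2 7 :=
    cubeSum_swap_left 5 (by decide) (by decide) (by decide)
  have h32 : cubeSum 0 1 2 3 4 7 = -cubeSum 0 1 2 3 4 7 :=
    cubeSum_swap_left 3 (by decide) (by decide) (by decide)
  have h33 : cubeSum 0 1 2 6 3 7 = -cubeSum 0 1 2 6 3 7 :=
    cubeSum_swap_right 1 (by decide) (by decide) (by decide)
  have h34 : cubeSum 0 1 2 3 4 6 = -cubeSum 0 1 2 3 4 6 :=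
    cubeSum_swap_left 2 (by decide) (by decide) (by decide)
  rw [mul_sub, map_sub]
  simp only [translateSum_cubePent_mul_cubeTriad]
  rw [h1, h2, h3, h4, h5, h6, h7, h8, h9, h10, h11, h12, h13, h14, h15, h16, h17, h18, h19,
    h20, h21, h22, h23, h24, h25, h26, h27, h28, h29, h30]
  linear_combination (norm := module) (-1 : ℤ) • h31 - h32 + h33 + h34

/-- Translations permute the four parallel edges, so all four facets lie in one orbit; they enter
with the same sign. -/
theorem bd_cubeSum :
    translateSum (bd (edge (cubePoint 0) (cubePoint 4) * (edge (cubePoint 1) (cubePoint 5) *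
      (edge (cubePoint 2) (cubePoint 6) * edge (cubePoint 3) (cubePoint 7))))) =
    (-4 : ℤ) • cubeSum 0 4 1 5 2 6 := by
  have h1 : cubeSum 0 4 1 5 3 7 = -cubeSum 0 4 1 5 2 6 :=
    cubeSum_swap_left 1 (by decide) (by decide) (by decide)
  have h2 : cubeSum 0 4 2 6 3 7 = cubeSum 0 4 1 5 2 6 :=
    cubeSum_rotate 2 (by decide) (by decide) (by decide)
  have h3 : cubeSum 1 5 2 6 3 7 = -cubeSum 0 4 1 5 2 6 :=
    cubeSum_swap_outer 3 (by decide) (by decide) (by decide)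
  have h : translateSum (bd (edge (cubePoint 0) (cubePoint 4) *
      (edge (cubePoint 1) (cubePoint 5) * (edge (cubePoint 2) (cubePoint 6) *
      edge (cubePoint 3) (cubePoint 7))))) = cubeSum 1 5 2 6 3 7 - (cubeSum 0 4 2 6 3 7 -
      (cubeSum 0 4 1 5 3 7 - cubeSum 0 4 1 5 2 6)) := by
    rw [bd_edge_mul (by decide), bd_edge_mul (by decide), bd_edge_mul (by decide),
      bd_edge (by decide)]
    simp only [cubeSum, mul_sub, map_sub, mul_one, mul_assoc]
  rw [h, h1, h2, h3]
  module

theorem relabel_comp_apply {U V W : Type*} (f : U → V) (g : V → W) (x : EdgeAlg U) :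
    relabel g (relabel f x) = relabel (g ∘ f) x := by
  suffices h : (relabel g).comp (relabel f) = relabel (g ∘ f) from DFunLike.congr_fun h x
  refine ExteriorAlgebra.hom_ext (Finsupp.lhom_ext' fun s => LinearMap.ext_ring ?_)
  obtain ⟨⟨a, b⟩, hs⟩ := s
  have h : ExteriorAlgebra.ι ℤ (Finsupp.single ⟨s(a, b), hs⟩ 1) = edge a b := by
    rw [edge, edgeVec, dif_pos hs]
  simp only [LinearMap.comp_apply, Finsupp.lsingle_apply, AlgHom.toLinearMap_apply,
    AlgHom.comp_apply]
  change relabel g (relabel f (ExteriorAlgebra.ι ℤ (Finsupp.single ⟨s(a, b), hs⟩ 1))) =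
    relabel (g ∘ f) (ExteriorAlgebra.ι ℤ (Finsupp.single ⟨s(a, b), hs⟩ 1))
  rw [h]
  simp

/-- An affine map normalises the group of translations and so only permutes the summands. -/
theorem translateSum_relabel {G : Type*} [AddCommGroup G] [Fintype G] (ψ : G ≃ G) {φ : G → G}
    (h : ∀ d x, φ (d + x) = ψ d + φ x) (y : EdgeAlg G) :
    translateSum (relabel φ y) = relabel φ (translateSum y) := by
  simp only [translateSum_apply, map_sum, relabel_comp_apply]
  refine (Fintype.sum_equiv ψ _ _ fun d => ?_).symm
  congr 2
  exact funext fun x => h d x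

theorem pent_rotate {V : Type*} (w a b c d : V) : pent a b c d w = pent w a b c d := by
  simp only [pent]
  abel

theorem triad_swap {V : Type*} (p q r : V) : triad p r q = -triad p q r := by
  simp [triad]

section CubeSymm

variable {Q : Submodule ℤ (EdgeAlg Cube)}

theorem translateSum_mem (hQ : ∀ φ : Equiv.Perm Cube, ∀ y ∈ Q, relabel φ y ∈ Q) {y : EdgeAlg Cube}
    (hy : y ∈ Q) : translateSum y ∈ Q := by
  rw [translateSum_apply]
  exact Q.sum_mem fun d _ => hQ (Equiv.addLeft d) y hy

/-- Modulo `Q` the translates of the pentagon product sum to `2 • cubeSum 0 4 1 5 2 6` by the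
identity above, and `bd_cubeSum` puts four times that orbit sum in `Q`. This is the origin of the
factor two. -/
theorem two_smul_translateSum_cubePent_mem (hB : bdryOn 3 Finset.univ ≤ Q)
    (hQ : ∀ φ : Equiv.Perm Cube, ∀ y ∈ Q, relabel φ y ∈ Q)
    (hP : ∀ w a b c d p q r : Cube, [w, a, b, c, d, p, q, r].Nodup →
      pent w a b c d * (triad p q r - triad q r p) ∈ Q) :
    (2 : ℤ) • translateSum (cubePent 0 2 6 7 3 * cubeTriad 1 4 5) ∈ Q := by
  have h0 : edge (cubePoint 0) (cubePoint 4) * (edge (cubePoint 1) (cubePoint 5) *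
      (edge (cubePoint 2) (cubePoint 6) * edge (cubePoint 3) (cubePoint 7))) ∈
      chainOn 4 Finset.univ := by
    refine edge_mul_mem_chainOn (by simp) (by simp) (by decide) (edge_mul_mem_chainOn (by decide)
      (by decide) (by decide) (edge_mul_mem_chainOn (by decide) (by decide) (by decide)
      (edge_mem_chainOn (by decide) (by decide) (by decide))))
  have h1 := translateSum_mem hQ (hB ⟨_, h0, rfl⟩)
  have h2 := translateSum_mem hQ (hP (cubePoint 0) (cubePoint 1) (cubePoint 5) (cubePoint 6)
    (cubePoint 4) (cubePoint 2) (cubePoint 3) (cubePoint 7) (by decide))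
  rw [bd_cubeSum] at h1
  convert Q.sub_mem (Q.neg_mem h1) (Q.smul_mem (2 : ℤ) h2) using 1
  rw [eq_sub_of_add_eq translateSum_cubePent_add]
  module

theorem eq_cubePoint_of_nodup : ∀ p q r : Cube,
    [cubePoint 0, cubePoint 2, cubePoint 6, cubePoint 7, cubePoint 3, p, q, r].Nodup →
    [p, q, r] = [cubePoint 1, cubePoint 4, cubePoint 5] ∨
    [p, q, r] = [cubePoint 1, cubePoint 5, cubePoint 4] ∨
    [p, q, r] = [cubePoint 4, cubePoint 1, cubePoint 5] ∨
    [p, q, r] = [cubePoint 4, cubePoint 5, cubePoint 1] ∨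
    [p, q, r] = [cubePoint 5, cubePoint 1, cubePoint 4] ∨
    [p, q, r] = [cubePoint 5, cubePoint 4, cubePoint 1] := by
  decide

/-- The six orders of the remaining three points are reached by cyclic shifts, covered by `hP`, and
by exchanging the last two entries, which changes the sign of a triad. -/
theorem two_smul_translateSum_cubePent_mul_triad_mem (hB : bdryOn 3 Finset.univ ≤ Q)
    (hQ : ∀ φ : Equiv.Perm Cube, ∀ y ∈ Q, relabel φ y ∈ Q)
    (hP : ∀ w a b c d p q r : Cube, [w, a, b, c, d, p, q, r].Nodup →
      pent w a b c d * (triad p q r - triad q r p) ∈ Q) {p q r : Cube}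
    (h : [cubePoint 0, cubePoint 2, cubePoint 6, cubePoint 7, cubePoint 3, p, q, r].Nodup) :
    (2 : ℤ) • translateSum (cubePent 0 2 6 7 3 * triad p q r) ∈ Q := by
  have rot : ∀ p q r : Cube,
      [cubePoint 0, cubePoint 2, cubePoint 6, cubePoint 7, cubePoint 3, p, q, r].Nodup →
      (2 : ℤ) • translateSum (cubePent 0 2 6 7 3 * triad p q r) ∈ Q →
      (2 : ℤ) • translateSum (cubePent 0 2 6 7 3 * triad q r p) ∈ Q := by
    intro p q r h hm
    convert Q.sub_mem hm (Q.smul_mem (2 : ℤ) (translateSum_mem hQ (hP _ _ _ _ _ _ _ _ h))) using 1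
    rw [mul_sub, map_sub]
    module
  have swap : ∀ p q r : Cube, (2 : ℤ) • translateSum (cubePent 0 2 6 7 3 * triad p q r) ∈ Q →
      (2 : ℤ) • translateSum (cubePent 0 2 6 7 3 * triad p r q) ∈ Q := by
    intro p q r hm
    rw [triad_swap, mul_neg, map_neg, smul_neg]
    exact Q.neg_mem hm
  have h1 := two_smul_translateSum_cubePent_mem hB hQ hP
  have h2 := rot _ _ _ (by decide) h1
  have h3 := rot _ _ _ (by decide) h2
  have hc := eq_cubePoint_of_nodup p q r h
  simp only [List.cons.injEq, and_true] at hc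
  rcases hc with ⟨rfl, rfl, rfl⟩ | ⟨rfl, rfl, rfl⟩ | ⟨rfl, rfl, rfl⟩ | ⟨rfl, rfl, rfl⟩ |
    ⟨rfl, rfl, rfl⟩ | ⟨rfl, rfl, rfl⟩
  · exact h1
  · exact swap _ _ _ h1
  · exact swap _ _ _ h2
  · exact h2
  · exact h3
  · exact swap _ _ _ h3

theorem exists_affine_frame {w a b c d : Cube} (hnd : [w, a, b, c, d].Nodup)
    (hsum : a + b + c + d = 0) : ∃ ψ : Cube ≃+ Cube, w + ψ (cubePoint 0) = w ∧
      w + ψ (cubePoint 2) = a ∧ w + ψ (cubePoint 6) = b ∧ w + ψ (cubePoint 7) = c ∧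
      w + ψ (cubePoint 3) = d := by
  have two : (2 : Cube) = 0 := by decide
  -- The points `2, 6, 7, 3` form an affine plane that misses `0`, and the images of the basis
  -- vectors are forced: `2 = e₂`, `6 = e₂ + e₃` and `7 = e₁ + e₂ + e₃`. The condition `hsum` then
  -- places the image of `3`.
  let f : Cube →ₗ[ZMod 2] Cube :=
    (LinearMap.fst (ZMod 2) _ _).smulRight (b + c) +
      ((LinearMap.fst (ZMod 2) _ _ ∘ₗ LinearMap.snd (ZMod 2) _ _).smulRight (a + w) +
      (LinearMap.snd (ZMod 2) _ _ ∘ₗ LinearMap.snd (ZMod 2) _ _).smulRight (a + b))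
  have hf : ∀ x y z : ZMod 2, f (x, y, z) = x • (b + c) + (y • (a + w) + z • (a + b)) :=
    fun _ _ _ => rfl
  have hz : ∀ x : ZMod 2, x = 0 ∨ x = 1 := by decide
  simp only [List.nodup_cons, List.mem_cons, not_or, List.not_mem_nil, not_false_eq_true,
    List.nodup_nil, and_true] at hnd
  obtain ⟨⟨hwa, hwb, hwc, hwd⟩, ⟨hab, hac, had⟩, ⟨hbc, hbd⟩, hcd⟩ := hnd
  have hinj : Function.Injective f := by
    rw [injective_iff_map_eq_zero]
    rintro ⟨x, y, z⟩ h
    rw [hf] at h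
    rcases hz x with rfl | rfl <;> rcases hz y with rfl | rfl <;> rcases hz z with rfl | rfl <;>
      simp only [one_smul, zero_smul, zero_add, add_zero] at h
    · rfl
    · exact absurd (by linear_combination h - b * two) hab
    · exact absurd (by linear_combination h - a * two) hwa
    · exact absurd (by linear_combination h - (a + b) * two) hwb
    · exact absurd (by linear_combination h - c * two) hbc
    · exact absurd (by linear_combination h - (b + c) * two) hac
    · exact absurd (by linear_combination h - hsum) hwd
    · exact absurd (by linear_combination h - (a + b + c) * two) hwc
  refine ⟨AddEquiv.ofBijective f.toAddMonoidHom
    (Finite.injective_iff_bijective.1 hinj), ?_, ?_, ?_, ?_, ?_⟩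
  · exact (congrArg (w + ·) (hf 0 0 0)).trans (by simp)
  · refine (congrArg (w + ·) (hf 0 1 0)).trans ?_
    simp only [one_smul, zero_smul, zero_add, add_zero]
    linear_combination w * two
  · refine (congrArg (w + ·) (hf 0 1 1)).trans ?_
    simp only [one_smul, zero_smul, zero_add]
    linear_combination (w + a) * two
  · refine (congrArg (w + ·) (hf 1 1 1)).trans ?_
    simp only [one_smul]
    linear_combination (w + a + b) * two
  · refine (congrArg (w + ·) (hf 1 1 0)).trans ?_
    simp only [one_smul, zero_smul, add_zero]
    linear_combination hsum + (w - d) * two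

theorem mem_of_nodup_cube {l : List Cube} (hl : l.Nodup) (h8 : l.length = 8) :
    (∀ x, x ∈ l) ∧ l.sum = 0 := by
  have h : l.toFinset = Finset.univ := Finset.eq_univ_of_card _ (by
    rw [List.toFinset_card_of_nodup hl, h8]; rfl)
  refine ⟨fun x => by rw [← List.mem_toFinset, h]; exact Finset.mem_univ x, ?_⟩
  have h2 := List.sum_toFinset (fun x : Cube => x) hl
  rw [h, List.map_id'] at h2
  rw [← h2]
  decide

/-- All eight points sum to zero, so the pentagon's vertices sum to `p + q + r`, which differs from
`p`, `q` and `r` and hence is a pentagon vertex. The other four vertices sum to zero; after a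
rotation an affine map carries the model pentagon to this one. -/
theorem two_smul_translateSum_pent_mul_triad_mem (hB : bdryOn 3 Finset.univ ≤ Q)
    (hQ : ∀ φ : Equiv.Perm Cube, ∀ y ∈ Q, relabel φ y ∈ Q)
    (hP : ∀ w a b c d p q r : Cube, [w, a, b, c, d, p, q, r].Nodup →
      pent w a b c d * (triad p q r - triad q r p) ∈ Q) {w a b c d p q r : Cube}
    (h : [w, a, b, c, d, p, q, r].Nodup) :
    (2 : ℤ) • translateSum (pent w a b c d * triad p q r) ∈ Q := by
  have plane : ∀ w a b c d : Cube, [w, a, b, c, d, p, q, r].Nodup → a + b + c + d = 0 →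
      (2 : ℤ) • translateSum (pent w a b c d * triad p q r) ∈ Q := by
    intro w a b c d h hsum
    obtain ⟨ψ, hw, ha, hb, hc, hd⟩ := exists_affine_frame
      (h.sublist (by simp : List.Sublist [w, a, b, c, d] [w, a, b, c, d, p, q, r])) hsum
    let φ : Equiv.Perm Cube := ψ.toEquiv.trans (Equiv.addLeft w)
    have hφ : ∀ x, φ x = w + ψ x := fun _ => rfl
    simp only [← hφ] at hw ha hb hc hd
    obtain ⟨p', hp'⟩ := φ.surjective p
    obtain ⟨q', hq'⟩ := φ.surjective q
    obtain ⟨r', hr'⟩ := φ.surjective r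
    have hmap : pent w a b c d * triad p q r =
        relabel φ (cubePent 0 2 6 7 3 * triad p' q' r') := by
      rw [map_mul, relabel_pent, relabel_triad, hw, ha, hb, hc, hd, hp', hq', hr']
    have hnd : [cubePoint 0, cubePoint 2, cubePoint 6, cubePoint 7, cubePoint 3, p', q',
        r'].Nodup := by
      refine List.Nodup.of_map φ ?_
      simpa only [List.map_cons, List.map_nil, hw, ha, hb, hc, hd, hp', hq', hr'] using h
    rw [hmap, translateSum_relabel ψ.toEquiv (fun d x => ?_), ← map_smul]
    · exact hQ φ _ (two_smul_translateSum_cubePent_mul_triad_mem hB hQ hP hnd)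
    · change w + ψ (d + x) = ψ d + (w + ψ x)
      rw [map_add, add_left_comm]
  have rot : ∀ w a b c d : Cube, [w, a, b, c, d, p, q, r].Nodup →
      [a, b, c, d, w, p, q, r].Nodup := fun w a b c d h =>
    (List.perm_middle (l₁ := [a, b, c, d]) (l₂ := [p, q, r]) (a := w)).nodup_iff.2 h
  have two : (2 : Cube) = 0 := by decide
  obtain ⟨hmem, hsum⟩ := mem_of_nodup_cube h rfl
  simp only [List.sum_cons, List.sum_nil] at hsum
  have hs := hmem (w + a + b + c + d)
  have hne : q ≠ r ∧ p ≠ r ∧ p ≠ q := by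
    simp only [List.nodup_cons, List.mem_cons, not_or] at h
    tauto
  simp only [List.mem_cons, List.not_mem_nil, or_false] at hs
  have h1 := rot _ _ _ _ _ h
  have h2 := rot _ _ _ _ _ h1
  have h3 := rot _ _ _ _ _ h2
  have h4 := rot _ _ _ _ _ h3
  rcases hs with hs | hs | hs | hs | hs | hs | hs | hs
  · exact plane _ _ _ _ _ h (by linear_combination hs)
  · rw [← pent_rotate]
    exact plane _ _ _ _ _ h1 (by linear_combination hs)
  · rw [← pent_rotate, ← pent_rotate]
    exact plane _ _ _ _ _ h2 (by linear_combination hs)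
  · rw [← pent_rotate, ← pent_rotate, ← pent_rotate]
    exact plane _ _ _ _ _ h3 (by linear_combination hs)
  · rw [← pent_rotate, ← pent_rotate, ← pent_rotate, ← pent_rotate]
    exact plane _ _ _ _ _ h4 (by linear_combination hs)
  · exact absurd (by linear_combination hsum - hs - (p + r) * two) hne.1
  · exact absurd (by linear_combination hsum - hs - (q + r) * two) hne.2.1
  · exact absurd (by linear_combination hsum - hs - (q + r) * two) hne.2.2

/-- As `8 = 3 + 5`, cycles come from pentagons times one-edge cycles on the remaining three points,
and the latter come from triads. -/
theorem two_smul_translateSum_mem (hB : bdryOn 3 Finset.univ ≤ Q)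
    (hQ : ∀ φ : Equiv.Perm Cube, ∀ y ∈ Q, relabel φ y ∈ Q)
    (hP : ∀ w a b c d p q r : Cube, [w, a, b, c, d, p, q, r].Nodup →
      pent w a b c d * (triad p q r - triad q r p) ∈ Q) {y : EdgeAlg Cube}
    (hy : y ∈ cycleOn 3 Finset.univ) : (2 : ℤ) • translateSum y ∈ Q := by
  obtain ⟨M, hM⟩ : ∃ M : Submodule ℤ (EdgeAlg Cube), ∀ z, z ∈ M ↔ (2 : ℤ) • translateSum z ∈ Q :=
    ⟨Q.comap ((2 : ℤ) • translateSum), fun z => Iff.rfl⟩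
  have hBM : bdryOn 3 Finset.univ ≤ M := fun z hz =>
    (hM z).2 (Q.smul_mem _ (translateSum_mem hQ (hB hz)))
  rw [← hM]
  refine cycleOn_le_of_pent (k := 1) (by decide) hBM ?_ hy
  intro w _ a _ b _ c _ d _ hnd y hy
  have hcard := card_sdiff_five hnd (Finset.subset_univ _)
  obtain ⟨p, q, r, hpq, hpr, hqr, hR⟩ := Finset.card_eq_three.1
    (show (Finset.univ \ {w, a, b, c, d} : Finset Cube).card = 3 by rw [hcard]; decide)
  have hmem : ∀ x ∈ [p, q, r], x ∉ [w, a, b, c, d] := by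
    intro x hx hx'
    have : x ∈ Finset.univ \ {w, a, b, c, d} := by rw [hR]; simpa using hx
    simp only [Finset.mem_sdiff, Finset.mem_univ, true_and] at this
    exact this (by simpa using hx')
  have hdisj : List.Disjoint [w, a, b, c, d] [p, q, r] := fun x hx hx' => hmem x hx' hx
  have hnd8 : ∀ p' q' r' : Cube, [p', q', r'].Perm [p, q, r] →
      [w, a, b, c, d, p', q', r'].Nodup := fun p' q' r' hp =>
    List.Nodup.append hnd (hp.nodup_iff.2 (by simp [hpq, hpr, hqr]))
      fun x hx hx' => hdisj hx (hp.subset hx')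
  have htriad : ∀ p' q' r' : Cube, [p', q', r'].Perm [p, q, r] → ∀ T,
      ∀ z ∈ cycleOn 0 T, triad p' q' r' * z ∈ M.comap (LinearMap.mulLeft ℤ (pent w a b c d)) := by
    intro p' q' r' hp T z hz
    refine chainOn_zero_le (M := (M.comap (LinearMap.mulLeft ℤ (pent w a b c d))).comap
      (LinearMap.mulLeft ℤ (triad p' q' r'))) ?_ hz.1
    rw [Submodule.mem_comap, Submodule.mem_comap, LinearMap.mulLeft_apply, LinearMap.mulLeft_apply,
      mul_one, hM]
    exact two_smul_translateSum_pent_mul_triad_mem hB hQ hP (hnd8 _ _ _ hp)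
  have hr : ∀ x ∈ (Finset.univ \ {w, a, b, c, d}) \ {p, q}, x = r := by
    intro x hx
    rw [hR] at hx
    simp only [Finset.mem_sdiff, Finset.mem_insert, Finset.mem_singleton] at hx
    tauto
  refine cycle_induction_of_card (k := 0) (u := p) (v := q) (S := Finset.univ \ {w, a, b, c, d})
    (M := M.comap (LinearMap.mulLeft ℤ (pent w a b c d))) (by rw [hcard]; decide)
    (by rw [hR]; simp) (by rw [hR]; simp) hpq hy (fun z hz => hBM ?_) (fun x hx => ?_)
    (fun x hx => ?_)
  · exact pent_mul_mem_bdryOn (by simp) (by simp) (by simp) (by simp) (by simp) hnd subset_rfl hz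
  · rw [hr x hx]
    exact htriad _ _ _ (List.Perm.cons _ (List.Perm.swap _ _ _)) _
  · rw [hr x hx]
    exact htriad _ _ _ (List.perm_middle (l₁ := [q, r]) (l₂ := [])) _

end CubeSymm

/-! ### Twelve vertices compared with thirteen. -/

section Generic

variable {V : Type*} [DecidableEq V]

theorem sub_sign_smul_relabel_mem [Fintype V] {k : ℕ} (hk : 2 ≤ k)
    (hV : (Finset.univ : Finset V).card = 3 * k + 1) (σ : Equiv.Perm V) {x : EdgeAlg V}
    (hx : x ∈ cycleOn k Finset.univ) :
    x - (Equiv.Perm.sign σ : ℤ) • relabel σ x ∈ bdryOn k Finset.univ := by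
  induction σ using Equiv.Perm.swap_induction_on with
  | one =>
    rw [relabel_eq_self (f := (1 : Equiv.Perm V)) (fun _ _ => rfl) hx.1]
    simp
  | swap_mul σ p q hpq ih =>
    have h := add_swap_mem_of_card_one_mod hk hV (Finset.mem_univ p) (Finset.mem_univ q) hpq
      (relabel_mem_cycleOn (f := σ) (fun _ _ => by simp) σ.injective.injOn hx)
    rw [relabel_comp_apply] at h
    convert Submodule.add_mem _ ih (Submodule.smul_mem _ (Equiv.Perm.sign σ : ℤ) h) using 1
    rw [Equiv.Perm.sign_mul, Equiv.Perm.sign_swap hpq, Equiv.Perm.coe_mul]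
    push_cast
    module

/-- As `11 = 3 * 2 + 5`, these cycles are, up to boundaries, pentagons times cycles on six vertices.
Restoring `w` makes seven vertices beside the pentagon, where `3` kills the homology. -/
theorem cycleOn_erase_le_threeTorsion {S : Finset V} (hS : S.card = 12) {w : V} (hw : w ∈ S) :
    cycleOn 4 (S.erase w) ≤ threeTorsion 4 S := by
  refine cycleOn_le_of_pent (k := 2) (by rw [Finset.card_erase_of_mem hw, hS])
    ((bdryOn_mono (Finset.erase_subset w S)).trans (bdryOn_le_threeTorsion 4 S)) ?_
  intro x hx a ha b hb c hc d hd hnd y hy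
  have hsub : {x, a, b, c, d} ⊆ S := by
    intro z hz
    simp only [Finset.mem_insert, Finset.mem_singleton] at hz
    rcases hz with rfl | rfl | rfl | rfl | rfl <;> exact Finset.mem_of_mem_erase ‹_›
  refine pent_mul_mem_threeTorsion hnd hsub (three_smul_mem_of_card_one_mod le_rfl ?_ ?_)
  · rw [card_sdiff_five hnd hsub, hS]
  · exact cycleOn_mono (Finset.sdiff_subset_sdiff (Finset.erase_subset w S) le_rfl) hy

theorem three_smul_mem_of_mem_bdryOn_insert {S : Finset V} (hS : S.card = 12) {v : V} (hv : v ∉ S)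
    {x : EdgeAlg V} (hx : x ∈ bdryOn 4 (insert v S)) (hxS : x ∈ chainOn 4 S) :
    (3 : ℤ) • x ∈ bdryOn 4 S :=
  mem_threeTorsion.1 (mem_of_mem_bdryOn_insert hv hx hxS (bdryOn_le_threeTorsion 4 S)
    fun _ hw => cycleOn_erase_le_threeTorsion hS hw)

/-- One factor three makes `x` bound on thirteen vertices, another brings the bounding chain back to
twelve. -/
theorem nine_smul_mem_bdryOn {S : Finset V} (hS : S.card = 12) {v : V} (hv : v ∉ S)
    {x : EdgeAlg V} (hx : x ∈ cycleOn 4 S) : (9 : ℤ) • x ∈ bdryOn 4 S := by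
  have h := three_smul_mem_of_mem_bdryOn_insert hS hv (three_smul_mem_of_card_one_mod
    (by norm_num) (by rw [Finset.card_insert_of_notMem hv, hS])
    (cycleOn_mono (Finset.subset_insert v S) hx)) (Submodule.smul_mem _ _ hx.1)
  rwa [smul_smul] at h

end Generic

/-- Thirteen vertices, on eight of which the translations of the cube act. -/
abbrev CubePlus : Type := Cube ⊕ Fin 5

/-- A permutation of the cube, acting on the thirteen vertices. -/
abbrev extendPerm (φ : Equiv.Perm Cube) : Equiv.Perm CubePlus :=
  Equiv.sumCongr φ (Equiv.refl _)

/-- All vertices but one. -/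
abbrev twelve : Finset CubePlus := Finset.univ.erase (Sum.inr 4)

/-- The triad on three of the five additional vertices. -/
noncomputable abbrev outerTriad : EdgeAlg CubePlus :=
  triad (Sum.inr 0) (Sum.inr 1) (Sum.inr 2)

theorem sign_addLeft_cube : ∀ d : Cube, Equiv.Perm.sign (Equiv.addLeft d) = 1 := by
  decide

theorem relabel_extendPerm_outerTriad_mul (φ : Equiv.Perm Cube) (y : EdgeAlg CubePlus) :
    relabel (extendPerm φ) (outerTriad * y) = outerTriad * relabel (extendPerm φ) y := by
  simp

theorem relabel_extendPerm_mem {φ : Equiv.Perm Cube} {k : ℕ} {x : EdgeAlg CubePlus}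
    (hx : x ∈ bdryOn k twelve) : relabel (extendPerm φ) x ∈ bdryOn k twelve := by
  refine relabel_mem_bdryOn ?_ (extendPerm φ).injective.injOn hx
  rintro (x | x) hx
  · simp
  · simpa using hx

theorem relabel_extendPerm_mem_cycleOn {φ : Equiv.Perm Cube} {k : ℕ} {x : EdgeAlg CubePlus}
    (hx : x ∈ cycleOn k twelve) : relabel (extendPerm φ) x ∈ cycleOn k twelve := by
  refine relabel_mem_cycleOn ?_ (extendPerm φ).injective.injOn hx
  rintro (x | x) hx
  · simp
  · simpa using hx

theorem card_twelve : twelve.card = 12 := by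
  rw [Finset.card_erase_of_mem (Finset.mem_univ _)]; rfl

theorem insert_twelve : insert (Sum.inr 4) twelve = Finset.univ :=
  Finset.insert_erase (Finset.mem_univ _)

/-- Translations are even, so the difference bounds once the thirteenth vertex is added. -/
theorem three_smul_translate_sub_mem (d : Cube) {x : EdgeAlg CubePlus} (hx : x ∈ cycleOn 4 twelve) :
    (3 : ℤ) • (relabel (extendPerm (Equiv.addLeft d)) x - x) ∈ bdryOn 4 twelve := by
  refine three_smul_mem_of_mem_bdryOn_insert card_twelve (Finset.notMem_erase (Sum.inr 4) _) ?_
    (Submodule.sub_mem _ (relabel_extendPerm_mem_cycleOn hx).1 hx.1)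
  rw [insert_twelve]
  have h := sub_sign_smul_relabel_mem (k := 4) (by norm_num) (by decide)
    (extendPerm (Equiv.addLeft d)) (cycleOn_mono (Finset.erase_subset _ _) hx)
  rw [Equiv.Perm.sign_sumCongr, sign_addLeft_cube] at h
  simpa using Submodule.neg_mem _ h

/-- The elements of the cube algebra that become boundaries after multiplication with the outer
triad. -/
noncomputable def cubeBoundaries : Submodule ℤ (EdgeAlg Cube) :=
  (bdryOn 4 twelve).comap
    (LinearMap.mulLeft ℤ outerTriad ∘ₗ (relabel (Sum.inl : Cube → CubePlus)).toLinearMap)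

theorem mem_cubeBoundaries {y : EdgeAlg Cube} :
    y ∈ cubeBoundaries ↔ outerTriad * relabel Sum.inl y ∈ bdryOn 4 twelve := Iff.rfl

theorem bdryOn_le_cubeBoundaries : bdryOn 3 Finset.univ ≤ cubeBoundaries := by
  intro y hy
  refine triad_mul_mem_bdryOn (by decide) (by decide) (by decide) (by decide) (by decide)
    subset_rfl (relabel_mem_bdryOn ?_ Sum.inl_injective.injOn hy)
  intro x _
  simp

theorem relabel_mem_cubeBoundaries (φ : Equiv.Perm Cube) {y : EdgeAlg Cube}
    (hy : y ∈ cubeBoundaries) : relabel φ y ∈ cubeBoundaries := by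
  have h := relabel_extendPerm_mem (φ := φ) (mem_cubeBoundaries.1 hy)
  rwa [relabel_extendPerm_outerTriad_mul, relabel_comp_apply,
    show extendPerm φ ∘ Sum.inl = Sum.inl ∘ φ from rfl, ← relabel_comp_apply] at h

/-- Together with the outer triad and the spare vertex `Sum.inr 3`, the points `p, q, r` make up
seven vertices, where the even rotation of `p, q, r` preserves the product of the two triads. -/
theorem pent_mul_triad_sub_mem_cubeBoundaries {w a b c d p q r : Cube}
    (h : [w, a, b, c, d, p, q, r].Nodup) :
    pent w a b c d * (triad p q r - triad q r p) ∈ cubeBoundaries := by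
  have hpqr : q ≠ r ∧ p ≠ r ∧ p ≠ q := by
    simp only [List.nodup_cons, List.mem_cons, not_or] at h
    tauto
  have hmem : ∀ x ∈ [p, q, r], x ∉ [w, a, b, c, d] := fun x hx hx' =>
    (List.disjoint_of_nodup_append (l₁ := [w, a, b, c, d]) (l₂ := [p, q, r]) h) hx' hx
  have hnd : [w, a, b, c, d].Nodup :=
    h.sublist (by simp : List.Sublist [w, a, b, c, d] [w, a, b, c, d, p, q, r])
  let v : Fin 7 → CubePlus := ![Sum.inl p, Sum.inl q, Sum.inl r, Sum.inr 0, Sum.inr 1, Sum.inr 2,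
    Sum.inr 3]
  have hv : Function.Injective v := by
    rw [← List.nodup_ofFn]
    simp [v, List.ofFn_succ, hpqr]
  have hS : ∀ i, v i ∈ twelve \ {Sum.inl w, Sum.inl a, Sum.inl b, Sum.inl c, Sum.inl d} := by
    have hp := hmem p (by simp)
    have hq := hmem q (by simp)
    have hr := hmem r (by simp)
    simp only [List.mem_cons, List.not_mem_nil, or_false, not_or] at hp hq hr
    intro i
    fin_cases i <;> simp [v, hp, hq, hr]
  have key := biTriad_comp_sub_mem (Equiv.swap 0 1 * Equiv.swap 1 2) hv hS
  rw [Equiv.Perm.sign_mul, Equiv.Perm.sign_swap (by decide), Equiv.Perm.sign_swap (by decide)]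
    at key
  rw [mem_cubeBoundaries, map_mul, relabel_pent, map_sub, relabel_triad, relabel_triad,
    triad_mul_pent_mul]
  have hnd' : [Sum.inl w, Sum.inl a, Sum.inl b, Sum.inl c, Sum.inl d].Nodup (α := CubePlus) :=
    hnd.map Sum.inl_injective
  refine pent_mul_mem_bdryOn (by simp) (by simp) (by simp) (by simp) (by simp) hnd' subset_rfl ?_
  convert key using 1
  have e1 : biTriad v = triad (Sum.inl p) (Sum.inl q) (Sum.inl r) * outerTriad := rfl
  have e2 : biTriad (v ∘ (Equiv.swap 0 1 * Equiv.swap 1 2 : Equiv.Perm (Fin 7))) =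
    triad (Sum.inl q) (Sum.inl r) (Sum.inl p) * outerTriad := rfl
  have e3 : ∀ p q r : CubePlus, outerTriad * triad p q r = -(triad p q r * outerTriad) := by
    intro p q r
    simpa using triad_mul_triad (Sum.inr 0) (Sum.inr 1) (Sum.inr 2) p q r (1 : EdgeAlg CubePlus)
  rw [e1, e2, mul_sub, e3, e3]
  simp
  abel

section

theorem outerTriad_mul_translates_mem {y : EdgeAlg CubePlus}
    (hy : y ∈ cycleOn 3 (Finset.univ.image Sum.inl)) :
    (2 : ℤ) • ∑ d : Cube, relabel (extendPerm (Equiv.addLeft d)) (outerTriad * y) ∈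
      bdryOn 4 twelve := by
  let g : CubePlus → Cube := Sum.elim id fun _ => 0
  have hg : ∀ a ∈ Finset.univ.image (Sum.inl : Cube → CubePlus), Sum.inl (g a) = a := by
    simp [g]
  have hgi : Set.InjOn g (Finset.univ.image (Sum.inl : Cube → CubePlus)) :=
    fun a ha b hb h => by rw [← hg a ha, h, hg b hb]
  have hy0 : relabel Sum.inl (relabel g y) = y := relabel_leftInverse hg hy.1
  have h := two_smul_translateSum_mem bdryOn_le_cubeBoundaries
    (fun φ y hy => relabel_mem_cubeBoundaries φ hy)
    (fun _ _ _ _ _ _ _ _ h => pent_mul_triad_sub_mem_cubeBoundaries h)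
    (relabel_mem_cycleOn (T := Finset.univ) (fun _ _ => by simp) hgi hy)
  rw [mem_cubeBoundaries, map_smul, translateSum_apply, map_sum, mul_smul_comm,
    Finset.mul_sum] at h
  convert h using 3 with d
  rw [relabel_extendPerm_outerTriad_mul]
  conv_lhs => rw [← hy0]
  simp only [relabel_comp_apply]
  rfl

/-- Links at `Sum.inr 3` live on seven vertices, so `3c` can be moved onto the cube, to `y`. With `x
= outerTriad * c`, each translate of `outerTriad * y` is homologous to the same translate of `3x`,
hence to `3x`; twice the sum over the eight translates shows that `48x` bounds. -/
theorem outerTriad_mul_mem_threeTorsion {c : EdgeAlg CubePlus}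
    (hc : c ∈ cycleOn 3 (twelve \ {Sum.inr 0, Sum.inr 1, Sum.inr 2})) :
    outerTriad * c ∈ threeTorsion 4 twelve := by
  have hx : outerTriad * c ∈ cycleOn 4 twelve :=
    triad_mul_mem_cycleOn (by decide) (by decide) (by decide) (by decide) (by decide) subset_rfl hc
  obtain ⟨y, hy, hcy⟩ := exists_cycle_erase (v := Sum.inr 3) (by decide)
    (Submodule.smul_mem _ (3 : ℤ) hc) (fun w hw => by
      have hw3 : w ≠ Sum.inr 3 := Finset.ne_of_mem_erase hw
      rw [map_smul]
      refine three_smul_mem_of_card_one_mod le_rfl ?_ (coeff_mem_cycleOn hw3.symm hc)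
      rw [Finset.card_sdiff_of_subset, Finset.card_pair hw3.symm]
      · decide
      · intro z hz
        simp only [Finset.mem_insert, Finset.mem_singleton] at hz
        rcases hz with rfl | rfl
        · decide
        · exact Finset.mem_of_mem_erase hw)
  rw [show (twelve \ {Sum.inr 0, Sum.inr 1, Sum.inr 2}).erase (Sum.inr 3) =
    Finset.univ.image Sum.inl by decide] at hy
  have hmul : (3 : ℤ) • (outerTriad * c) - outerTriad * y ∈ bdryOn 4 twelve := by
    rw [← mul_smul_comm, ← mul_sub]
    exact triad_mul_mem_bdryOn (by decide) (by decide) (by decide) (by decide) (by decide)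
      subset_rfl hcy
  generalize outerTriad * c = x at hx hmul ⊢
  have h1 := outerTriad_mul_translates_mem hy
  have h2 : ∑ d : Cube, ((2 : ℤ) • relabel (extendPerm (Equiv.addLeft d))
      ((3 : ℤ) • x - outerTriad * y) - (2 : ℤ) • (3 : ℤ) •
        (relabel (extendPerm (Equiv.addLeft d)) x - x)) ∈ bdryOn 4 twelve :=
    Submodule.sum_mem _ fun d _ => Submodule.sub_mem _
      (Submodule.smul_mem _ _ (relabel_extendPerm_mem hmul))
      (Submodule.smul_mem _ _ (three_smul_translate_sub_mem d hx))
  have h3 : ∑ d : Cube, ((2 : ℤ) • relabel (extendPerm (Equiv.addLeft d))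
      ((3 : ℤ) • x - outerTriad * y) - (2 : ℤ) • (3 : ℤ) •
        (relabel (extendPerm (Equiv.addLeft d)) x - x)) = (48 : ℤ) • x -
      (2 : ℤ) • ∑ d : Cube, relabel (extendPerm (Equiv.addLeft d)) (outerTriad * y) := by
    have : ∀ d : Cube, (2 : ℤ) • relabel (extendPerm (Equiv.addLeft d))
      ((3 : ℤ) • x - outerTriad * y) - (2 : ℤ) • (3 : ℤ) •
        (relabel (extendPerm (Equiv.addLeft d)) x - x) = (6 : ℤ) • x - (2 : ℤ) •
        relabel (extendPerm (Equiv.addLeft d)) (outerTriad * y) := by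
      intro d
      rw [map_sub, map_smul]
      module
    rw [Finset.sum_congr rfl fun d _ => this d, Finset.sum_sub_distrib, Finset.sum_const,
      ← Finset.smul_sum, show (Finset.univ : Finset Cube).card = 8 by decide]
    module
  rw [h3] at h2
  have h9 := nine_smul_mem_bdryOn card_twelve (Finset.notMem_erase (Sum.inr 4) _) hx
  rw [mem_threeTorsion]
  -- Here `48 - 5 * 9 = 3`.
  convert Submodule.sub_mem _ (Submodule.add_mem _ h2 h1) (Submodule.smul_mem _ (5 : ℤ) h9) using 1
  module

variable {V : Type*} [DecidableEq V]

theorem triad_mul_mem_threeTorsion_of_card_twelve {S : Finset V} (hS : S.card = 12) {p q r : V}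
    (hp : p ∈ S) (hq : q ∈ S) (hr : r ∈ S) (hpq : p ≠ q) (hpr : p ≠ r) (hqr : q ≠ r)
    {c : EdgeAlg V} (hc : c ∈ cycleOn 3 (S \ {p, q, r})) :
    triad p q r * c ∈ threeTorsion 4 S := by
  have hcard : (S \ {p, q, r}).card =
      (twelve \ {Sum.inr 0, Sum.inr 1, Sum.inr 2}).card := by
    rw [card_sdiff_triple hp hq hr hpq hpr hqr, hS]
    decide
  let e := Finset.equivOfCardEq hcard
  let f : V → CubePlus := fun x => if x = p then Sum.inr 0 else if x = q then Sum.inr 1 else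
    if x = r then Sum.inr 2 else if h : x ∈ S \ {p, q, r} then e ⟨x, h⟩ else Sum.inr 4
  let g : CubePlus → V := fun y => if y = Sum.inr 0 then p else if y = Sum.inr 1 then q else
    if y = Sum.inr 2 then r else
    if h : y ∈ twelve \ {Sum.inr 0, Sum.inr 1, Sum.inr 2} then e.symm ⟨y, h⟩ else p
  have fp : f p = Sum.inr 0 := by simp [f]
  have fq : f q = Sum.inr 1 := by simp [f, hpq.symm]
  have fr : f r = Sum.inr 2 := by simp [f, hpr.symm, hqr.symm]
  have gp : g (Sum.inr 0) = p := by simp [g]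
  have gq : g (Sum.inr 1) = q := by simp [g]
  have gr : g (Sum.inr 2) = r := by simp [g]
  have hf : ∀ x (h : x ∈ S \ {p, q, r}), f x = e ⟨x, h⟩ := by
    intro x h
    have h' := h
    simp only [Finset.mem_sdiff, Finset.mem_insert, Finset.mem_singleton, not_or] at h'
    simp only [f, h', if_false, dif_pos h]
  have hg : ∀ y (h : y ∈ twelve \ {Sum.inr 0, Sum.inr 1, Sum.inr 2}), g y = e.symm ⟨y, h⟩ := by
    intro y h
    have h' := h
    simp only [Finset.mem_sdiff, Finset.mem_insert, Finset.mem_singleton, not_or] at h'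
    simp only [g, h', if_false, dif_pos h]
  have hS' : ∀ x ∈ S, x = p ∨ x = q ∨ x = r ∨ x ∈ S \ {p, q, r} := by
    intro x hx
    simp only [Finset.mem_sdiff, Finset.mem_insert, Finset.mem_singleton]
    tauto
  have hT' : ∀ y ∈ twelve, y = Sum.inr 0 ∨ y = Sum.inr 1 ∨ y = Sum.inr 2 ∨
      y ∈ twelve \ {Sum.inr 0, Sum.inr 1, Sum.inr 2} := by
    intro y hy
    rw [Finset.mem_sdiff, Finset.mem_insert, Finset.mem_insert, Finset.mem_singleton]
    tauto
  have hgf : ∀ x ∈ S, g (f x) = x := by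
    intro x hx
    rcases hS' x hx with rfl | rfl | rfl | h
    · rw [fp, gp]
    · rw [fq, gq]
    · rw [fr, gr]
    · rw [hf x h, hg _ (e ⟨x, h⟩).2]
      simp
  have hfg : ∀ y ∈ twelve, f (g y) = y := by
    intro y hy
    rcases hT' y hy with rfl | rfl | rfl | h
    · rw [gp, fp]
    · rw [gq, fq]
    · rw [gr, fr]
    · rw [hg y h, hf _ (e.symm ⟨y, h⟩).2]
      simp
  have hgS : Set.MapsTo g twelve S := by
    intro y hy
    rcases hT' y hy with rfl | rfl | rfl | h
    · rwa [gp]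
    · rwa [gq]
    · rwa [gr]
    · rw [hg y h]
      exact (Finset.mem_sdiff.1 (e.symm ⟨y, h⟩).2).1
  have hfi : Set.InjOn f S := fun a ha b hb h => by rw [← hgf a ha, h, hgf b hb]
  have hgi : Set.InjOn g twelve := fun a ha b hb h => by rw [← hfg a ha, h, hfg b hb]
  have hfR : Set.MapsTo f (S \ {p, q, r} : Finset V)
      (twelve \ {Sum.inr 0, Sum.inr 1, Sum.inr 2} : Finset CubePlus) := by
    intro x h
    rw [hf x h]
    exact (e ⟨x, h⟩).2
  have h := outerTriad_mul_mem_threeTorsion (relabel_mem_cycleOn hfR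
    (hfi.mono (by simp)) hc)
  have h2 := relabel_mem_bdryOn hgS hgi (mem_threeTorsion.1 h)
  rw [mem_threeTorsion]
  have hc' : relabel g (relabel f c) = c :=
    relabel_leftInverse (fun a ha => hgf a (Finset.mem_sdiff.1 ha).1) hc.1
  rwa [AlgHom.map_smul_of_tower, map_mul, relabel_triad, gp, gq, gr, hc'] at h2

theorem cycleOn_le_threeTorsion_of_card_twelve {S : Finset V} (hS : S.card = 12) :
    cycleOn 4 S ≤ threeTorsion 4 S := by
  obtain ⟨u, hu, v, hv, huv⟩ := Finset.one_lt_card.1 (show 1 < S.card by omega)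
  have hne : ∀ a ∈ S \ {u, v}, a ∈ S ∧ a ≠ u ∧ a ≠ v := fun a ha => by simpa using ha
  intro x hx
  refine cycle_induction_of_card (by omega) hu hv huv hx (bdryOn_le_threeTorsion _ _)
    (fun a ha y hy => ?_) (fun a ha y hy => ?_)
  · obtain ⟨haS, hau, hav⟩ := hne a ha
    refine triad_mul_mem_threeTorsion_of_card_twelve hS hu haS hv hau.symm huv hav ?_
    rwa [Finset.pair_comm a v]
  · obtain ⟨haS, hau, hav⟩ := hne a ha
    refine triad_mul_mem_threeTorsion_of_card_twelve hS hv haS hu hav.symm huv.symm hau ?_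
    rwa [Finset.pair_comm a u, Finset.insert_comm]

end

/-! ### Back to the simplicial homology of the matching complex. -/

section Transfer

variable {V : Type*} [DecidableEq V]

/-- A family of disjoint edges within `S`. -/
def IsMatchingOn {k : ℕ} (v : Fin k → (⊤ : SimpleGraph V).edgeSet) (S : Finset V) : Prop :=
  (∀ i j x, x ∈ (v i : Sym2 V) → x ∈ (v j : Sym2 V) → i = j) ∧
    ∀ i x, x ∈ (v i : Sym2 V) → x ∈ S

theorem orientedSimplex_succ {ι : Type*} {k : ℕ} (v : Fin (k + 1) → ι) :
    orientedSimplex v =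
      ExteriorAlgebra.ι ℤ (Finsupp.single (v 0) 1) * orientedSimplex fun j => v j.succ := by
  simp [orientedSimplex, ExteriorAlgebra.ιMulti_succ_apply, Matrix.vecTail, Function.comp_def]

theorem ι_single_eq_edge {V : Type*} {a b : V} (h : s(a, b) ∈ (⊤ : SimpleGraph V).edgeSet) :
    ExteriorAlgebra.ι ℤ (Finsupp.single ⟨s(a, b), h⟩ 1) = edge a b := by
  rw [edge, edgeVec, dif_pos h]

theorem orientedSimplex_mem_chainOn {k : ℕ} {v : Fin k → (⊤ : SimpleGraph V).edgeSet}
    {S : Finset V} (h : IsMatchingOn v S) : orientedSimplex v ∈ chainOn k S := by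
  induction k generalizing S with
  | zero =>
    have : orientedSimplex v = 1 := by simp [orientedSimplex]
    rw [this]
    exact one_mem_chainOn S
  | succ k ih =>
    rw [orientedSimplex_succ]
    obtain ⟨a, b, hab'⟩ : ∃ a b, (v 0 : Sym2 V) = s(a, b) :=
      Sym2.ind (fun a b => ⟨a, b, rfl⟩) (v 0 : Sym2 V)
    have hs : s(a, b) ∈ (⊤ : SimpleGraph V).edgeSet := hab' ▸ (v 0).2
    rw [show v 0 = ⟨s(a, b), hs⟩ from Subtype.ext hab', ι_single_eq_edge]
    refine edge_mul_mem_chainOn (h.2 0 a (by simp [hab'])) (h.2 0 b (by simp [hab']))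
      (by simpa using hs) (ih ⟨fun i j x hi hj => ?_, fun i x hx => ?_⟩)
    · exact Fin.succ_injective _ (h.1 _ _ x hi hj)
    · have hx0 : x ∉ (v 0 : Sym2 V) := fun h0 => (Fin.succ_ne_zero i) (h.1 _ _ x hx h0)
      rw [hab', Sym2.mem_iff] at hx0
      simp [h.2 _ x hx, hx0]

theorem chainOn_le_span_orientedSimplex (k : ℕ) (S : Finset V) :
    chainOn k S ≤ Submodule.span ℤ {c | ∃ v : Fin k → (⊤ : SimpleGraph V).edgeSet,
      IsMatchingOn v S ∧ c = orientedSimplex v} := by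
  induction k generalizing S with
  | zero =>
    refine chainOn_zero_le (Submodule.subset_span
      ⟨Fin.elim0, ⟨fun i => i.elim0, fun i => i.elim0⟩, ?_⟩)
    simp [orientedSimplex]
  | succ k ih =>
    refine chainOn_succ_le fun a ha b hb hab y hy => ?_
    suffices h : chainOn k (S \ {a, b}) ≤ (Submodule.span ℤ _).comap
      (LinearMap.mulLeft ℤ (edge a b)) from h hy
    refine (ih _).trans (Submodule.span_le.2 ?_)
    rintro _ ⟨v, hv, rfl⟩
    have hs : s(a, b) ∈ (⊤ : SimpleGraph V).edgeSet := by simpa using hab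
    have hnot : ∀ i, ∀ x ∈ (v i : Sym2 V), x ∈ S ∧ x ≠ a ∧ x ≠ b := fun i x hx => by
      simpa using hv.2 i x hx
    refine Submodule.subset_span ⟨Fin.cons ⟨s(a, b), hs⟩ v, ⟨fun i j x => ?_, fun i x => ?_⟩, ?_⟩
    · refine Fin.cases ?_ (fun i => ?_) i <;> refine Fin.cases ?_ (fun j => ?_) j
      · simp
      · intro hi hj
        have := hnot j x (by simpa using hj)
        simp only [Fin.cons_zero, Sym2.mem_iff] at hi
        tauto
      · intro hi hj
        have := hnot i x (by simpa using hi)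
        simp only [Fin.cons_zero, Sym2.mem_iff] at hj
        tauto
      · intro hi hj
        exact congrArg Fin.succ (hv.1 i j x (by simpa using hi) (by simpa using hj))
    · refine Fin.cases ?_ (fun i => ?_) i
      · simp only [Fin.cons_zero, Sym2.mem_iff]
        rintro (rfl | rfl) <;> assumption
      · intro hx
        exact (hnot i x (by simpa using hx)).1
    · rw [orientedSimplex_succ]
      simp [ι_single_eq_edge]

theorem isMatchingOn_univ_iff {V : Type*} [Fintype V] {k : ℕ}
    (v : Fin k → (⊤ : SimpleGraph V).edgeSet) :
    IsMatchingOn v Finset.univ ↔ ∃ w : Fin k ↪ (⊤ : SimpleGraph V).edgeSet, v = w ∧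
      (k = 0 ∨ Finset.univ.map w ∈ matchingComplex (⊤ : SimpleGraph V)) := by
  constructor
  · rintro ⟨h, -⟩
    have hinj : Function.Injective v := by
      intro i j hij
      have ha := Sym2.out_fst_mem (v i : Sym2 V)
      exact h i j _ ha (hij ▸ ha)
    refine ⟨⟨v, hinj⟩, rfl, ?_⟩
    rcases Nat.eq_zero_or_pos k with hk | hk
    · exact Or.inl hk
    · refine Or.inr ⟨⟨_, Finset.mem_map_of_mem _ (Finset.mem_univ (⟨0, hk⟩ : Fin k))⟩, ?_⟩
      intro x e he f hf hxe hxf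
      obtain ⟨i, -, rfl⟩ := Finset.mem_map.1 he
      obtain ⟨j, -, rfl⟩ := Finset.mem_map.1 hf
      exact congrArg v (h i j x hxe hxf)
  · rintro ⟨w, rfl, hw⟩
    refine ⟨fun i j x hi hj => ?_, fun _ _ _ => Finset.mem_univ _⟩
    have hw' := (hw.resolve_left (by rintro rfl; exact i.elim0)).2
    exact w.injective (hw' x _ (Finset.mem_map_of_mem _ (Finset.mem_univ i)) _
      (Finset.mem_map_of_mem _ (Finset.mem_univ j)) hi hj)

theorem chains_eq_chainOn [Fintype V] {d : ℤ} {k : ℕ} (hd : d + 1 = k) :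
    (matchingComplex (⊤ : SimpleGraph V)).chains d = chainOn k Finset.univ := by
  refine le_antisymm (Submodule.span_le.2 ?_) ((chainOn_le_span_orientedSimplex k _).trans
    (Submodule.span_mono ?_))
  · rintro _ ⟨l, v, hl, hv, rfl⟩
    obtain rfl : l = k := by omega
    exact orientedSimplex_mem_chainOn ((isMatchingOn_univ_iff v).2 ⟨v, rfl, hv⟩)
  · rintro _ ⟨v, hv, rfl⟩
    obtain ⟨w, rfl, hw⟩ := (isMatchingOn_univ_iff v).1 hv
    exact ⟨k, w, hd.symm, hw, rfl⟩

theorem cycles_eq_cycleOn [Fintype V] {d : ℤ} {k : ℕ} (hd : d + 1 = k) :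
    (matchingComplex (⊤ : SimpleGraph V)).cycles d = cycleOn k Finset.univ := by
  rw [cycles, chains_eq_chainOn hd, cycleOn]

theorem boundaries_eq_bdryOn [Fintype V] {d : ℤ} {k : ℕ} (hd : d + 1 = k) :
    (matchingComplex (⊤ : SimpleGraph V)).boundaries d = bdryOn k Finset.univ := by
  rw [boundaries, chains_eq_chainOn (k := k + 1) (by push_cast; omega), bdryOn]

theorem chainOn_fg [Finite V] (k : ℕ) (S : Finset V) : (chainOn k S).FG := by
  have h : chainOn k S ≤ Submodule.span ℤ
      (Set.range (orientedSimplex : (Fin k → (⊤ : SimpleGraph V).edgeSet) → EdgeAlg V)) :=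
    (chainOn_le_span_orientedSimplex k S).trans
      (Submodule.span_mono (by rintro _ ⟨v, -, rfl⟩; exact ⟨v, rfl⟩))
  have := isNoetherian_of_fg_of_noetherian _ (Submodule.fg_span (R := ℤ) (Set.finite_range
    (orientedSimplex : (Fin k → (⊤ : SimpleGraph V).edgeSet) → EdgeAlg V)))
  exact Submodule.FG.of_le (Submodule.fg_span (Set.finite_range _)) h

theorem nontrivial_reducedHomology [Fintype V] {d : ℤ} {k : ℕ} (hd : d + 1 = k)
    (h : ∃ z ∈ cycleOn k (Finset.univ : Finset V), z ∉ bdryOn k Finset.univ) :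
    Nontrivial ((matchingComplex (⊤ : SimpleGraph V)).ReducedHomology d) := by
  obtain ⟨z, hz, hzB⟩ := h
  rw [← cycles_eq_cycleOn hd] at hz
  rw [← boundaries_eq_bdryOn hd] at hzB
  exact ⟨Submodule.Quotient.mk ⟨z, hz⟩, 0, fun h0 => hzB ((Submodule.Quotient.mk_eq_zero
    (((matchingComplex (⊤ : SimpleGraph V)).boundaries d).submoduleOf _)).1 h0)⟩

theorem isElementaryAbelianGroup_reducedHomology [Fintype V] {d : ℤ} {k : ℕ} (hd : d + 1 = k)
    (h : cycleOn k (Finset.univ : Finset V) ≤ threeTorsion k Finset.univ) :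
    IsElementaryAbelianGroup 3 ((matchingComplex (⊤ : SimpleGraph V)).ReducedHomology d) := by
  have h3 : ∀ x : (matchingComplex (⊤ : SimpleGraph V)).ReducedHomology d, (3 : ℕ) • x = 0 := by
    intro x
    obtain ⟨⟨z, hz⟩, rfl⟩ := Submodule.Quotient.mk_surjective _ x
    have hz' := hz
    rw [cycles_eq_cycleOn hd] at hz'
    have hB := mem_threeTorsion.1 (h hz')
    rw [← boundaries_eq_bdryOn hd] at hB
    rw [← Submodule.Quotient.mk_smul, Submodule.Quotient.mk_eq_zero]
    change (3 : ℕ) • z ∈ (matchingComplex (⊤ : SimpleGraph V)).boundaries d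
    exact_mod_cast hB
  refine ⟨?_, h3⟩
  have hfg : ((matchingComplex (⊤ : SimpleGraph V)).cycles d).FG := by
    rw [cycles_eq_cycleOn hd]
    exact Submodule.FG.of_le (chainOn_fg k _) inf_le_left
  have : Module.Finite ℤ ((matchingComplex (⊤ : SimpleGraph V)).cycles d) :=
    Module.Finite.iff_fg.2 hfg
  -- A finitely generated abelian group killed by `3` is finite.
  refine Module.finite_of_fg_torsion _ fun {x} => ⟨⟨3, by simp⟩, ?_⟩
  have := h3 x
  exact_mod_cast this

end Transfer

/-- The construction needs room for an extra vertex, so it takes place in `ℕ` and is relabelled to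
`Fin n`. -/
theorem exists_notMem_bdryOn_fin {n k : ℕ} (hk : 2 ≤ k) (hn : n = 3 * k) :
    ∃ z ∈ cycleOn k (Finset.univ : Finset (Fin n)), z ∉ bdryOn k Finset.univ := by
  have : NeZero n := ⟨by omega⟩
  obtain ⟨z, hz, hzB⟩ := exists_notMem_bdryOn_of_card_zero_mod hk
    (S := Finset.range n) (by rw [Finset.card_range, hn])
  have hval : ∀ a ∈ Finset.range n, ((Fin.ofNat n a : Fin n) : ℕ) = a := fun a ha =>
    Nat.mod_eq_of_lt (Finset.mem_range.1 ha)
  refine ⟨relabel (Fin.ofNat n) z, relabel_mem_cycleOn (fun _ _ => by simp)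
    (fun a ha b hb h => ?_) hz, fun h => hzB ?_⟩
  · rw [← hval a ha, h, hval b hb]
  · have := relabel_mem_bdryOn (f := Fin.val) (T := Finset.range n) (fun i _ => by simp)
      Fin.val_injective.injOn h
    rwa [relabel_leftInverse hval hz.1] at this

end MatchingChain

open MatchingChain in
theorem theorem1p4 (n : ℕ) (hn : n = 7 ∨ n = 10 ∨ (12 ≤ n ∧ n ≠ 14)) :
    Nontrivial ((matchingComplex (⊤ : SimpleGraph (Fin n))).ReducedHomology (matchingNu n)) ∧
      IsElementaryAbelianGroup 3
        ((matchingComplex (⊤ : SimpleGraph (Fin n))).ReducedHomology (matchingNu n)) := by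
  have hcard : (Finset.univ : Finset (Fin n)).card = n := by simp
  obtain ⟨k, hd, h, h'⟩ : ∃ k : ℕ, matchingNu n + 1 = k ∧
      (∃ z ∈ cycleOn k (Finset.univ : Finset (Fin n)), z ∉ bdryOn k Finset.univ) ∧
      cycleOn k (Finset.univ : Finset (Fin n)) ≤ threeTorsion k Finset.univ := by
    -- In the residue class of two, `12 ≤ n` and `n ≠ 14` force `n ≥ 17 = 12 + 5`; in that of zero,
    -- `n ≥ 12`.
    obtain ⟨k, hk, rfl⟩ | ⟨k, rfl⟩ | ⟨k, rfl⟩ : (∃ k, 2 ≤ k ∧ n = 3 * k + 1) ∨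
        (∃ k, n = 3 * (k + 4)) ∨ ∃ k, n = 3 * (k + 4) + 5 := by
      obtain h | h | h : n % 3 = 1 ∨ n % 3 = 0 ∨ n % 3 = 2 := by omega
      · exact Or.inl ⟨n / 3, by omega, by omega⟩
      · exact Or.inr (Or.inl ⟨n / 3 - 4, by omega⟩)
      · exact Or.inr (Or.inr ⟨n / 3 - 5, by omega⟩)
    · exact ⟨k, by simp only [matchingNu]; omega,
        exists_notMem_bdryOn_of_card_one_mod hk hcard,
        fun _ hx => three_smul_mem_of_card_one_mod hk hcard hx⟩
    · exact ⟨k + 4, by simp only [matchingNu]; omega,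
        exists_notMem_bdryOn_fin (by omega) rfl,
        three_smul_mem_of_card_zero_mod (fun _ => cycleOn_le_threeTorsion_of_card_twelve) hcard⟩
    · exact ⟨k + 4 + 2, by simp only [matchingNu]; omega,
        exists_notMem_bdryOn_of_card_two_mod (by omega) hcard,
        three_smul_mem_of_card_two_mod (fun _ => cycleOn_le_threeTorsion_of_card_twelve) hcard⟩
  exact ⟨nontrivial_reducedHomology hd h, isElementaryAbelianGroup_reducedHomology hd h'⟩
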